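/- Let $G$ be a finite graph with vertex set $I$ that is a disjoint union of Dynkin graphs of types $A_n$, $D_n$, $E_6$, $E_7$, $E_8$, and let $k$ be an algebraically closed field. Let $\Phi$ be the root system of $G$ in the root lattice $Q=\bigoplus_{i\in I}\mathbb Z\alpha_i$, where the $\alpha_i$ are the simple roots, and let $\Phi_{\ge -1}=\Phi_{>0}\cup\{-\alpha_i: i\in I\}$ be the set of almost positive roots. Write $[\gamma:\alpha_i]$ for the coefficient of $\alpha_i$ in $\gamma\in Q$. For $i\in I$ let $\sigma_i:Q\to Q$ be the map with $[\sigma_i\gamma:\alpha_j]=[\gamma:\alpha_j]$ for $j\ne i$ and $$[\sigma_i\gamma:\alpha_i]=-[\gamma:\alpha_i]+\sum_{j}\max([\gamma:\alpha_j],0),$$ where the sum is over the neighbours $j$ of $i$ in $G$. Let $\Gamma$ be a quiver with underlying graph $G$. A decorated representation $M=M^+\oplus V$ of $\Gamma$ is a finite-dimensional $k$-representation $M^+=(M_i)_{i\in I}$ of $\Gamma$ together with an $I$-graded finite-dimensional $k$-space $V=(V_i)_{i\in I}$; equivalently, it is a representation of the quiver obtained from $\Gamma$ by adding one isolated vertex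 for every $i\in I$. Its signed dimension vector is $\sum_{i}(\dim M_i-\dim V_i)\alpha_i$. For $\alpha\in\Phi_{\ge -1}$ let $U_\alpha^\Gamma$ be the indecomposable decorated representation with signed dimension vector $\alpha$, which exists and is unique up to isomorphism by Gabriel's theorem. For decorated representations $M=M^+\oplus V$ and $N=N^+\oplus W$ put $$E_\Gamma(M,N)=\mathrm{Ext}^1_\Gamma(M^+,N^+)\oplus \mathrm{Ext}^1_\Gamma(N^+,M^+)^*\oplus\bigoplus_{i\in I}\mathrm{Hom}_k(M_i,W_i)\oplus\bigoplus_{i\in I}\mathrm{Hom}_k(V_i,N_i),$$ and let $(\alpha\|\beta)_\Gamma=\dim_k E_\Gamma(U_\alpha^\Gamma,U_\beta^\Gamma)$ for $\alpha,\beta\in\Phi_{\ge -1}$. A set $C\subseteq\Phi_{\ge -1}$ is $\Gamma$-compatible if $(\alpha\|\beta)_\Gamma=0$ for all $\alpha,\beta\in C$. Let $\Delta_\Gamma$ be the simplicial complex on $\Phi_{\ge -1}$ whose simplices are the nonempty $\Gamma$-compatible sets. If $\Gamma$ and $\Gamma'$ are two quivers with the same underlying graph $G$, then the simplicial complexes $\Delta_\Gamma$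 and $\Delta_{\Gamma'}$ are isomorphic. More precisely, there is a finite sequence $i_1,\dots,i_t$ in $I$ such that $\sigma_{i_1}\circ\cdots\circ\sigma_{i_t}$ restricts to a bijection $e:\Phi_{\ge -1}\to\Phi_{\ge -1}$, and a finite set $C\subseteq\Phi_{\ge -1}$ is a simplex of $\Delta_\Gamma$ if and only if $e(C)$ is a simplex of $\Delta_{\Gamma'}$. -/

import Mathlib

open CategoryTheory CategoryTheory.Limits
open scoped ZeroObject

universe u w

namespace DecoratedQuiver

/-! ### Simply-laced Dynkin graphs -/

/-- The graph on `Fin n` attached to a Cartan matrix: distinct vertices are joined exactly when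
the corresponding matrix entry is nonzero. -/
def diagramGraph {n : ℕ} (A : Matrix (Fin n) (Fin n) ℤ) : SimpleGraph (Fin n) :=
  SimpleGraph.fromRel fun i j => A i j ≠ 0

/-- A connected Dynkin graph of type `A_n`, `D_n` (`n ≥ 4`), `E_6`, `E_7` or `E_8`. -/
def IsConnectedDynkin {J : Type w} (H : SimpleGraph J) : Prop :=
  (∃ n : ℕ, 1 ≤ n ∧ Nonempty (H ≃g diagramGraph (CartanMatrix.A n))) ∨
  (∃ n : ℕ, 4 ≤ n ∧ Nonempty (H ≃g diagramGraph (CartanMatrix.D n))) ∨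
  Nonempty (H ≃g diagramGraph CartanMatrix.E₆) ∨
  Nonempty (H ≃g diagramGraph CartanMatrix.E₇) ∨
  Nonempty (H ≃g diagramGraph CartanMatrix.E₈)

/-- A disjoint union of Dynkin graphs of types `A_n`, `D_n`, `E_6`, `E_7`, `E_8`: every connected
component is one of them. -/
def IsDynkin {I : Type w} (G : SimpleGraph I) : Prop :=
  ∀ c : G.ConnectedComponent, IsConnectedDynkin c.toSimpleGraph

/-! ### The root system of a graph -/

section Roots

variable {I : Type w} [Fintype I] (G : SimpleGraph I)

open Classical in
/-- The simple root `α_i`, as an element of the root lattice `Q = ℤ^I`; the multiplicity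
`[γ : α_i]` is the coordinate `γ i`. -/
noncomputable def simpleRoot (i : I) : I → ℤ := Pi.single i 1

open Classical in
/-- The simple reflection `s_i(γ) = γ - ⟨γ, α_i^∨⟩ α_i` for the simply-laced Cartan matrix
of `G`. -/
noncomputable def simpleReflection (i : I) (γ : I → ℤ) : I → ℤ :=
  γ - (2 * γ i - ∑ j with G.Adj i j, γ j) • simpleRoot i

/-- The roots: the orbits of the simple roots under the Weyl group, which is generated by the
simple reflections. -/
inductive IsRoot : (I → ℤ) → Prop
  | simple (i : I) : IsRoot (simpleRoot i)
  | reflect (i : I) {α : I → ℤ} (hα : IsRoot α) : IsRoot (simpleReflection G i α)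

/-- A positive root: a root that is a nonnegative combination of simple roots. -/
def IsPositiveRoot (α : I → ℤ) : Prop := IsRoot G α ∧ ∀ i, 0 ≤ α i

/-- The set `Φ_{≥ -1}` of almost positive roots: positive roots and negatives of simple roots. -/
def AlmostPositiveRoot : Type w :=
  {α : I → ℤ // IsPositiveRoot G α ∨ ∃ i, α = -simpleRoot i}

open Classical in
/-- The piecewise linear map `σ_i : Q → Q`. -/
noncomputable def sigma (i : I) (γ : I → ℤ) : I → ℤ :=
  Function.update γ i (-γ i + ∑ j with G.Adj j i, max (γ j) 0)

end Roots

/-! ### Quivers with a given underlying graph -/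

/-- A quiver with underlying graph `G`, that is, an orientation of `G`: every edge carries exactly
one arrow, in one of the two directions. -/
structure QuiverOn {I : Type w} (G : SimpleGraph I) where
  /-- there is an arrow from `i` to `j` -/
  arrow : I → I → Prop
  adj_iff : ∀ i j, G.Adj i j ↔ arrow i j ∨ arrow j i
  asymm : ∀ i j, arrow i j → ¬ arrow j i

section Representations

variable (k : Type u) [Field k] {I : Type w} {G : SimpleGraph I}

/-- The vertex set of the quiver, as a type that carries the quiver structure. -/
def QuiverOn.Vertex (_ : QuiverOn G) : Type w := I

instance (Γ : QuiverOn G) : Quiver.{0} Γ.Vertex where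
  Hom i j := PLift (Γ.arrow i j)

/-- The category `rep Γ` of finite-dimensional representations of `Γ` over `k`. A functor on the
path category amounts to a family of spaces and a linear map for every arrow. -/
abbrev Rep (Γ : QuiverOn G) := Paths Γ.Vertex ⥤ FGModuleCat.{u} k

instance (Γ : QuiverOn G) : HasExt.{max w (u + 1)} (Rep k Γ) := HasExt.standard (Rep k Γ)

variable {k} in
/-- The space `M_i` of a representation at a vertex `i`. -/
abbrev Rep.space {Γ : QuiverOn G} (M : Rep k Γ) (i : I) : FGModuleCat.{u} k :=
  M.obj ((Paths.of Γ.Vertex).obj i)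

/-- The category of decorated representations `M = M⁺ ⊕ V` of `Γ`: a representation `M⁺` of `Γ`
together with an `I`-graded finite-dimensional space `V`. This is the category of representations
of the quiver obtained from `Γ` by adding an isolated vertex `i⁻` for every vertex `i`. -/
abbrev DecRep (Γ : QuiverOn G) := Rep k Γ × (I → FGModuleCat.{u} k)

variable {k} {Γ : QuiverOn G}

/-- The direct sum of decorated representations. -/
noncomputable def DecRep.sum (M N : DecRep k Γ) : DecRep k Γ :=
  (M.1 ⊞ N.1, fun i => M.2 i ⊞ N.2 i)

/-- Indecomposable decorated representations: nonzero, and not isomorphic to a direct sum of two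
nonzero decorated representations. -/
def DecRep.IsIndecomposable (M : DecRep k Γ) : Prop :=
  ¬ IsZero M ∧ ∀ A B : DecRep k Γ, Nonempty (M ≅ A.sum B) → IsZero A ∨ IsZero B

/-- The signed dimension vector: its coordinate at `i` is `dim M_i - dim V_i`. -/
noncomputable def DecRep.sdim (M : DecRep k Γ) : I → ℤ :=
  fun i => (Module.finrank k (M.1.space i) : ℤ) - (Module.finrank k (M.2 i) : ℤ)

/-- The space `E_Γ(M, N)`, for `M = M⁺ ⊕ V` and `N = N⁺ ⊕ W`:
`Ext¹(M⁺, N⁺) ⊕ Ext¹(N⁺, M⁺)^* ⊕ Hom^I(M⁺, W) ⊕ Hom^I(V, N⁺)`. -/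
abbrev DecRep.E (M N : DecRep k Γ) :=
  Abelian.Ext M.1 N.1 1 × Module.Dual k (Abelian.Ext N.1 M.1 1) ×
    (∀ i : I, M.1.space i →ₗ[k] N.2 i) × (∀ i : I, M.2 i →ₗ[k] N.1.space i)

variable (k)

open Classical in
/-- The indecomposable decorated representation `U_α` with signed dimension vector `α`. For an
almost positive root `α` of a Dynkin graph it exists and is unique up to isomorphism, by Gabriel's
theorem. For other vectors `α` it is an irrelevant value: some indecomposable of signed dimension
vector `α` if there is one, and zero if there is none. -/
noncomputable def indecomposableOf (Γ : QuiverOn G) (α : I → ℤ) : DecRep k Γ :=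
  if h : ∃ M : DecRep k Γ, M.IsIndecomposable ∧ M.sdim = α then h.choose else (0, fun _ => 0)

variable [Fintype I]

/-- The `Γ`-compatibility degree `(α ‖ β)_Γ = dim E_Γ(U_α, U_β)`. -/
noncomputable def compatibilityDegree (Γ : QuiverOn G) (α β : AlmostPositiveRoot G) : ℕ :=
  Module.finrank k ((indecomposableOf k Γ α.1).E (indecomposableOf k Γ β.1))

/-- `Γ`-compatible sets of almost positive roots. -/
def IsCompatible (Γ : QuiverOn G) (C : Set (AlmostPositiveRoot G)) : Prop :=
  ∀ α ∈ C, ∀ β ∈ C, compatibilityDegree k Γ α β = 0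

/-- The simplicial complex `Δ_Γ`: its vertices are almost positive roots, and its faces are the
nonempty finite `Γ`-compatible sets. -/
def compatibleComplex (Γ : QuiverOn G) : PreAbstractSimplicialComplex (AlmostPositiveRoot G) where
  faces := {C | C.Nonempty ∧ IsCompatible k Γ (C : Set (AlmostPositiveRoot G))}
  isRelLowerSet_faces := by
    intro C hC
    exact ⟨hC.1, fun D hDC hD => ⟨hD, fun α hα β hβ => hC.2 α (hDC hα) β (hDC hβ)⟩⟩

end Representations

end DecoratedQuiver

open DecoratedQuiver

/-! The compatibility degree is a number read off from the Euler form. For a positive root against a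
positive root it is max(0, -⟨α,β⟩) + max(0, -⟨β,α⟩); for -α_i against a positive root it is the
coefficient of α_i; for two negative simple roots it is 0 (`compatibilityDegree_root_root` and its
companions). Once this is known, the effect of σ_i at a sink i can be checked by hand. On positive
roots other than α_i it is the simple reflection, which carries the Euler form of Γ to that of the
quiver with the arrows at i reversed (`eulerForm_reverseAt`). It exchanges α_i and -α_i, and there a
coefficient of α_i turns into the dimension of an Ext space (`compatibilityDegree_sigmaEquiv`).
Since the graph is a forest, any two orientations are linked by reversals at sinks, and the
composite of the corresponding σ_i preserves all degrees.

The formula for two positive roots rests on two facts. The standard injective coresolution of length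
one gives dim Hom - dim Ext¹ = ⟨M,N⟩ (`finrank_hom_sub_finrank_ext`). For indecomposables whose
dimension vectors are roots, dim Hom = max(0, ⟨M,N⟩) (`finrank_homs_eq_max`): apply reflection
functors to both representations until one of them is simple at a sink, where the claim is
immediate. Indecomposability is used as "every idempotent endomorphism is 0 or 1", which reflection
preserves. Running reflections backwards from a simple representation also shows that every positive
root is realised. Only the dimension vector and the idempotents of the chosen indecomposable matter,
so the uniqueness half of Gabriel's theorem is never needed.

Reflections at sinks do reach a simple root (`IsPositiveWeight.reachesSimple`). Otherwise the orbit
of a positive root under a Coxeter element would consist of positive vectors of norm 2. It would be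
finite, and the sum over a period would be fixed by the Coxeter element, hence by all simple
reflections, hence zero.

The Dynkin hypothesis enters through one certificate, a positive vector z on which the Cartan matrix
is positive. It yields positive definiteness, finiteness of the set of vectors of norm 2, and the
existence of leaves. -/

namespace DecoratedQuiver

/-! ### Positive weights on Dynkin graphs -/

section Weights

open Classical

/-- The sum of the coordinates of `x` over the neighbours of `i`. -/
noncomputable def neighborSum {I : Type w} [Fintype I] (G : SimpleGraph I) (x : I → ℤ) (i : I) : ℤ :=
  ∑ j with G.Adj i j, x j

/-- A positive vector on which the Cartan matrix of `G` takes positive values. -/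
def IsPositiveWeight {I : Type w} [Fintype I] (G : SimpleGraph I) (x : I → ℤ) : Prop :=
  ∀ i, 0 < x i ∧ neighborSum G x i < 2 * x i

lemma IsPositiveWeight.of_iso {I : Type*} {J : Type*} [Fintype I] [Fintype J]
    {G : SimpleGraph I} {H : SimpleGraph J} (f : G ≃g H) {x : J → ℤ}
    (hx : IsPositiveWeight H x) : IsPositiveWeight G (fun i => x (f i)) := by
  intro i
  refine ⟨(hx (f i)).1, ?_⟩
  have := (hx (f i)).2
  convert this using 1
  unfold neighborSum
  refine Finset.sum_bij (fun j _ => f j) ?_ ?_ ?_ ?_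
  · intro j hj
    simpa [f.map_adj_iff] using hj
  · intro a _ b _ h
    exact f.injective h
  · intro b hb
    refine ⟨f.symm b, ?_, by simp⟩
    simp only [Finset.mem_filter, Finset.mem_univ, true_and] at hb ⊢
    rw [← f.map_adj_iff]
    simpa using hb
  · intro j _
    rfl

/-- Lets the end vertices of a chain be treated like interior ones: a missing neighbour contributes
a nonnegative value of U, so the sum over the actual neighbours only gets larger. -/
lemma sum_fin_le_sum_int {n : ℕ} (S : Finset (Fin n)) (T : Finset ℤ) (U : ℤ → ℤ)
    (hT : ∀ t ∈ T, 0 ≤ U t) (hST : ∀ j ∈ S, ((j : ℕ) : ℤ) ∈ T) :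
    ∑ j ∈ S, U ((j : ℕ) : ℤ) ≤ ∑ t ∈ T, U t := by
  have h : ∑ j ∈ S, U ((j : ℕ) : ℤ) = ∑ t ∈ S.image (fun j : Fin n => ((j : ℕ) : ℤ)), U t := by
    rw [Finset.sum_image]
    intro a _ b _ hab
    exact Fin.ext (by simpa using hab)
  rw [h]
  refine Finset.sum_le_sum_of_subset_of_nonneg ?_ (fun t ht _ => hT t ht)
  intro t ht
  obtain ⟨j, hj, rfl⟩ := Finset.mem_image.1 ht
  exact hST j hj

lemma exists_isPositiveWeight_A (n : ℕ) :
    ∃ x, IsPositiveWeight (diagramGraph (CartanMatrix.A n)) x := by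
  -- Coefficients of the sum of the positive roots, on which the Cartan matrix is constantly 2. As a
  -- function on ℤ it vanishes at -1 and n, just outside the chain.
  let U : ℤ → ℤ := fun t => (t + 1) * (n - t)
  refine ⟨fun i => U ((i : ℕ) : ℤ), fun i => ?_⟩
  have hi : ((i : ℕ) : ℤ) < n := by exact_mod_cast i.2
  have hi0 : (0 : ℤ) ≤ ((i : ℕ) : ℤ) := by positivity
  refine ⟨mul_pos (by linarith) (by linarith), ?_⟩
  refine lt_of_le_of_lt (sum_fin_le_sum_int _ {((i : ℕ) : ℤ) - 1, ((i : ℕ) : ℤ) + 1} U ?_ ?_) ?_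
  · intro t ht
    simp only [Finset.mem_insert, Finset.mem_singleton] at ht
    rcases ht with rfl | rfl <;> exact mul_nonneg (by linarith) (by linarith)
  · intro j hj
    simp only [diagramGraph, SimpleGraph.fromRel_adj, CartanMatrix.A, Matrix.of_apply,
      Finset.mem_filter, Finset.mem_univ, true_and] at hj
    simp only [Finset.mem_insert, Finset.mem_singleton]
    have hij := hj.1
    have hji := hij.symm
    by_cases h : (i : ℕ) + 1 = j ∨ (j : ℕ) + 1 = i
    · omega
    · have h' : ¬ ((j : ℕ) + 1 = i ∨ (i : ℕ) + 1 = j) := by omega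
      simp [hij, hji, h, h'] at hj
  · rw [Finset.sum_pair (by omega)]
    simp only [U]
    nlinarith

lemma exists_isPositiveWeight_D (n : ℕ) (hn : 4 ≤ n) :
    ∃ x, IsPositiveWeight (diagramGraph (CartanMatrix.D n)) x := by
  have hn' : (4 : ℤ) ≤ n := by exact_mod_cast hn
  -- Twice the coefficients of the sum of the positive roots, doubled to avoid the fraction n(n-1)/2
  -- at the two tips of the fork, n-2 and n-1. The branch vertex is n-3, and the value at -1 is 0.
  let U : ℤ → ℤ := fun t => if t ≤ n - 3 then 2 * (t + 1) * (2 * n - 2 - t) else n * (n - 1)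
  have hU : ∀ t : ℤ, -1 ≤ t → 0 ≤ U t := by
    intro t ht
    simp only [U]
    split_ifs
    · exact mul_nonneg (by linarith) (by linarith)
    · nlinarith
  refine ⟨fun i => U ((i : ℕ) : ℤ), fun i => ?_⟩
  have hi : ((i : ℕ) : ℤ) < n := by exact_mod_cast i.2
  have hi0 : (0 : ℤ) ≤ ((i : ℕ) : ℤ) := by positivity
  refine ⟨?_, ?_⟩
  · simp only [U]
    split_ifs
    · exact mul_pos (by linarith) (by linarith)
    · nlinarith
  have key : ∀ j : Fin n, (diagramGraph (CartanMatrix.D n)).Adj i j →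
      ((i : ℕ) + 1 = j ∧ (j : ℕ) + 2 < n) ∨ ((j : ℕ) + 1 = i ∧ (i : ℕ) + 2 < n) ∨
      ((i : ℕ) + 3 = n ∧ ((j : ℕ) + 2 = n ∨ (j : ℕ) + 1 = n)) ∨
      ((j : ℕ) + 3 = n ∧ ((i : ℕ) + 2 = n ∨ (i : ℕ) + 1 = n)) := by
    intro j hj
    by_contra hcon
    simp only [diagramGraph, SimpleGraph.fromRel_adj, CartanMatrix.D, Matrix.of_apply] at hj
    have h2 : ¬ n ≤ 2 := by omega
    push Not at hcon
    obtain ⟨h3, h4, h5, h6⟩ := hcon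
    obtain ⟨hne, hj⟩ := hj
    rcases hj with hj | hj
    · rw [if_neg hne, if_neg h2, if_neg (by omega), if_neg (by omega), if_neg (by omega),
        if_neg (by omega)] at hj
      exact hj rfl
    · rw [if_neg hne.symm, if_neg h2, if_neg (by omega), if_neg (by omega), if_neg (by omega),
        if_neg (by omega)] at hj
      exact hj rfl
  by_cases h1 : (i : ℕ) + 3 < n
  · refine lt_of_le_of_lt (sum_fin_le_sum_int _ {((i : ℕ) : ℤ) - 1, ((i : ℕ) : ℤ) + 1} U ?_ ?_) ?_
    · intro t ht
      simp only [Finset.mem_insert, Finset.mem_singleton] at ht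
      exact hU t (by omega)
    · intro j hj
      have := key j (by simpa using hj)
      simp only [Finset.mem_insert, Finset.mem_singleton]
      omega
    · rw [Finset.sum_pair (by omega)]
      simp only [U]
      rw [if_pos (by omega), if_pos (by omega), if_pos (by omega)]
      nlinarith
  by_cases h2 : (i : ℕ) + 3 = n
  · refine lt_of_le_of_lt (sum_fin_le_sum_int _
      {((i : ℕ) : ℤ) - 1, ((i : ℕ) : ℤ) + 1, ((i : ℕ) : ℤ) + 2} U ?_ ?_) ?_
    · intro t ht
      simp only [Finset.mem_insert, Finset.mem_singleton] at ht
      exact hU t (by omega)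
    · intro j hj
      have := key j (by simpa using hj)
      simp only [Finset.mem_insert, Finset.mem_singleton]
      omega
    · rw [Finset.sum_insert (by simp only [Finset.mem_insert, Finset.mem_singleton]; omega),
        Finset.sum_pair (by omega)]
      simp only [U]
      rw [if_pos (by omega), if_neg (by omega), if_neg (by omega), if_pos (by omega)]
      have : ((i : ℕ) : ℤ) = n - 3 := by omega
      rw [this]
      nlinarith
  · refine lt_of_le_of_lt (sum_fin_le_sum_int _ {(n : ℤ) - 3} U ?_ ?_) ?_
    · intro t ht
      simp only [Finset.mem_singleton] at ht
      exact hU t (by omega)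
    · intro j hj
      have := key j (by simpa using hj)
      simp only [Finset.mem_singleton]
      omega
    · rw [Finset.sum_singleton]
      simp only [U]
      rw [if_pos (by omega), if_neg (by omega)]
      nlinarith

lemma isPositiveWeight_of_forall {n : ℕ} (A : Matrix (Fin n) (Fin n) ℤ) (x : Fin n → ℤ)
    (h : ∀ i, 0 < x i ∧ (∑ j, if i ≠ j ∧ (A i j ≠ 0 ∨ A j i ≠ 0) then x j else 0) < 2 * x i) :
    IsPositiveWeight (diagramGraph A) x := by
  intro i
  refine ⟨(h i).1, lt_of_eq_of_lt ?_ (h i).2⟩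
  unfold neighborSum
  rw [Finset.sum_filter]
  refine Finset.sum_congr rfl fun j _ => ?_
  simp only [diagramGraph, SimpleGraph.fromRel_adj]

lemma exists_isPositiveWeight_E₆ :
    ∃ x, IsPositiveWeight (diagramGraph CartanMatrix.E₆) x := by
  -- Here and for E₇ and E₈: the coefficients of the sum of the positive roots, so that the Cartan
  -- matrix takes the value 2 at every vertex.
  refine ⟨![16, 22, 30, 42, 30, 16], isPositiveWeight_of_forall _ _ fun i => ?_⟩
  fin_cases i <;> simp [Fin.sum_univ_succ, CartanMatrix.E₆]

lemma exists_isPositiveWeight_E₇ :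
    ∃ x, IsPositiveWeight (diagramGraph CartanMatrix.E₇) x := by
  refine ⟨![34, 49, 66, 96, 75, 52, 27], isPositiveWeight_of_forall _ _ fun i => ?_⟩
  fin_cases i <;> simp [Fin.sum_univ_succ, CartanMatrix.E₇]

lemma exists_isPositiveWeight_E₈ :
    ∃ x, IsPositiveWeight (diagramGraph CartanMatrix.E₈) x := by
  refine ⟨![92, 136, 182, 270, 220, 168, 114, 58], isPositiveWeight_of_forall _ _ fun i => ?_⟩
  fin_cases i <;> simp [Fin.sum_univ_succ, CartanMatrix.E₈]

lemma IsConnectedDynkin.exists_isPositiveWeight {J : Type w} [Fintype J] {H : SimpleGraph J}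
    (hH : IsConnectedDynkin H) : ∃ x, IsPositiveWeight H x := by
  rcases hH with ⟨n, -, ⟨f⟩⟩ | ⟨n, hn, ⟨f⟩⟩ | ⟨⟨f⟩⟩ | ⟨⟨f⟩⟩ | ⟨⟨f⟩⟩
  · obtain ⟨x, hx⟩ := exists_isPositiveWeight_A n
    exact ⟨_, hx.of_iso f⟩
  · obtain ⟨x, hx⟩ := exists_isPositiveWeight_D n hn
    exact ⟨_, hx.of_iso f⟩
  · obtain ⟨x, hx⟩ := exists_isPositiveWeight_E₆
    exact ⟨_, hx.of_iso f⟩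
  · obtain ⟨x, hx⟩ := exists_isPositiveWeight_E₇
    exact ⟨_, hx.of_iso f⟩
  · obtain ⟨x, hx⟩ := exists_isPositiveWeight_E₈
    exact ⟨_, hx.of_iso f⟩

/-- All neighbours of a vertex lie in its own component, so weights chosen componentwise glue. -/
lemma IsDynkin.exists_isPositiveWeight {I : Type w} [Fintype I] {G : SimpleGraph I}
    (hG : IsDynkin G) : ∃ x, IsPositiveWeight G x := by
  choose x hx using fun c => (hG c).exists_isPositiveWeight
  refine ⟨fun i => x (G.connectedComponentMk i) ⟨i, rfl⟩, fun i => ?_⟩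
  obtain ⟨h1, h2⟩ := hx (G.connectedComponentMk i) ⟨i, rfl⟩
  refine ⟨h1, lt_of_eq_of_lt ?_ h2⟩
  unfold neighborSum
  symm
  refine Finset.sum_bij (fun j _ => j.1) ?_ ?_ ?_ ?_
  · intro j hj
    exact Finset.mem_filter.2 ⟨Finset.mem_univ _, (Finset.mem_filter.1 hj).2⟩
  · intro a _ b _ h
    exact Subtype.ext h
  · intro b hb
    simp only [Finset.mem_filter, Finset.mem_univ, true_and] at hb
    refine ⟨⟨b, ?_⟩, ?_, rfl⟩
    · exact SimpleGraph.ConnectedComponent.sound hb.symm.reachable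
    · exact Finset.mem_filter.2 ⟨Finset.mem_univ _, hb⟩
  · rintro ⟨j, hj⟩ _
    have : G.connectedComponentMk j = G.connectedComponentMk i := hj
    have key : ∀ (c d : G.ConnectedComponent) (h : c = d) (a : j ∈ c.supp) (b : j ∈ d.supp),
        x c ⟨j, a⟩ = x d ⟨j, b⟩ := by
      rintro c d rfl a b
      rfl
    exact key _ _ this.symm _ _

end Weights

/-! ### The Cartan form and the Euler form -/

section Forms

open Classical

set_option linter.unusedSectionVars false

variable {I : Type w} [Fintype I] {G : SimpleGraph I}

lemma neighborSum_eq (x : I → ℤ) (i : I) :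
    neighborSum G x i = ∑ j, if G.Adj i j then x j else 0 := Finset.sum_filter _ _

lemma neighborSum_add (x y : I → ℤ) (i : I) :
    neighborSum G (x + y) i = neighborSum G x i + neighborSum G y i := by
  simp [neighborSum, Finset.sum_add_distrib]

lemma neighborSum_smul (c : ℤ) (x : I → ℤ) (i : I) :
    neighborSum G (c • x) i = c * neighborSum G x i := by
  simp [neighborSum, Finset.mul_sum]

lemma neighborSum_simpleRoot (i j : I) :
    neighborSum G (simpleRoot i) j = if G.Adj j i then 1 else 0 := by
  rw [neighborSum_eq, Finset.sum_eq_single i]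
  · simp [simpleRoot]
  · intro b _ hb
    simp [simpleRoot, hb]
  · simp

lemma simpleRoot_apply_self (i : I) : (simpleRoot i : I → ℤ) i = 1 := by simp [simpleRoot]

lemma simpleRoot_apply_of_ne {i j : I} (h : j ≠ i) : (simpleRoot i : I → ℤ) j = 0 := by
  simp [simpleRoot, h]

lemma simpleReflection_eq (i : I) (x : I → ℤ) :
    simpleReflection G i x = x + (neighborSum G x i - 2 * x i) • simpleRoot i := by
  unfold simpleReflection
  rw [sub_eq_add_neg, ← neg_smul, neg_sub]
  rfl

lemma simpleReflection_apply_self (i : I) (x : I → ℤ) :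
    simpleReflection G i x i = neighborSum G x i - x i := by
  rw [simpleReflection_eq]
  simp [simpleRoot_apply_self]
  ring

lemma simpleReflection_apply_of_ne {i j : I} (h : j ≠ i) (x : I → ℤ) :
    simpleReflection G i x j = x j := by
  rw [simpleReflection_eq]
  simp [simpleRoot_apply_of_ne h]

lemma neighborSum_simpleReflection (i : I) (x : I → ℤ) :
    neighborSum G (simpleReflection G i x) i = neighborSum G x i := by
  rw [simpleReflection_eq, neighborSum_add, neighborSum_smul, neighborSum_simpleRoot]
  simp

lemma simpleReflection_simpleReflection (i : I) (x : I → ℤ) :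
    simpleReflection G i (simpleReflection G i x) = x := by
  ext j
  by_cases h : j = i
  · subst h
    rw [simpleReflection_apply_self, neighborSum_simpleReflection, simpleReflection_apply_self]
    ring
  · rw [simpleReflection_apply_of_ne h, simpleReflection_apply_of_ne h]

lemma simpleReflection_simpleRoot (i : I) :
    simpleReflection G i (simpleRoot i) = -simpleRoot i := by
  ext j
  by_cases h : j = i
  · subst h
    rw [simpleReflection_apply_self, neighborSum_simpleRoot]
    simp [simpleRoot_apply_self]
  · rw [simpleReflection_apply_of_ne h, Pi.neg_apply, simpleRoot_apply_of_ne h]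
    simp

/-- The symmetric bilinear form of the Cartan matrix of `G`. -/
noncomputable def cartanForm (G : SimpleGraph I) (x y : I → ℤ) : ℤ :=
  ∑ i, x i * (2 * y i - neighborSum G y i)

lemma cartanForm_add_left (x y z : I → ℤ) :
    cartanForm G (x + y) z = cartanForm G x z + cartanForm G y z := by
  simp [cartanForm, add_mul, Finset.sum_add_distrib]

lemma cartanForm_smul_left (c : ℤ) (x z : I → ℤ) :
    cartanForm G (c • x) z = c * cartanForm G x z := by
  simp [cartanForm, mul_assoc, Finset.mul_sum]

lemma cartanForm_simpleRoot_left (i : I) (x : I → ℤ) :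
    cartanForm G (simpleRoot i) x = 2 * x i - neighborSum G x i := by
  simp [cartanForm, simpleRoot, Pi.single_apply]

lemma cartanForm_comm (x y : I → ℤ) : cartanForm G x y = cartanForm G y x := by
  simp only [cartanForm, mul_sub, Finset.sum_sub_distrib, neighborSum_eq, Finset.mul_sum]
  congr 1
  · exact Finset.sum_congr rfl fun i _ => by ring
  · rw [Finset.sum_comm]
    refine Finset.sum_congr rfl fun i _ => Finset.sum_congr rfl fun j _ => ?_
    rw [G.adj_comm]
    split_ifs <;> ring

lemma cartanForm_simpleRoot_self (i : I) : cartanForm G (simpleRoot i) (simpleRoot i) = 2 := by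
  rw [cartanForm_simpleRoot_left, neighborSum_simpleRoot, simpleRoot_apply_self]
  simp

lemma cartanForm_simpleReflection (i : I) (x : I → ℤ) :
    cartanForm G (simpleReflection G i x) (simpleReflection G i x) = cartanForm G x x := by
  set c := neighborSum G x i - 2 * x i with hc
  rw [simpleReflection_eq, ← hc, cartanForm_add_left, cartanForm_smul_left,
    cartanForm_comm x, cartanForm_comm (simpleRoot i), cartanForm_add_left, cartanForm_add_left,
    cartanForm_smul_left, cartanForm_smul_left, cartanForm_simpleRoot_self,
    cartanForm_comm x (simpleRoot i), cartanForm_simpleRoot_left]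
  have : 2 * x i - neighborSum G x i = -c := by rw [hc]; ring
  rw [this]
  ring

/-- The Euler form of a quiver with arrow relation `R`. -/
noncomputable def eulerForm (R : I → I → Prop) (x y : I → ℤ) : ℤ :=
  ∑ i, x i * y i - ∑ i, ∑ j, if R i j then x i * y j else 0

/-- Asymmetry makes each edge count once as an arrow. In particular the norm of a vector is twice an
integer. -/
lemma cartanForm_eq_eulerForm {R : I → I → Prop} (hR : ∀ i j, G.Adj i j ↔ R i j ∨ R j i)
    (hR' : ∀ i j, R i j → ¬ R j i) (x y : I → ℤ) :
    cartanForm G x y = eulerForm R x y + eulerForm R y x := by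
  have h : ∑ i, x i * neighborSum G y i =
      (∑ i, ∑ j, if R i j then x i * y j else 0) + ∑ i, ∑ j, if R i j then y i * x j else 0 := by
    rw [Finset.sum_comm (f := fun i j => if R i j then y i * x j else 0),
      ← Finset.sum_add_distrib]
    refine Finset.sum_congr rfl fun i _ => ?_
    rw [neighborSum_eq, Finset.mul_sum, ← Finset.sum_add_distrib]
    refine Finset.sum_congr rfl fun j _ => ?_
    by_cases h1 : R i j
    · have h2 := hR' i j h1
      simp [hR, h1, h2]
    · by_cases h2 : R j i
      · simp [hR, h1, h2, mul_comm]
      · simp [hR, h1, h2]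
  simp only [cartanForm, eulerForm, mul_sub, Finset.sum_sub_distrib, h]
  have h1 : ∑ i, x i * (2 * y i) = ∑ i, x i * y i + ∑ i, y i * x i := by
    rw [← Finset.sum_add_distrib]
    exact Finset.sum_congr rfl fun i _ => by ring
  rw [h1]
  ring

lemma eulerForm_add_left (R : I → I → Prop) (x y z : I → ℤ) :
    eulerForm R (x + y) z = eulerForm R x z + eulerForm R y z := by
  have : ∀ i j, (if R i j then (x i + y i) * z j else 0) =
      (if R i j then x i * z j else 0) + (if R i j then y i * z j else 0) := by
    intro i j
    split_ifs <;> ring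
  simp only [eulerForm, Pi.add_apply, this]
  simp only [add_mul, Finset.sum_add_distrib]
  ring

lemma eulerForm_add_right (R : I → I → Prop) (x y z : I → ℤ) :
    eulerForm R x (y + z) = eulerForm R x y + eulerForm R x z := by
  have : ∀ i j, (if R i j then x i * (y j + z j) else 0) =
      (if R i j then x i * y j else 0) + (if R i j then x i * z j else 0) := by
    intro i j
    split_ifs <;> ring
  simp only [eulerForm, Pi.add_apply, this]
  simp only [mul_add, Finset.sum_add_distrib]
  ring

lemma eulerForm_smul_left (R : I → I → Prop) (c : ℤ) (x y : I → ℤ) :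
    eulerForm R (c • x) y = c * eulerForm R x y := by
  simp only [eulerForm, Pi.smul_apply, smul_eq_mul, mul_sub, Finset.mul_sum, mul_ite, mul_zero,
    mul_assoc]

lemma eulerForm_smul_right (R : I → I → Prop) (c : ℤ) (x y : I → ℤ) :
    eulerForm R x (c • y) = c * eulerForm R x y := by
  simp only [eulerForm, Pi.smul_apply, smul_eq_mul, mul_sub, Finset.mul_sum, mul_ite, mul_zero,
    mul_left_comm c]

/-- A vertex of a quiver with underlying graph `G` without outgoing arrows. -/
def IsSink (R : I → I → Prop) (i : I) : Prop := ∀ j, ¬ R i j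

/-- The quiver obtained by reversing the arrows that end in `i`, if `i` is a sink. -/
def reverseAt (R : I → I → Prop) (i : I) : I → I → Prop :=
  fun a b => (a = i ∧ R b i) ∨ (b ≠ i ∧ R a b)

lemma eulerForm_simpleRoot_left {R : I → I → Prop} {i : I} (hi : IsSink R i) (x : I → ℤ) :
    eulerForm R (simpleRoot i) x = x i := by
  have h : ∀ a b, (if R a b then (simpleRoot i : I → ℤ) a * x b else 0) = 0 := by
    intro a b
    split_ifs with h
    · rw [simpleRoot_apply_of_ne, zero_mul]
      rintro rfl
      exact hi _ h
    · rfl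
  simp only [eulerForm, h]
  simp [simpleRoot, Pi.single_apply]

lemma eulerForm_simpleRoot_right {R : I → I → Prop} (hR : ∀ i j, G.Adj i j ↔ R i j ∨ R j i)
    {i : I} (hi : IsSink R i) (x : I → ℤ) :
    eulerForm R x (simpleRoot i) = x i - neighborSum G x i := by
  have h : ∀ a, (∑ b, if R a b then x a * (simpleRoot i : I → ℤ) b else 0) =
      if G.Adj i a then x a else 0 := by
    intro a
    rw [Finset.sum_eq_single i]
    · have := hi a
      simp [hR, this, simpleRoot_apply_self]
    · intro b _ hb
      simp [simpleRoot_apply_of_ne hb]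
    · simp
  rw [eulerForm, neighborSum_eq, Finset.sum_congr rfl fun a _ => h a]
  simp [simpleRoot, Pi.single_apply]

/-- Only the terms of the edges at i change: each arrow into i loses its term and contributes the
term of the opposite arrow. -/
lemma eulerForm_reverseAt_apply {R : I → I → Prop} (hR : ∀ i j, G.Adj i j ↔ R i j ∨ R j i)
    {i : I} (hi : IsSink R i) (x y : I → ℤ) :
    eulerForm (reverseAt R i) x y =
      eulerForm R x y - x i * neighborSum G y i + y i * neighborSum G x i := by
  have h : ∀ a b, (if reverseAt R i a b then x a * y b else 0) =
      (if R a b then x a * y b else 0) + (if a = i then (if G.Adj i b then x i * y b else 0) else 0)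
        - (if b = i then (if G.Adj i a then x a * y i else 0) else 0) := by
    intro a b
    have hii := hi i
    by_cases ha : a = i
    · subst ha
      by_cases hb : b = a
      · subst hb
        simp [reverseAt, hii]
      · have := hi b
        simp [reverseAt, hb, hR, this]
    · by_cases hb : b = i
      · subst hb
        have := hi a
        simp [reverseAt, ha, hR, this]
      · simp [reverseAt, ha, hb]
  simp only [eulerForm, h, Finset.sum_sub_distrib, Finset.sum_add_distrib, neighborSum_eq,
    Finset.mul_sum]
  have h1 : ∑ a, ∑ b, (if a = i then (if G.Adj i b then x i * y b else 0) else 0) =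
      ∑ b, x i * if G.Adj i b then y b else 0 := by
    rw [Finset.sum_eq_single i (fun b _ hb => by simp [hb]) (by simp)]
    simp
  have h2 : ∑ a, ∑ b, (if b = i then (if G.Adj i a then x a * y i else 0) else 0) =
      ∑ a, y i * if G.Adj i a then x a else 0 := by
    rw [Finset.sum_comm, Finset.sum_eq_single i (fun b _ hb => by simp [hb]) (by simp)]
    simp [mul_comm]
  rw [h1, h2]
  ring

/-- The numerical shadow of the reflection functor: s_i is an isometry between the Euler forms
before and after the reversal. -/
lemma eulerForm_reverseAt {R : I → I → Prop} (hR : ∀ i j, G.Adj i j ↔ R i j ∨ R j i)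
    {i : I} (hi : IsSink R i) (x y : I → ℤ) :
    eulerForm (reverseAt R i) (simpleReflection G i x) (simpleReflection G i y) =
      eulerForm R x y := by
  rw [eulerForm_reverseAt_apply hR hi, neighborSum_simpleReflection, neighborSum_simpleReflection,
    simpleReflection_apply_self, simpleReflection_apply_self, simpleReflection_eq,
    simpleReflection_eq, eulerForm_add_left, eulerForm_add_right, eulerForm_add_right,
    eulerForm_smul_left, eulerForm_smul_left, eulerForm_smul_right, eulerForm_smul_right,
    eulerForm_simpleRoot_left hi, eulerForm_simpleRoot_left hi, eulerForm_simpleRoot_right hR hi,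
    simpleRoot_apply_self]
  ring

end Forms

/-! ### Root vectors -/

section RootVectors

open Classical

variable {I : Type w} [Fintype I] {G : SimpleGraph I}

/-- Substitute x = z·y. The norm of x becomes Σ z_i (Cz)_i y_i² plus the sum over edges of z_i z_j
(y_i - y_j)², with C the Cartan matrix. As (Cz)_i is a positive integer, the norm is at least Σ z_i
y_i² = Σ x_i²/z_i. -/
lemma IsPositiveWeight.sq_le {z : I → ℤ} (hz : IsPositiveWeight G z) (x : I → ℤ) (i : I) :
    (x i) ^ 2 ≤ z i * cartanForm G x x := by
  have hz0 : ∀ i, (0 : ℝ) < z i := fun i => by exact_mod_cast (hz i).1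
  set y : I → ℝ := fun i => x i / z i with hy
  have hxy : ∀ i, (x i : ℝ) = z i * y i := fun i => by
    rw [hy]
    have := (hz0 i).ne'
    field_simp
  have hB : (cartanForm G x x : ℝ) = ∑ i, (2 * z i ^ 2 * y i ^ 2 -
      ∑ j, if G.Adj i j then (z i * z j) * (y i * y j) else 0) := by
    simp only [cartanForm, neighborSum_eq]
    push_cast
    refine Finset.sum_congr rfl fun i _ => ?_
    rw [mul_sub, Finset.mul_sum]
    congr 1
    · rw [hxy]; ring
    · refine Finset.sum_congr rfl fun j _ => ?_
      split_ifs
      · rw [hxy, hxy]; ring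
      · simp
  have hsym : ∑ i, ∑ j, (if G.Adj i j then (z i * z j : ℝ) * (y j) ^ 2 else 0) =
      ∑ i, ∑ j, (if G.Adj i j then (z i * z j : ℝ) * (y i) ^ 2 else 0) := by
    rw [Finset.sum_comm]
    refine Finset.sum_congr rfl fun i _ => Finset.sum_congr rfl fun j _ => ?_
    rw [G.adj_comm, mul_comm (z j : ℝ)]
  have hle : ∑ i, ∑ j, (if G.Adj i j then (z i * z j : ℝ) * (y i * y j) else 0) ≤
      ∑ i, ∑ j, (if G.Adj i j then (z i * z j : ℝ) * (y i) ^ 2 else 0) := by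
    have : ∑ i, ∑ j, (if G.Adj i j then (z i * z j : ℝ) * (y i * y j) else 0) ≤
        ∑ i, ∑ j, ((if G.Adj i j then (z i * z j : ℝ) * (y i) ^ 2 else 0) / 2 +
          (if G.Adj i j then (z i * z j : ℝ) * (y j) ^ 2 else 0) / 2) := by
      refine Finset.sum_le_sum fun i _ => Finset.sum_le_sum fun j _ => ?_
      split_ifs
      · have h1 := mul_nonneg (mul_pos (hz0 i) (hz0 j)).le (sq_nonneg (y i - y j))
        nlinarith
      · simp
    refine this.trans (le_of_eq ?_)
    simp only [Finset.sum_add_distrib, ← Finset.sum_div, hsym]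
    ring
  have hge : ∑ i, z i * y i ^ 2 ≤ (cartanForm G x x : ℝ) := by
    rw [hB, Finset.sum_sub_distrib]
    refine le_trans ?_ (sub_le_sub_left hle _)
    rw [← Finset.sum_sub_distrib]
    refine Finset.sum_le_sum fun i _ => ?_
    have h1 : ∑ j, (if G.Adj i j then (z i * z j : ℝ) * (y i) ^ 2 else 0) =
        z i * y i ^ 2 * (neighborSum G z i : ℝ) := by
      rw [neighborSum_eq]
      push_cast
      rw [Finset.mul_sum]
      refine Finset.sum_congr rfl fun j _ => ?_
      split_ifs <;> ring
    have h2 : (neighborSum G z i : ℝ) + 1 ≤ 2 * z i := by exact_mod_cast (hz i).2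
    rw [h1]
    nlinarith [mul_nonneg (hz0 i).le (sq_nonneg (y i))]
  have hi : z i * y i ^ 2 ≤ (cartanForm G x x : ℝ) :=
    (Finset.single_le_sum (f := fun i => (z i : ℝ) * y i ^ 2)
      (fun j _ => mul_nonneg (hz0 j).le (sq_nonneg _)) (Finset.mem_univ i)).trans hge
  have : ((x i : ℝ)) ^ 2 ≤ z i * cartanForm G x x := by
    rw [hxy]
    nlinarith [mul_le_mul_of_nonneg_left hi (hz0 i).le]
  exact_mod_cast this

lemma IsPositiveWeight.eq_zero {z : I → ℤ} (hz : IsPositiveWeight G z) {x : I → ℤ}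
    (hx : cartanForm G x x ≤ 0) : x = 0 := by
  ext i
  have h := hz.sq_le x i
  have : (x i) ^ 2 ≤ 0 := h.trans (mul_nonpos_of_nonneg_of_nonpos (hz i).1.le hx)
  simpa using this

lemma IsPositiveWeight.finite {z : I → ℤ} (hz : IsPositiveWeight G z) :
    {x : I → ℤ | cartanForm G x x = 2}.Finite := by
  refine (Set.Finite.pi' fun i => Set.finite_Icc (-(2 * z i)) (2 * z i)).subset ?_
  intro x hx i
  have h := hz.sq_le x i
  rw [Set.mem_ofPred_eq] at hx
  rw [hx] at h
  have := (hz i).1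
  constructor <;> nlinarith

/-- Nonnegative vectors of norm `2` for the Cartan form. -/
def IsRootVector (G : SimpleGraph I) (x : I → ℤ) : Prop := cartanForm G x x = 2 ∧ ∀ i, 0 ≤ x i

lemma isRootVector_simpleRoot (i : I) : IsRootVector G (simpleRoot i) := by
  refine ⟨cartanForm_simpleRoot_self i, fun j => ?_⟩
  by_cases h : j = i
  · rw [h, simpleRoot_apply_self]; norm_num
  · rw [simpleRoot_apply_of_ne h]

lemma IsRoot.cartanForm_eq {x : I → ℤ} (hx : IsRoot G x) : cartanForm G x x = 2 := by
  induction hx with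
  | simple i => exact cartanForm_simpleRoot_self i
  | reflect i _ ih => rw [cartanForm_simpleReflection, ih]

/-- The representation theory below sees positive roots only through norm 2 and nonnegativity; the
converse implication plays no role. -/
lemma IsPositiveRoot.isRootVector {x : I → ℤ} (hx : IsPositiveRoot G x) : IsRootVector G x :=
  ⟨hx.1.cartanForm_eq, hx.2⟩

lemma IsRootVector.ne_zero {x : I → ℤ} (hx : IsRootVector G x) : x ≠ 0 := by
  rintro rfl
  have := hx.1
  simp [cartanForm] at this

lemma IsRootVector.eq_simpleRoot {x : I → ℤ} (hx : IsRootVector G x) {i : I}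
    (h : ∀ j, j ≠ i → x j = 0) : x = simpleRoot i := by
  have h1 : x = x i • simpleRoot i := by
    ext j
    by_cases hj : j = i
    · simp [hj, simpleRoot_apply_self]
    · simp [h j hj, simpleRoot_apply_of_ne hj]
  have h2 : cartanForm G x x = 2 * x i ^ 2 := by
    nth_rewrite 1 [h1]
    rw [cartanForm_smul_left, cartanForm_comm, h1, cartanForm_smul_left,
      cartanForm_simpleRoot_self]
    simp [simpleRoot_apply_self]
    ring
  have h3 : x i = 1 := by
    have := hx.1
    have := hx.2 i
    have h4 : x i ^ 2 = 1 := by linarith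
    nlinarith
  rw [h1, h3, one_smul]

/-- Split x into positive and negative parts p - m. Their supports are disjoint, so (p,m) ≤ 0. The
form is even and positive definite, so if both parts were nonzero the norm of x would be at least 4.
-/
lemma IsPositiveWeight.nonneg_or_nonpos {z : I → ℤ} (hz : IsPositiveWeight G z)
    {R : I → I → Prop} (hR : ∀ i j, G.Adj i j ↔ R i j ∨ R j i) (hR' : ∀ i j, R i j → ¬ R j i)
    {x : I → ℤ} (hx : cartanForm G x x = 2) : (∀ i, 0 ≤ x i) ∨ ∀ i, x i ≤ 0 := by
  set p : I → ℤ := fun i => max (x i) 0 with hp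
  set m : I → ℤ := fun i => max (-x i) 0 with hm
  have hxp : p + (-1 : ℤ) • m = x := by
    ext i
    simp only [hp, hm, Pi.add_apply, Pi.smul_apply, smul_eq_mul]
    omega
  have hpm : cartanForm G p m ≤ 0 := by
    refine Finset.sum_nonpos fun i _ => ?_
    have h1 : p i * m i = 0 := by
      rcases le_total (x i) 0 with h | h
      · simp [hp, h]
      · simp [hm, h]
    have h2 : 0 ≤ neighborSum G m i := Finset.sum_nonneg fun j _ => le_max_right _ _
    have h3 : 0 ≤ p i := le_max_right _ _
    nlinarith
  have hB : cartanForm G p p + cartanForm G m m - 2 * cartanForm G p m = 2 := by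
    have h1 : ∀ y, cartanForm G x y = cartanForm G p y - cartanForm G m y := by
      intro y
      rw [← hxp, cartanForm_add_left, cartanForm_smul_left]
      ring
    refine Eq.trans ?_ hx
    rw [h1 x, cartanForm_comm p x, cartanForm_comm m x, h1, h1, cartanForm_comm m p]
    ring
  have even : ∀ y : I → ℤ, 0 < cartanForm G y y → 2 ≤ cartanForm G y y := by
    intro y hy
    rw [cartanForm_eq_eulerForm hR hR'] at hy ⊢
    omega
  by_cases h1 : p = 0
  · right
    intro i
    have := congrFun h1 i
    simpa [hp] using this
  · left
    have hp2 : 2 ≤ cartanForm G p p := even p (by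
      by_contra hcon
      exact h1 (hz.eq_zero (not_lt.1 hcon)))
    have hm0 : m = 0 := hz.eq_zero (by linarith)
    intro i
    have := congrFun hm0 i
    simpa [hm] using this

/-- Reflection changes only the i-th coordinate. If the result were nonpositive, all other
coordinates of x would vanish, which leaves only α_i. -/
lemma IsRootVector.reflect {z : I → ℤ} (hz : IsPositiveWeight G z)
    {R : I → I → Prop} (hR : ∀ i j, G.Adj i j ↔ R i j ∨ R j i) (hR' : ∀ i j, R i j → ¬ R j i)
    {x : I → ℤ} (hx : IsRootVector G x) {i : I} (hxi : x ≠ simpleRoot i) :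
    IsRootVector G (simpleReflection G i x) := by
  have h2 : cartanForm G (simpleReflection G i x) (simpleReflection G i x) = 2 := by
    rw [cartanForm_simpleReflection, hx.1]
  refine ⟨h2, ?_⟩
  rcases hz.nonneg_or_nonpos hR hR' h2 with h | h
  · exact h
  · exfalso
    refine hxi (hx.eq_simpleRoot fun j hj => le_antisymm ?_ (hx.2 j))
    have := h j
    rwa [simpleReflection_apply_of_ne hj] at this

lemma reflect_ne_simpleRoot {x : I → ℤ} (hx : ∀ j, 0 ≤ x j) (i : I) :
    simpleReflection G i x ≠ simpleRoot i := by
  intro h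
  have := congrArg (simpleReflection G i) h
  rw [simpleReflection_simpleReflection, simpleReflection_simpleRoot] at this
  have h2 := hx i
  rw [this, Pi.neg_apply, simpleRoot_apply_self] at h2
  norm_num at h2

end RootVectors

/-! ### Height functions and orientations -/

section Heights

open Classical

set_option linter.unusedSectionVars false

variable {I : Type w} {G : SimpleGraph I}

/-- Height functions on `G`: they differ by one along every edge. -/
def IsHeight (G : SimpleGraph I) (h : I → ℤ) : Prop :=
  ∀ i j, G.Adj i j → h i = h j + 1 ∨ h j = h i + 1

/-- The arrow relation of the orientation of `G` in which the arrows descend. -/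
def descends (G : SimpleGraph I) (h : I → ℤ) (i j : I) : Prop := G.Adj i j ∧ h i = h j + 1

lemma IsHeight.adj_iff {h : I → ℤ} (hh : IsHeight G h) (i j : I) :
    G.Adj i j ↔ descends G h i j ∨ descends G h j i := by
  constructor
  · intro hij
    rcases hh i j hij with h1 | h1
    · exact Or.inl ⟨hij, h1⟩
    · exact Or.inr ⟨hij.symm, h1⟩
  · rintro (h1 | h1)
    · exact h1.1
    · exact h1.1.symm

lemma descends_asymm {h : I → ℤ} (i j : I) (hij : descends G h i j) : ¬ descends G h j i := by
  intro hji
  have h1 := hij.2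
  have h2 := hji.2
  omega

/-- The height function obtained by moving a vertex up. -/
noncomputable def raise (h : I → ℤ) (i : I) : I → ℤ := Function.update h i (h i + 2)

lemma raise_self (h : I → ℤ) (i : I) : raise h i i = h i + 2 := by simp [raise]

lemma raise_of_ne (h : I → ℤ) {i j : I} (hj : j ≠ i) : raise h i j = h j := by simp [raise, hj]

lemma IsHeight.eq_of_isSink {h : I → ℤ} (hh : IsHeight G h) {i : I} (hi : IsSink (descends G h) i)
    {j : I} (hij : G.Adj i j) : h j = h i + 1 := by
  rcases hh i j hij with h1 | h1
  · exact absurd ⟨hij, h1⟩ (hi j)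
  · exact h1

/-- All neighbours of a sink lie one above it, so after a move by 2 they lie one below it. -/
lemma IsHeight.raise {h : I → ℤ} (hh : IsHeight G h) {i : I} (hi : IsSink (descends G h) i) :
    IsHeight G (raise h i) := by
  intro a b hab
  by_cases ha : a = i
  · subst ha
    rw [raise_self, raise_of_ne h hab.ne']
    have := hh.eq_of_isSink hi hab
    omega
  · by_cases hb : b = i
    · subst hb
      rw [raise_self, raise_of_ne h hab.ne]
      have := hh.eq_of_isSink hi hab.symm
      omega
    · rw [raise_of_ne h ha, raise_of_ne h hb]
      exact hh a b hab

lemma IsHeight.descends_raise {h : I → ℤ} (hh : IsHeight G h) {i : I}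
    (hi : IsSink (descends G h) i) : descends G (DecoratedQuiver.raise h i) =
      reverseAt (descends G h) i := by
  funext a b
  rw [eq_iff_iff]
  unfold reverseAt descends
  by_cases ha : a = i
  · subst ha
    by_cases hb : b = a
    · subst hb
      simp
    · simp only [raise_self, raise_of_ne h hb, true_and, hb, ne_eq, not_false_eq_true]
      constructor
      · rintro ⟨h1, h2⟩
        exact Or.inl ⟨h1.symm, by omega⟩
      · rintro (⟨h1, h2⟩ | ⟨h1, h2⟩)
        · exact ⟨h1.symm, by omega⟩
        · exact absurd ⟨h1, h2⟩ (hi b)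
  · by_cases hb : b = i
    · subst hb
      simp only [raise_self, raise_of_ne h ha, ha, false_and, ne_eq, not_true, false_or, iff_false]
      rintro ⟨h1, h2⟩
      have := hh.eq_of_isSink hi h1.symm
      omega
    · simp [raise_of_ne h ha, raise_of_ne h hb, ha, hb]

lemma descends_add (h : I → ℤ) (c : ℤ) : descends G (fun i => h i + c) = descends G h := by
  funext a b
  rw [eq_iff_iff]
  unfold descends
  beta_reduce
  constructor <;> rintro ⟨h1, h2⟩ <;> exact ⟨h1, by omega⟩

lemma IsHeight.neg {h : I → ℤ} (hh : IsHeight G h) : IsHeight G fun i => -h i := by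
  intro i j hij
  beta_reduce
  rcases hh i j hij with h1 | h1 <;> omega

variable [Fintype I]

/-- Every nonempty set of vertices of a Dynkin graph contains a leaf or an isolated vertex. -/
lemma IsPositiveWeight.exists_card_le_one {z : I → ℤ} (hz : IsPositiveWeight G z) {S : Finset I}
    (hS : S.Nonempty) : ∃ i ∈ S, (S.filter fun j => G.Adj i j).card ≤ 1 := by
  by_contra! hcon
  -- If every vertex of S had two neighbours in S, the indicator vector of S would have nonpositive
  -- norm.
  set x : I → ℤ := fun i => if i ∈ S then 1 else 0 with hx
  have h0 : cartanForm G x x ≤ 0 := by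
    refine Finset.sum_nonpos fun i _ => ?_
    by_cases hi : i ∈ S
    · have h1 : neighborSum G x i = ((S.filter fun j => G.Adj i j).card : ℤ) := by
        rw [neighborSum, hx, Finset.sum_ite_mem, Finset.sum_const, nsmul_eq_mul, mul_one]
        congr 2
        ext j
        simp [and_comm]
      have h2 := hcon i hi
      have h3 : x i = 1 := by simp [hx, hi]
      rw [h1, h3]
      omega
    · simp [hx, hi]
  obtain ⟨i, hi⟩ := hS
  have := congrFun (hz.eq_zero h0) i
  simp [hx, hi] at this

/-- Two orientations of a Dynkin graph have height functions of the same parity. -/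
lemma IsPositiveWeight.exists_heights {z : I → ℤ} (hz : IsPositiveWeight G z)
    (Γ Γ' : QuiverOn G) : ∃ h h' : I → ℤ, (∀ i j, Γ.arrow i j → h i = h j + 1) ∧
      (∀ i j, Γ'.arrow i j → h' i = h' j + 1) ∧ ∀ i, (2 : ℤ) ∣ h' i - h i := by
  -- Heights are built on subsets, adding one vertex with at most one neighbour in the rest at each
  -- stage; no cycle condition ever arises.
  suffices H : ∀ (n : ℕ) (S : Finset I), S.card = n → ∃ h h' : I → ℤ,
      (∀ i ∈ S, ∀ j ∈ S, Γ.arrow i j → h i = h j + 1) ∧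
      (∀ i ∈ S, ∀ j ∈ S, Γ'.arrow i j → h' i = h' j + 1) ∧ ∀ i, (2 : ℤ) ∣ h' i - h i by
    obtain ⟨h, h', h1, h2, h3⟩ := H _ Finset.univ rfl
    exact ⟨h, h', fun i j => h1 i (Finset.mem_univ _) j (Finset.mem_univ _),
      fun i j => h2 i (Finset.mem_univ _) j (Finset.mem_univ _), h3⟩
  intro n
  induction n with
  | zero =>
    intro S hS
    rw [Finset.card_eq_zero] at hS
    subst hS
    exact ⟨0, 0, by simp, by simp, by simp⟩
  | succ n ih =>
    intro S hS
    obtain ⟨v, hv, hv1⟩ := hz.exists_card_le_one (S := S) (Finset.card_pos.1 (by omega))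
    obtain ⟨h, h', h1, h2, h3⟩ := ih (S.erase v) (by rw [Finset.card_erase_of_mem hv]; omega)
    have extend : ∀ (Δ : QuiverOn G) (h : I → ℤ) (a : ℤ),
        (∀ i ∈ S.erase v, ∀ j ∈ S.erase v, Δ.arrow i j → h i = h j + 1) →
        (∀ j ∈ S, Δ.arrow v j → a = h j + 1) → (∀ j ∈ S, Δ.arrow j v → h j = a + 1) →
        ∀ i ∈ S, ∀ j ∈ S, Δ.arrow i j →
          Function.update h v a i = Function.update h v a j + 1 := by
      intro Δ h a hS' hv1 hv2 i hi j hj hij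
      have hne : i ≠ j := ((Δ.adj_iff i j).2 (Or.inl hij)).ne
      by_cases hiv : i = v
      · subst hiv
        simpa [Function.update_of_ne hne.symm] using hv1 j hj hij
      · by_cases hjv : j = v
        · subst hjv
          simpa [Function.update_of_ne hne] using hv2 i hi hij
        · rw [Function.update_of_ne hiv, Function.update_of_ne hjv]
          exact hS' i (Finset.mem_erase.2 ⟨hiv, hi⟩) j (Finset.mem_erase.2 ⟨hjv, hj⟩) hij
    by_cases hnb : ∃ p ∈ S, G.Adj v p
    · obtain ⟨p, hp, hvp⟩ := hnb
      have huniq : ∀ j ∈ S, G.Adj v j → j = p := fun j hj hvj =>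
        Finset.card_le_one.1 hv1 j (Finset.mem_filter.2 ⟨hj, hvj⟩) p
          (Finset.mem_filter.2 ⟨hp, hvp⟩)
      -- Either direction of the edge gives the new height the parity of h p + 1, so the parity of
      -- h' - h at p is inherited by v.
      have choice : ∀ (Δ : QuiverOn G) (h : I → ℤ), ∃ a : ℤ, (2 : ℤ) ∣ a - h p - 1 ∧
          (∀ j ∈ S, Δ.arrow v j → a = h j + 1) ∧ (∀ j ∈ S, Δ.arrow j v → h j = a + 1) := by
        intro Δ h
        by_cases hΔ : Δ.arrow v p
        · refine ⟨h p + 1, by simp, fun j hj hvj => ?_, fun j hj hvj => ?_⟩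
          · rw [huniq j hj ((Δ.adj_iff _ _).2 (Or.inl hvj))]
          · have := huniq j hj ((Δ.adj_iff _ _).2 (Or.inr hvj))
            subst this
            exact absurd hvj (Δ.asymm _ _ hΔ)
        · refine ⟨h p - 1, ⟨-1, by ring⟩, fun j hj hvj => ?_, fun j hj hvj => ?_⟩
          · have := huniq j hj ((Δ.adj_iff _ _).2 (Or.inl hvj))
            subst this
            exact absurd hvj hΔ
          · rw [huniq j hj ((Δ.adj_iff _ _).2 (Or.inr hvj))]
            ring
      obtain ⟨a, ha1, ha2, ha3⟩ := choice Γ h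
      obtain ⟨a', ha1', ha2', ha3'⟩ := choice Γ' h'
      refine ⟨Function.update h v a, Function.update h' v a', extend Γ h a h1 ha2 ha3,
        extend Γ' h' a' h2 ha2' ha3', fun i => ?_⟩
      by_cases hi : i = v
      · subst hi
        have := h3 p
        rw [Function.update_self, Function.update_self]
        omega
      · rw [Function.update_of_ne hi, Function.update_of_ne hi]
        exact h3 i
    · push Not at hnb
      refine ⟨h, h', ?_, ?_, h3⟩
      · have := extend Γ h (h v) h1
          (fun j hj hvj => absurd ((Γ.adj_iff _ _).2 (Or.inl hvj)) (hnb j hj))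
          (fun j hj hvj => absurd ((Γ.adj_iff _ _).2 (Or.inr hvj)) (hnb j hj))
        rwa [Function.update_eq_self] at this
      · have := extend Γ' h' (h' v) h2
          (fun j hj hvj => absurd ((Γ'.adj_iff _ _).2 (Or.inl hvj)) (hnb j hj))
          (fun j hj hvj => absurd ((Γ'.adj_iff _ _).2 (Or.inr hvj)) (hnb j hj))
        rwa [Function.update_eq_self] at this

lemma QuiverOn.arrow_eq_descends (Γ : QuiverOn G) {h : I → ℤ}
    (hΓ : ∀ i j, Γ.arrow i j → h i = h j + 1) : Γ.arrow = descends G h := by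
  funext i j
  rw [eq_iff_iff]
  refine ⟨fun hij => ⟨(Γ.adj_iff i j).2 (Or.inl hij), hΓ i j hij⟩, fun ⟨hij, h1⟩ => ?_⟩
  rcases (Γ.adj_iff i j).1 hij with h2 | h2
  · exact h2
  · have := hΓ j i h2
    omega

lemma QuiverOn.isHeight (Γ : QuiverOn G) {h : I → ℤ}
    (hΓ : Γ.arrow = descends G h) : IsHeight G h := by
  intro i j hij
  rw [Γ.adj_iff, hΓ] at hij
  rcases hij with h1 | h1
  · exact Or.inl h1.2
  · exact Or.inr h1.2

/-- The orientation of `G` given by a height function. -/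
def IsHeight.quiver {h : I → ℤ} (hh : IsHeight G h) : QuiverOn G where
  arrow := descends G h
  adj_iff := hh.adj_iff
  asymm := descends_asymm

lemma QuiverOn.ext_arrow {Γ Γ' : QuiverOn G} (h : Γ.arrow = Γ'.arrow) : Γ = Γ' := by
  cases Γ
  cases Γ'
  cases h
  rfl

/-- Any two orientations of a Dynkin graph are linked by reflections at sinks. -/
lemma IsPositiveWeight.sink_induction {z : I → ℤ} (hz : IsPositiveWeight G z)
    (P : QuiverOn G → QuiverOn G → Prop) (refl : ∀ Γ, P Γ Γ)
    (step : ∀ (Γ₁ Γ₂ Γ₃ : QuiverOn G) (i : I), IsSink Γ₁.arrow i →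
      Γ₂.arrow = reverseAt Γ₁.arrow i → P Γ₂ Γ₃ → P Γ₁ Γ₃) (Γ Γ' : QuiverOn G) : P Γ Γ' := by
  obtain ⟨h, h', h1, h2, h3⟩ := hz.exists_heights Γ Γ'
  -- Adding the constant 2N to h' changes neither its orientation nor parities, and places it above
  -- h. It then remains to climb from h to h' by raising sinks.
  obtain ⟨N, hN⟩ : ∃ N : ℤ, ∀ i, h i - h' i ≤ 2 * N := by
    refine ⟨∑ i, |h i - h' i|, fun i => ?_⟩
    have := Finset.single_le_sum (f := fun i => |h i - h' i|) (fun j _ => abs_nonneg _)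
      (Finset.mem_univ i)
    have h4 := le_abs_self (h i - h' i)
    have h5 := abs_nonneg (h i - h' i)
    linarith
  have key : ∀ (n : ℕ) (h h' : I → ℤ) (Γ Γ' : QuiverOn G), Γ.arrow = descends G h →
      Γ'.arrow = descends G h' → (∀ i, (2 : ℤ) ∣ h' i - h i) → (∀ i, h i ≤ h' i) →
      (∑ i, (h' i - h i)).toNat = n → P Γ Γ' := by
    intro n
    induction n using Nat.strong_induction_on with
    | _ n ih =>
      intro h h' Γ Γ' h1 h2 h3 h4 hn
      by_cases heq : h = h'
      · subst heq
        rw [QuiverOn.ext_arrow (h1.trans h2.symm)]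
        exact refl _
      · obtain ⟨i0, hi0⟩ := Function.ne_iff.1 heq
        -- A lowest vertex still below its target is a sink. A lower neighbour j would already be at
        -- its target, while h' i ≥ h i + 2 by parity, so h' would differ by at least 3 along the
        -- edge.
        obtain ⟨i, hi, himin⟩ := (Finset.univ.filter fun i => h i < h' i).exists_min_image h
          ⟨i0, by simpa using lt_of_le_of_ne (h4 i0) hi0⟩
        simp only [Finset.mem_filter, Finset.mem_univ, true_and] at hi himin
        have hh := Γ.isHeight h1
        have hh' := Γ'.isHeight h2
        have hsink : IsSink (descends G h) i := by
          rintro j ⟨hij, hj⟩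
          have h5 : h j = h' j := by
            by_contra hne
            have := himin j (lt_of_le_of_ne (h4 j) hne)
            omega
          have h6 := h3 i
          have h7 := hh' i j hij
          omega
        refine step Γ (hh.raise hsink).quiver Γ' i (by rw [h1]; exact hsink)
          (by rw [h1, ← hh.descends_raise hsink]; rfl) ?_
        have hsum : ∑ j, (h' j - raise h i j) = ∑ j, (h' j - h j) - 2 := by
          have : ∀ j, h' j - raise h i j = (h' j - h j) - if j = i then 2 else 0 := by
            intro j
            by_cases hj : j = i
            · subst hj
              rw [raise_self, if_pos rfl]
              ring
            · rw [raise_of_ne h hj, if_neg hj]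
              ring
          rw [Finset.sum_congr rfl fun j _ => this j, Finset.sum_sub_distrib]
          simp
        have hle : ∀ j, raise h i j ≤ h' j := by
          intro j
          by_cases hj : j = i
          · subst hj
            have h6 := h3 j
            rw [raise_self]
            omega
          · rw [raise_of_ne h hj]
            exact h4 j
        have hpos : 0 ≤ ∑ j, (h' j - raise h i j) :=
          Finset.sum_nonneg fun j _ => by linarith [hle j]
        refine ih (∑ j, (h' j - raise h i j)).toNat (by omega) (raise h i) h' _ Γ' rfl h2
          (fun j => ?_) hle rfl
        by_cases hj : j = i
        · subst hj
          have h6 := h3 j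
          rw [raise_self]
          omega
        · rw [raise_of_ne h hj]
          exact h3 j
  refine key _ h (fun i => h' i + 2 * N) Γ Γ' (Γ.arrow_eq_descends h1) ?_ (fun i => ?_)
    (fun i => by linarith [hN i]) rfl
  · rw [descends_add]
    exact Γ'.arrow_eq_descends h2
  · have := h3 i
    omega

end Heights

/-! ### Reaching simple roots by reflections at sinks -/

section Reach

open Classical

set_option linter.unusedSectionVars false

variable {I : Type w} [Fintype I] {G : SimpleGraph I}

/-- Some sequence of reflections at sinks takes `x` to a simple root at a sink. -/
inductive ReachesSimple (G : SimpleGraph I) : (I → ℤ) → (I → ℤ) → Prop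
  | simple {h : I → ℤ} {i : I} (hi : IsSink (descends G h) i) : ReachesSimple G h (simpleRoot i)
  | reflect {h x : I → ℤ} {i : I} (hi : IsSink (descends G h) i) (hx : x ≠ simpleRoot i)
      (hr : ReachesSimple G (raise h i) (simpleReflection G i x)) : ReachesSimple G h x

/-- The successive vertices of `l` are sinks that lead from `h` to `h'`. -/
inductive IsAdmissible (G : SimpleGraph I) : (I → ℤ) → List I → (I → ℤ) → Prop
  | nil (h : I → ℤ) : IsAdmissible G h [] h
  | cons {h h' : I → ℤ} {i : I} {l : List I} (hi : IsSink (descends G h) i)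
      (hl : IsAdmissible G (raise h i) l h') : IsAdmissible G h (i :: l) h'

lemma raise_add (h : I → ℤ) (c : ℤ) (i : I) :
    raise (fun j => h j + c) i = fun j => raise h i j + c := by
  funext j
  by_cases hj : j = i
  · subst hj
    rw [raise_self, raise_self]
    ring
  · rw [raise_of_ne _ hj, raise_of_ne _ hj]

lemma ReachesSimple.add {h x : I → ℤ} (hr : ReachesSimple G h x) (c : ℤ) :
    ReachesSimple G (fun j => h j + c) x := by
  induction hr with
  | simple hi => exact .simple (by rwa [descends_add])
  | reflect hi hx _ ih => exact .reflect (by rwa [descends_add]) hx (by rwa [raise_add])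

/-- Raise the vertices once each, in order of increasing height. With S the set already raised, a
lowest vertex outside S is a sink: its lower neighbours have been moved above it. At the end all
heights have grown by 2, so the orientation is the original one and the product of the reflections
is a Coxeter element. -/
lemma IsHeight.exists_isAdmissible {h : I → ℤ} (hh : IsHeight G h) :
    ∃ l : List I, l.Nodup ∧ (∀ i, i ∈ l) ∧ IsAdmissible G h l fun i => h i + 2 := by
  suffices H : ∀ (n : ℕ) (S : Finset I), (Finset.univ \ S).card = n →
      (∀ i ∈ S, ∀ j, j ∉ S → h i ≤ h j) → ∃ l : List I, l.Nodup ∧ (∀ i, i ∈ l ↔ i ∉ S) ∧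
        IsAdmissible G (fun i => h i + if i ∈ S then 2 else 0) l fun i => h i + 2 by
    obtain ⟨l, h1, h2, h3⟩ := H _ ∅ rfl (by simp)
    exact ⟨l, h1, by simpa using h2, by simpa using h3⟩
  intro n
  induction n with
  | zero =>
    intro S hS _
    have hS' : ∀ i, i ∈ S := by
      intro i
      by_contra hi
      have : i ∈ Finset.univ \ S := by simp [hi]
      rw [Finset.card_eq_zero.1 hS] at this
      simp at this
    refine ⟨[], by simp, by simpa using hS', ?_⟩
    simp only [hS', if_true]
    exact .nil _
  | succ n ih =>
    intro S hS hlow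
    obtain ⟨i, hi, himin⟩ := (Finset.univ \ S).exists_min_image h (Finset.card_pos.1 (by omega))
    simp only [Finset.mem_sdiff, Finset.mem_univ, true_and] at hi himin
    have hcard : (Finset.univ \ insert i S).card = n := by
      rw [Finset.sdiff_insert, Finset.card_erase_of_mem (by simpa using hi)]
      omega
    obtain ⟨l, hl1, hl2, hl3⟩ := ih (insert i S) hcard (by
      intro a ha b hb
      rw [Finset.mem_insert, not_or] at hb
      rcases Finset.mem_insert.1 ha with rfl | ha
      · exact himin b hb.2
      · exact hlow a ha b hb.2)
    refine ⟨i :: l, List.nodup_cons.2 ⟨by simp [hl2], hl1⟩, fun j => ?_, .cons ?_ ?_⟩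
    · rw [List.mem_cons, hl2, Finset.mem_insert]
      by_cases hj : j = i
      · subst hj
        simp [hi]
      · simp [hj]
    · rintro j ⟨hij, hj⟩
      beta_reduce at hj
      rw [if_neg hi] at hj
      by_cases hjS : j ∈ S
      · have h1 := hlow j hjS i hi
        have h2 := hh i j hij
        rw [if_pos hjS] at hj
        omega
      · have h1 := himin j hjS
        rw [if_neg hjS] at hj
        omega
    · convert hl3 using 1
      funext j
      by_cases hj : j = i
      · subst hj
        rw [raise_self]
        simp [hi]
      · rw [raise_of_ne _ hj]
        simp [hj]

/-- The composition of the simple reflections along a list. -/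
noncomputable def reflectAlong (G : SimpleGraph I) (l : List I) (x : I → ℤ) : I → ℤ :=
  l.foldl (fun y i => simpleReflection G i y) x

lemma reflectAlong_cons (i : I) (l : List I) (x : I → ℤ) :
    reflectAlong G (i :: l) x = reflectAlong G l (simpleReflection G i x) := rfl

lemma simpleReflection_add (i : I) (x y : I → ℤ) :
    simpleReflection G i (x + y) = simpleReflection G i x + simpleReflection G i y := by
  ext j
  by_cases hj : j = i
  · subst hj
    simp only [simpleReflection_apply_self, neighborSum_add, Pi.add_apply]
    ring
  · simp only [simpleReflection_apply_of_ne hj, Pi.add_apply]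

lemma reflectAlong_add (l : List I) (x y : I → ℤ) :
    reflectAlong G l (x + y) = reflectAlong G l x + reflectAlong G l y := by
  induction l generalizing x y with
  | nil => rfl
  | cons i l ih => rw [reflectAlong_cons, simpleReflection_add, ih]; rfl

lemma reflectAlong_apply_of_notMem (l : List I) (x : I → ℤ) {j : I} (hj : j ∉ l) :
    reflectAlong G l x j = x j := by
  induction l generalizing x with
  | nil => rfl
  | cons i l ih =>
    rw [List.mem_cons, not_or] at hj
    rw [reflectAlong_cons, ih _ hj.2, simpleReflection_apply_of_ne hj.1]

/-- Each coordinate is changed by one reflection only. Hence the first reflection already gives its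
coordinate the final value, which is the initial one; remove it and repeat. -/
lemma simpleReflection_eq_of_reflectAlong_eq {l : List I} (hl : l.Nodup) {x : I → ℤ}
    (hx : reflectAlong G l x = x) {i : I} (hi : i ∈ l) : simpleReflection G i x = x := by
  induction l with
  | nil => simp at hi
  | cons a l ih =>
    rw [List.nodup_cons] at hl
    rw [reflectAlong_cons] at hx
    have h1 : simpleReflection G a x = x := by
      ext j
      by_cases hj : j = a
      · subst hj
        rw [← reflectAlong_apply_of_notMem (G := G) l (simpleReflection G j x) hl.1, hx]
      · rw [simpleReflection_apply_of_ne hj]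
    rcases List.mem_cons.1 hi with rfl | hi
    · exact h1
    · rw [h1] at hx
      exact ih hl.2 hx hi

lemma IsAdmissible.not_reachesSimple {z : I → ℤ} (hz : IsPositiveWeight G z) {h h' : I → ℤ}
    {l : List I} (hl : IsAdmissible G h l h') (hh : IsHeight G h) {x : I → ℤ}
    (hx : IsRootVector G x) (hr : ¬ ReachesSimple G h x) :
    IsRootVector G (reflectAlong G l x) ∧ ¬ ReachesSimple G h' (reflectAlong G l x) := by
  induction hl generalizing x with
  | nil h => exact ⟨hx, hr⟩
  | @cons h h' i l hi _ ih =>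
    have hxi : x ≠ simpleRoot i := by
      rintro rfl
      exact hr (.simple hi)
    exact ih (hh.raise hi) (hx.reflect hz hh.adj_iff descends_asymm hxi)
      fun hcon => hr (.reflect hi hxi hcon)

/-- Every positive root becomes simple under a suitable sequence of reflections at sinks. -/
theorem IsPositiveWeight.reachesSimple {z : I → ℤ} (hz : IsPositiveWeight G z) {h : I → ℤ}
    (hh : IsHeight G h) {x : I → ℤ} (hx : IsRootVector G x) : ReachesSimple G h x := by
  by_contra hr
  obtain ⟨l, hl1, hl2, hl3⟩ := hh.exists_isAdmissible
  have hit : ∀ n : ℕ, IsRootVector G ((reflectAlong G l)^[n] x) ∧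
      ¬ ReachesSimple G h ((reflectAlong G l)^[n] x) := by
    intro n
    induction n with
    | zero => exact ⟨hx, hr⟩
    | succ n ih =>
      rw [Function.iterate_succ_apply']
      obtain ⟨h1, h2⟩ := hl3.not_reachesSimple hz hh ih.1 ih.2
      -- After a full round all heights are shifted by 2, which is the same orientation, so the
      -- Coxeter element can be iterated.
      exact ⟨h1, fun hcon => h2 (hcon.add 2)⟩
  set c := reflectAlong G l with hc
  obtain ⟨m, n, hmn, heq⟩ := hz.finite.exists_lt_map_eq_of_forall_mem
    (f := fun n : ℕ => c^[n] x) (fun n => (hit n).1.1)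
  -- Two iterates coincide because vectors of norm 2 are finite in number. The sum over a period is
  -- fixed by the Coxeter element.
  set v : I → ℤ := ∑ k ∈ Finset.Ico m n, c^[k] x with hv
  let cHom : (I → ℤ) →+ (I → ℤ) := AddMonoidHom.mk' c (reflectAlong_add l)
  have hcv : c v = v := by
    have h1 : c v = ∑ k ∈ Finset.Ico m n, c^[k + 1] x := by
      change cHom v = _
      rw [hv, map_sum]
      refine Finset.sum_congr rfl fun k _ => ?_
      rw [Function.iterate_succ_apply']
      rfl
    have h2 := Finset.sum_Ico_add' (fun k => c^[k] x) m n 1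
    rw [h1, h2, hv, Finset.sum_Ico_succ_top (by omega), Finset.sum_eq_sum_Ico_succ_bot hmn, ← heq,
      add_comm]
  have hv0 : v = 0 := by
    -- Being fixed by s_i means being orthogonal to α_i; for all i this makes the norm zero.
    refine hz.eq_zero (le_of_eq (Finset.sum_eq_zero fun i _ => ?_))
    have h1 := congrFun (simpleReflection_eq_of_reflectAlong_eq hl1 hcv (hl2 i)) i
    rw [simpleReflection_apply_self] at h1
    have : 2 * v i - neighborSum G v i = 0 := by linarith
    rw [this, mul_zero]
  refine (hit m).1.ne_zero ?_
  ext i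
  have h1 := congrFun hv0 i
  rw [hv, Finset.sum_apply] at h1
  rw [Pi.zero_apply, Finset.sum_eq_zero_iff_of_nonneg (fun k _ => (hit k).1.2 i)] at h1
  exact h1 m (Finset.mem_Ico.2 ⟨le_rfl, hmn⟩)

end Reach

/-! ### Families of spaces and maps -/

section LinearAlgebra

variable {k : Type*} [Field k] {A B C : Type*} [AddCommGroup A] [Module k A] [AddCommGroup B]
  [Module k B] [AddCommGroup C] [Module k C]

lemma exists_comp_eq_of_range_le (g : A →ₗ[k] B) (hg : Function.Injective g) (h : C →ₗ[k] B)
    (hgh : ∀ x, ∃ y, g y = h x) : ∃ f : C →ₗ[k] A, ∀ x, g (f x) = h x := by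
  obtain ⟨l, hl⟩ := LinearMap.exists_leftInverse_of_injective g (LinearMap.ker_eq_bot.2 hg)
  refine ⟨l ∘ₗ h, fun x => ?_⟩
  obtain ⟨y, hy⟩ := hgh x
  have := LinearMap.congr_fun hl y
  simp only [LinearMap.comp_apply, LinearMap.id_apply] at this ⊢
  rw [← hy, this]

lemma exists_comp_eq_of_ker_le (g : B →ₗ[k] A) (hg : Function.Surjective g) (h : B →ₗ[k] C)
    (hgh : ∀ x, g x = 0 → h x = 0) : ∃ f : A →ₗ[k] C, ∀ x, f (g x) = h x := by
  obtain ⟨s, hs⟩ := LinearMap.exists_rightInverse_of_surjective g (LinearMap.range_eq_top.2 hg)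
  refine ⟨h ∘ₗ s, fun x => ?_⟩
  have h1 := LinearMap.congr_fun hs (g x)
  simp only [LinearMap.comp_apply, LinearMap.id_apply] at h1 ⊢
  have h2 := hgh (s (g x) - x) (by rw [map_sub, h1, sub_self])
  rwa [map_sub, sub_eq_zero] at h2

lemma eq_zero_or_id_of_finrank_eq_one [FiniteDimensional k A] (hA : Module.finrank k A = 1)
    (p : A →ₗ[k] A) (hp : p ∘ₗ p = p) : p = 0 ∨ p = LinearMap.id := by
  by_cases h : p = 0
  · exact Or.inl h
  · right
    obtain ⟨x, hx⟩ : ∃ x, p x ≠ 0 := by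
      by_contra! hcon
      exact h (LinearMap.ext hcon)
    ext y
    obtain ⟨c, rfl⟩ := (finrank_eq_one_iff_of_nonzero' (p x) hx).1 hA y
    have := LinearMap.congr_fun hp x
    rw [LinearMap.comp_apply] at this
    simp [this]

end LinearAlgebra

/-- A family of finite-dimensional spaces indexed by `I` with linear maps between them; as a
representation of a quiver on `I`, only the maps along arrows matter. -/
structure SpaceFamily (k : Type u) [Field k] (I : Type w) where
  /-- the space at a vertex -/
  V : I → Type u
  [addCommGroup : ∀ i, AddCommGroup (V i)]
  [module : ∀ i, Module k (V i)]
  [finite : ∀ i, FiniteDimensional k (V i)]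
  /-- the map from the space at one vertex to the space at another one -/
  map : ∀ i j, V i →ₗ[k] V j

namespace SpaceFamily

open Classical

set_option linter.unusedSectionVars false

attribute [instance] addCommGroup module finite

variable {k : Type u} [Field k] {I : Type w}

/-- The dimension vector. -/
noncomputable def dim (M : SpaceFamily k I) : I → ℤ := fun i => Module.finrank k (M.V i)

/-- The morphisms of representations of the quiver with arrow relation `R`. -/
def homs (R : I → I → Prop) (M N : SpaceFamily k I) : Submodule k (∀ i, M.V i →ₗ[k] N.V i) where
  carrier := {f | ∀ i j, R i j → ∀ x, N.map i j (f i x) = f j (M.map i j x)}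
  add_mem' := by
    intro f g hf hg i j hij x
    simp [hf i j hij, hg i j hij]
  zero_mem' := by
    intro i j _ x
    simp
  smul_mem' := by
    intro c f hf i j hij x
    simp [hf i j hij]

/-- Every idempotent endomorphism is trivial. -/
def HasTrivialIdempotents (R : I → I → Prop) (M : SpaceFamily k I) : Prop :=
  ∀ f ∈ homs R M M, (∀ i, f i ∘ₗ f i = f i) → (∀ i, f i = 0) ∨ ∀ i, f i = LinearMap.id

variable [Fintype I]

/-- The map from the sum of the spaces at the sources of the arrows into `i`. -/
noncomputable def arrowSum (R : I → I → Prop) (M : SpaceFamily k I) (i : I) :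
    (∀ j : {j // R j i}, M.V j) →ₗ[k] M.V i :=
  ∑ j : {j // R j i}, M.map j i ∘ₗ LinearMap.proj j

lemma arrowSum_apply (R : I → I → Prop) (M : SpaceFamily k I) (i : I)
    (y : ∀ j : {j // R j i}, M.V j) : arrowSum R M i y = ∑ j : {j // R j i}, M.map j i (y j) := by
  simp [arrowSum, LinearMap.sum_apply]

lemma arrowSum_single (R : I → I → Prop) (M : SpaceFamily k I) (i : I) (j : {j // R j i})
    (x : M.V j) : arrowSum R M i (Pi.single j x) = M.map j i x := by
  rw [arrowSum_apply, Finset.sum_eq_single j]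
  · simp
  · intro b _ hb
    simp [hb]
  · simp

lemma arrowSum_comp {R : I → I → Prop} {M N : SpaceFamily k I} {f : ∀ i, M.V i →ₗ[k] N.V i}
    (hf : f ∈ homs R M N) (i : I) (y : ∀ j : {j // R j i}, M.V j) :
    arrowSum R N i (fun j : {j // R j i} => f j (y j)) = f i (arrowSum R M i y) := by
  rw [arrowSum_apply, arrowSum_apply, map_sum]
  exact Finset.sum_congr rfl fun j _ => hf j i j.2 _

/-- A complement of the image of the incoming maps splits off as copies of the simple representation
at i. The projection onto it, extended by 0, is an endomorphism because i is a sink, so it is 0 or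
the identity. The identity would force M to live at i alone. -/
lemma surjective_arrowSum {G : SimpleGraph I} {R : I → I → Prop} {i : I} (hi : IsSink R i)
    {M : SpaceFamily k I} (hM : M.HasTrivialIdempotents R) (hd : IsRootVector G M.dim)
    (hMi : M.dim ≠ simpleRoot i) : Function.Surjective (arrowSum R M i) := by
  set W := LinearMap.range (arrowSum R M i) with hW
  obtain ⟨s, hs⟩ := LinearMap.exists_rightInverse_of_surjective W.mkQ (Submodule.range_mkQ W)
  have hs' : ∀ x, W.mkQ (s x) = x := fun x => LinearMap.congr_fun hs x
  -- An idempotent with kernel W, because s is a section of the quotient map.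
  set p : M.V i →ₗ[k] M.V i := s ∘ₗ W.mkQ with hp
  have hpW : ∀ j, R j i → ∀ x, p (M.map j i x) = 0 := by
    intro j hj x
    have : M.map j i x ∈ W := ⟨Pi.single ⟨j, hj⟩ x, arrowSum_single R M i ⟨j, hj⟩ x⟩
    rw [hp, LinearMap.comp_apply, Submodule.mkQ_apply, (Submodule.Quotient.mk_eq_zero W).2 this,
      map_zero]
  set f : ∀ j, M.V j →ₗ[k] M.V j := Function.update (fun _ => 0) i p with hf
  have hfi : f i = p := Function.update_self _ _ _
  have hfj : ∀ j, j ≠ i → f j = 0 := fun j hj => Function.update_of_ne hj _ _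
  have hfhom : f ∈ homs R M M := by
    intro a b hab x
    have ha : a ≠ i := by
      rintro rfl
      exact hi b hab
    rw [hfj a ha]
    by_cases hb : b = i
    · subst hb
      rw [hfi, hpW a hab]
      simp
    · rw [hfj b hb]
      simp
  have hidem : ∀ j, f j ∘ₗ f j = f j := by
    intro j
    by_cases hj : j = i
    · subst hj
      rw [hfi]
      ext x
      simp only [hp, LinearMap.comp_apply, hs']
    · rw [hfj j hj]
      simp
  rcases hM f hfhom hidem with h | h
  · intro x
    have h1 : p x = 0 := by rw [← hfi, h i]; rfl
    have h2 : W.mkQ x = 0 := by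
      rw [← hs' (W.mkQ x)]
      change W.mkQ (p x) = 0
      rw [h1, map_zero]
    rw [Submodule.mkQ_apply, Submodule.Quotient.mk_eq_zero] at h2
    exact h2
  · refine absurd (hd.eq_simpleRoot fun j hj => ?_) hMi
    have h1 : (LinearMap.id : M.V j →ₗ[k] M.V j) = 0 := by rw [← h j, hfj j hj]
    have : Subsingleton (M.V j) := ⟨fun x y => by
      have hx := LinearMap.congr_fun h1 x
      have hy := LinearMap.congr_fun h1 y
      simp only [LinearMap.id_apply, LinearMap.zero_apply] at hx hy
      rw [hx, hy]⟩
    unfold dim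
    rw [Module.finrank_zero_of_subsingleton]
    rfl

/-- `M'` arises from `M` by the reflection functor at the sink `i`. -/
structure IsReflection (R : I → I → Prop) (i : I) (M M' : SpaceFamily k I)
    (E : ∀ j, j ≠ i → M.V j ≃ₗ[k] M'.V j) : Prop where
  sink : IsSink R i
  comm : ∀ a b (ha : a ≠ i) (hb : b ≠ i), R a b → ∀ x,
    M'.map a b (E a ha x) = E b hb (M.map a b x)
  inj : ∀ x : M'.V i, (∀ j, R j i → M'.map i j x = 0) → x = 0
  sum_eq_zero : ∀ (x : M'.V i) (y : ∀ j : {j // R j i}, M.V j),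
    (∀ (j : {j // R j i}) (hj : j.1 ≠ i), M'.map i j x = E j hj (y j)) → arrowSum R M i y = 0
  exact : ∀ y : ∀ j : {j // R j i}, M.V j, arrowSum R M i y = 0 →
    ∃ x : M'.V i, ∀ (j : {j // R j i}) (hj : j.1 ≠ i), M'.map i j x = E j hj (y j)
  surj : Function.Surjective (arrowSum R M i)

/-! ### Morphisms and idempotents under reflection at a sink -/

namespace IsReflection

variable {R : I → I → Prop} {i : I} {M M' N N' : SpaceFamily k I}
  {E : ∀ j, j ≠ i → M.V j ≃ₗ[k] M'.V j} {F : ∀ j, j ≠ i → N.V j ≃ₗ[k] N'.V j}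

lemma ne (hE : IsReflection R i M M' E) (j : {j // R j i}) : j.1 ≠ i := by
  intro h
  have := j.2
  rw [h] at this
  exact hE.sink i this

/-- The space at i is a quotient of the sum of its neighbours, so a morphism is determined away from
i. -/
lemma eq_zero (hE : IsReflection R i M M' E) {f : ∀ j, M.V j →ₗ[k] N.V j} (hf : f ∈ homs R M N)
    (h : ∀ j, j ≠ i → f j = 0) : f = 0 := by
  funext j
  by_cases hj : j = i
  · subst hj
    ext x
    obtain ⟨y, rfl⟩ := hE.surj x
    rw [← arrowSum_comp hf, arrowSum_apply]
    refine Finset.sum_eq_zero fun a _ => ?_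
    rw [h a (hE.ne a), LinearMap.zero_apply, map_zero]
  · exact h j hj

/-- Dually, after reflection the space at i embeds in the sum of its neighbours. -/
lemma eq_zero' (hE : IsReflection R i M M' E) (hF : IsReflection R i N N' F)
    {f : ∀ j, M'.V j →ₗ[k] N'.V j} (hf : f ∈ homs (reverseAt R i) M' N')
    (h : ∀ j, j ≠ i → f j = 0) : f = 0 := by
  funext j
  by_cases hj : j = i
  · subst hj
    ext x
    refine hF.inj _ fun a ha => ?_
    rw [hf j a (Or.inl ⟨rfl, ha⟩), h a (hE.ne ⟨a, ha⟩), LinearMap.zero_apply]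
  · exact h j hj

/-- At i the reflected morphism is the map induced on the kernels of the incoming sums. -/
lemma exists_reflected (hE : IsReflection R i M M' E) (hF : IsReflection R i N N' F)
    {f : ∀ j, M.V j →ₗ[k] N.V j} (hf : f ∈ homs R M N) :
    ∃ f' ∈ homs (reverseAt R i) M' N', ∀ j (hj : j ≠ i) x, f' j (E j hj x) = F j hj (f j x) := by
  let inc : ∀ (L L' : SpaceFamily k I) (D : ∀ j : {j // R j i}, L.V j ≃ₗ[k] L'.V j),
      L'.V i →ₗ[k] ∀ j : {j // R j i}, L.V j := fun L L' D =>
    LinearMap.pi fun j => (D j).symm.toLinearMap ∘ₗ L'.map i j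
  set incM := inc M M' (fun j => E j (hE.ne j)) with hincM
  set incN := inc N N' (fun j => F j (hF.ne j)) with hincN
  obtain ⟨φ, hφ⟩ := exists_comp_eq_of_range_le incN (by
      rw [injective_iff_map_eq_zero]
      intro x hx
      refine hF.inj x fun j hj => ?_
      have := congrFun hx ⟨j, hj⟩
      simpa [hincN, inc] using this)
    ((LinearMap.pi fun j => f j ∘ₗ LinearMap.proj j) ∘ₗ incM) (by
      intro x
      obtain ⟨y, hy⟩ := hF.exact (fun j => f j (incM x j)) (by
        rw [arrowSum_comp hf, hE.sum_eq_zero x (incM x) (by intro j hj; simp [hincM, inc]),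
          map_zero])
      refine ⟨y, ?_⟩
      funext j
      simp [hincN, inc, hy j (hF.ne j)])
  have hφ' : ∀ x (j : {j // R j i}), N'.map i j (φ x) =
      F j (hF.ne j) (f j ((E j (hE.ne j)).symm (M'.map i j x))) := by
    intro x j
    have := congrFun (hφ x) j
    simp only [hincN, hincM, inc, LinearMap.pi_apply, LinearMap.comp_apply, LinearMap.proj_apply,
      LinearEquiv.coe_coe] at this
    rw [← this, LinearEquiv.apply_symm_apply]
  set f' : ∀ j, M'.V j →ₗ[k] N'.V j := Function.update
    (fun j => if hj : j = i then 0 else (F j hj).toLinearMap ∘ₗ f j ∘ₗ (E j hj).symm.toLinearMap)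
    i φ with hf'
  have hf'i : f' i = φ := Function.update_self _ _ _
  have hf'j : ∀ j (hj : j ≠ i) x, f' j x = F j hj (f j ((E j hj).symm x)) := by
    intro j hj x
    rw [hf', Function.update_of_ne hj, dif_neg hj]
    rfl
  refine ⟨f', ?_, fun j hj x => by rw [hf'j, LinearEquiv.symm_apply_apply]⟩
  rintro a b (⟨rfl, hb⟩ | ⟨hb, hab⟩) x
  · rw [hf'i, hf'j b (hE.ne ⟨b, hb⟩)]
    exact hφ' x ⟨b, hb⟩
  · have ha : a ≠ i := by
      rintro rfl
      exact hE.sink b hab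
    obtain ⟨x, rfl⟩ := (E a ha).surjective x
    rw [hf'j a ha, hE.comm a b ha hb hab, hf'j b hb, LinearEquiv.symm_apply_apply,
      LinearEquiv.symm_apply_apply, hF.comm a b ha hb hab, hf a b hab]

/-- At i the morphism is induced on the quotients of the sums of neighbours by the kernels, which is
where surjectivity for M is used. -/
lemma exists_unreflected (hE : IsReflection R i M M' E) (hF : IsReflection R i N N' F)
    {f' : ∀ j, M'.V j →ₗ[k] N'.V j} (hf' : f' ∈ homs (reverseAt R i) M' N') :
    ∃ f ∈ homs R M N, ∀ j (hj : j ≠ i) x, f' j (E j hj x) = F j hj (f j x) := by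
  set g : ∀ j, j ≠ i → (M.V j →ₗ[k] N.V j) := fun j hj =>
    (F j hj).symm.toLinearMap ∘ₗ f' j ∘ₗ (E j hj).toLinearMap with hg
  have hgF : ∀ j hj x, F j hj (g j hj x) = f' j (E j hj x) := by
    intro j hj x
    simp [hg]
  obtain ⟨φ, hφ⟩ := exists_comp_eq_of_ker_le (arrowSum R M i) hE.surj
    (arrowSum R N i ∘ₗ LinearMap.pi fun j => g j (hE.ne j) ∘ₗ LinearMap.proj j) (by
      intro y hy
      obtain ⟨x, hx⟩ := hE.exact y hy
      refine hF.sum_eq_zero (f' i x) _ fun j hj => ?_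
      rw [hf' i j (Or.inl ⟨rfl, j.2⟩), hx j hj]
      exact (hgF j hj _).symm)
  set f : ∀ j, M.V j →ₗ[k] N.V j :=
    Function.update (fun j => if hj : j = i then 0 else g j hj) i φ with hf
  have hfi : f i = φ := Function.update_self _ _ _
  have hfj : ∀ j (hj : j ≠ i), f j = g j hj := by
    intro j hj
    rw [hf, Function.update_of_ne hj, dif_neg hj]
  refine ⟨f, ?_, fun j hj x => by rw [hfj j hj, hgF]⟩
  intro a b hab x
  have ha : a ≠ i := by
    rintro rfl
    exact hE.sink b hab
  by_cases hb : b = i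
  · subst hb
    have h1 := hφ (Pi.single ⟨a, hab⟩ x)
    rw [arrowSum_single] at h1
    rw [hfi, h1, hfj a ha]
    have h2 : (LinearMap.pi fun j : {j // R j b} => g j (hE.ne j) ∘ₗ LinearMap.proj j)
        (Pi.single (M := fun j : {j // R j b} => M.V j) ⟨a, hab⟩ x) =
        Pi.single (M := fun j : {j // R j b} => N.V j) ⟨a, hab⟩ (g a ha x) := by
      funext j
      by_cases hj : j = ⟨a, hab⟩
      · subst hj
        simp
      · simp [hj]
    refine Eq.trans ?_ (congrArg (arrowSum R N b) h2.symm)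
    rw [arrowSum_single]
  · rw [hfj a ha, hfj b hb]
    apply (F b hb).injective
    rw [hgF, ← hF.comm a b ha hb hab, hgF, ← hE.comm a b ha hb hab,
      hf' a b (Or.inr ⟨hb, hab⟩)]

/-- Both morphism spaces embed, by restriction away from i, in the same space of families of linear
maps, and there they have the same image. -/
lemma finrank_homs_eq (hE : IsReflection R i M M' E) (hF : IsReflection R i N N' F) :
    Module.finrank k (homs (reverseAt R i) M' N') = Module.finrank k (homs R M N) := by
  let ρ : homs R M N →ₗ[k] ∀ j : {j // j ≠ i}, M.V j →ₗ[k] N.V j :=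
    { toFun := fun f j => f.1 j
      map_add' := fun _ _ => rfl
      map_smul' := fun _ _ => rfl }
  let ρ' : homs (reverseAt R i) M' N' →ₗ[k] ∀ j : {j // j ≠ i}, M.V j →ₗ[k] N.V j :=
    { toFun := fun f j => (F j j.2).symm.toLinearMap ∘ₗ f.1 j ∘ₗ (E j j.2).toLinearMap
      map_add' := fun _ _ => by ext; simp
      map_smul' := fun _ _ => by ext; simp }
  have hρ : Function.Injective ρ := by
    rw [injective_iff_map_eq_zero]
    intro f hf
    exact Subtype.ext (hE.eq_zero f.2 fun j hj => congrFun hf ⟨j, hj⟩)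
  have hρ' : Function.Injective ρ' := by
    rw [injective_iff_map_eq_zero]
    intro f hf
    refine Subtype.ext (hE.eq_zero' hF f.2 fun j hj => ?_)
    ext x
    obtain ⟨x, rfl⟩ := (E j hj).surjective x
    have := LinearMap.congr_fun (congrFun hf ⟨j, hj⟩) x
    simpa [ρ'] using this
  have hrange : LinearMap.range ρ' = LinearMap.range ρ := by
    apply le_antisymm
    · rintro _ ⟨f', rfl⟩
      obtain ⟨f, hf, h⟩ := hE.exists_unreflected hF f'.2
      refine ⟨⟨f, hf⟩, ?_⟩
      funext j
      ext x
      simp [ρ, ρ', h j j.2]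
    · rintro _ ⟨f, rfl⟩
      obtain ⟨f', hf', h⟩ := hE.exists_reflected hF f.2
      refine ⟨⟨f', hf'⟩, ?_⟩
      funext j
      ext x
      simp [ρ, ρ', h j j.2]
  rw [← LinearMap.finrank_range_of_inj hρ, ← LinearMap.finrank_range_of_inj hρ', hrange]

/-- An idempotent is carried back to M. The result is idempotent away from i, hence everywhere,
because morphisms are determined there; the same principle brings 0 or the identity back to M'. -/
lemma hasTrivialIdempotents (hE : IsReflection R i M M' E) (hM : M.HasTrivialIdempotents R) :
    M'.HasTrivialIdempotents (reverseAt R i) := by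
  intro f' hf' hidem
  obtain ⟨f, hf, h⟩ := hE.exists_unreflected hE hf'
  have hff : (fun j => f j ∘ₗ f j) ∈ homs R M M := by
    intro a b hab x
    simp [hf a b hab]
  have hidem' : (fun j => f j ∘ₗ f j) - f = 0 := by
    refine hE.eq_zero (sub_mem hff hf) fun j hj => ?_
    ext x
    simp only [Pi.sub_apply, LinearMap.sub_apply, LinearMap.comp_apply, LinearMap.zero_apply,
      sub_eq_zero]
    apply (E j hj).injective
    rw [← h, ← h, ← LinearMap.comp_apply, hidem]
  rcases hM f hf (fun j => sub_eq_zero.1 (congrFun hidem' j)) with h0 | h0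
  · left
    refine fun j => congrFun (hE.eq_zero' hE hf' fun j hj => ?_) j
    ext x
    obtain ⟨x, rfl⟩ := (E j hj).surjective x
    rw [h, h0]
    simp
  · right
    have hid : (fun j => LinearMap.id) ∈ homs (reverseAt R i) M' M' := fun a b _ x => rfl
    refine fun j => sub_eq_zero.1 (congrFun (hE.eq_zero' hE (sub_mem hf' hid) fun j hj => ?_) j)
    ext x
    obtain ⟨x, rfl⟩ := (E j hj).surjective x
    rw [Pi.sub_apply, LinearMap.sub_apply, h, h0]
    simp

end IsReflection

end SpaceFamily

/-! ### Reflecting representations and the dimension of Hom -/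

namespace SpaceFamily

section Reflections

open Classical

set_option linter.unusedSectionVars false

variable {k : Type u} [Field k] {I : Type w} [Fintype I]

lemma _root_.DecoratedQuiver.IsSink.ne {R : I → I → Prop} {i j : I} (hi : IsSink R i)
    (hj : R j i) : j ≠ i := by
  rintro rfl
  exact hi _ hj

/-- The reflection functor at a sink, on objects. -/
lemma exists_isReflection {R : I → I → Prop} {i : I} (hi : IsSink R i) (M : SpaceFamily k I)
    (hM : Function.Surjective (arrowSum R M i)) :
    ∃ (M' : SpaceFamily k I) (E : ∀ j, j ≠ i → M.V j ≃ₗ[k] M'.V j), IsReflection R i M M' E := by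
  set K := LinearMap.ker (arrowSum R M i) with hK
  -- The kernel is a subspace of a product over vertices, whose universe also depends on I. All
  -- spaces are therefore replaced by coordinate spaces of the same dimension.
  let d : I → ℕ := fun j => if j = i then Module.finrank k K else Module.finrank k (M.V j)
  have hne : ∀ j : {j // R j i}, j.1 ≠ i := fun j => hi.ne j.2
  let E : ∀ j, j ≠ i → M.V j ≃ₗ[k] (Fin (d j) → k) := fun j hj =>
    LinearEquiv.ofFinrankEq _ _ (by simp [d, hj])
  let κ : ∀ j, j = i → ((Fin (d j) → k) ≃ₗ[k] K) := fun j hj =>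
    LinearEquiv.ofFinrankEq _ _ (by simp [d, hj])
  let mp : ∀ a b, (Fin (d a) → k) →ₗ[k] (Fin (d b) → k) := fun a b =>
    if hb : b = i then 0 else
      if ha : a = i then
        if hR : R b i then (E b hb).toLinearMap ∘ₗ
          LinearMap.proj (φ := fun j : {j // R j i} => M.V j) ⟨b, hR⟩ ∘ₗ K.subtype ∘ₗ
            (κ a ha).toLinearMap
        else 0
      else (E b hb).toLinearMap ∘ₗ M.map a b ∘ₗ (E a ha).symm.toLinearMap
  have hmp_i : ∀ (j : {j // R j i}) (x : Fin (d i) → k),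
      mp i j x = E j (hne j) ((κ i rfl x : ∀ j : {j // R j i}, M.V j) j) := by
    intro j x
    have : mp i j = (E j (hne j)).toLinearMap ∘ₗ
        LinearMap.proj (φ := fun j : {j // R j i} => M.V j) j ∘ₗ K.subtype ∘ₗ
          (κ i rfl).toLinearMap :=
      (dif_neg (hne j)).trans ((dif_pos rfl).trans (dif_pos j.2))
    rw [this]
    rfl
  have hmp : ∀ a b (ha : a ≠ i) (hb : b ≠ i) x,
      mp a b x = E b hb (M.map a b ((E a ha).symm x)) := by
    intro a b ha hb x
    simp only [mp]
    rw [dif_neg hb, dif_neg ha]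
    rfl
  refine ⟨⟨fun j => Fin (d j) → k, mp⟩, E, hi, ?_, ?_, ?_, ?_, hM⟩
  · intro a b ha hb _ x
    rw [hmp a b ha hb, LinearEquiv.symm_apply_apply]
  · intro x hx
    have : ((κ i rfl x : K) : ∀ j : {j // R j i}, M.V j) = 0 := by
      funext j
      have h1 := hx j j.2
      rw [hmp_i j x] at h1
      exact (LinearEquiv.map_eq_zero_iff _).1 h1
    exact (LinearEquiv.map_eq_zero_iff _).1 (Subtype.ext this)
  · intro x y hy
    have : y = (κ i rfl x : K) := by
      funext j
      have h1 := hy j (hne j)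
      rw [hmp_i j x] at h1
      exact ((E j (hne j)).injective h1).symm
    rw [this]
    exact (κ i rfl x).2
  · intro y hy
    refine ⟨(κ i rfl).symm ⟨y, hy⟩, fun j hj => ?_⟩
    rw [hmp_i j, LinearEquiv.apply_symm_apply]

/-- Rank-nullity for the surjection from the sum of the neighbours onto M_i, whose kernel is M'_i.
-/
lemma IsReflection.dim_eq {G : SimpleGraph I} {R : I → I → Prop}
    (hR : ∀ i j, G.Adj i j ↔ R i j ∨ R j i) {i : I} {M M' : SpaceFamily k I}
    {E : ∀ j, j ≠ i → M.V j ≃ₗ[k] M'.V j} (hE : IsReflection R i M M' E) :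
    M'.dim = simpleReflection G i M.dim := by
  ext j
  by_cases hj : j = i
  · subst hj
    rw [simpleReflection_apply_self]
    let inc : M'.V j →ₗ[k] ∀ a : {a // R a j}, M.V a :=
      LinearMap.pi fun a => (E a (hE.ne a)).symm.toLinearMap ∘ₗ M'.map j a
    have hinc : Function.Injective inc := by
      rw [injective_iff_map_eq_zero]
      intro x hx
      refine hE.inj x fun a ha => ?_
      simpa [inc] using congrFun hx ⟨a, ha⟩
    have hrange : LinearMap.range inc = LinearMap.ker (arrowSum R M j) := by
      apply le_antisymm
      · rintro _ ⟨x, rfl⟩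
        exact hE.sum_eq_zero x _ fun a ha => by simp [inc]
      · intro y hy
        obtain ⟨x, hx⟩ := hE.exact y hy
        refine ⟨x, ?_⟩
        funext a
        simp [inc, hx a (hE.ne a)]
    have h1 := LinearMap.finrank_range_add_finrank_ker (arrowSum R M j)
    rw [LinearMap.range_eq_top.2 hE.surj, finrank_top, ← hrange,
      LinearMap.finrank_range_of_inj hinc, Module.finrank_pi_fintype] at h1
    have h2 : neighborSum G M.dim j = ∑ a : {a // R a j}, (Module.finrank k (M.V a) : ℤ) := by
      rw [neighborSum, Finset.filter_congr (q := fun a => R a j)]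
      · refine Finset.sum_bij (fun a ha => ⟨a, (Finset.mem_filter.1 ha).2⟩) ?_ ?_ ?_ ?_
        · intro a _
          simp
        · intro a _ b _ h
          exact congrArg Subtype.val h
        · intro b _
          exact ⟨b, by simp [b.2], rfl⟩
        · intro a _
          rfl
      · intro a _
        rw [hR]
        simp [hE.sink a]
    rw [h2]
    unfold dim
    have h3 : (Module.finrank k (M.V j) : ℤ) + Module.finrank k (M'.V j) =
      ∑ a : {a // R a j}, (Module.finrank k (M.V a) : ℤ) := by exact_mod_cast h1
    linarith
  · rw [simpleReflection_apply_of_ne hj]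
    unfold dim
    rw [(E j hj).finrank_eq]

lemma subsingleton_of_dim_eq {M : SpaceFamily k I} {i : I} (hM : M.dim = simpleRoot i) {j : I}
    (hj : j ≠ i) : Subsingleton (M.V j) := by
  have := congrFun hM j
  rw [simpleRoot_apply_of_ne hj] at this
  have h : Module.finrank k (M.V j) = 0 := Int.natCast_eq_zero.1 this
  exact Module.finrank_zero_iff.1 h

lemma finrank_eq_one_of_dim_eq {M : SpaceFamily k I} {i : I} (hM : M.dim = simpleRoot i) :
    Module.finrank k (M.V i) = 1 := by
  have := congrFun hM i
  rw [simpleRoot_apply_self] at this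
  exact Int.ofNat_inj.1 this

/-- With no arrow leaving i, every linear map from the line at i to N_i is a morphism. -/
lemma finrank_homs_of_dim_eq_simpleRoot {R : I → I → Prop} {i : I} (hi : IsSink R i)
    {M : SpaceFamily k I} (hM : M.dim = simpleRoot i) (N : SpaceFamily k I) :
    (Module.finrank k (homs R M N) : ℤ) = N.dim i := by
  let φ : homs R M N →ₗ[k] (M.V i →ₗ[k] N.V i) :=
    { toFun := fun f => f.1 i
      map_add' := fun _ _ => rfl
      map_smul' := fun _ _ => rfl }
  have hφ : Function.Bijective φ := by
    constructor
    · rw [injective_iff_map_eq_zero]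
      intro f hf
      refine Subtype.ext (funext fun j => ?_)
      by_cases hj : j = i
      · subst hj
        exact hf
      · have := subsingleton_of_dim_eq hM hj
        exact Subsingleton.elim _ _
    · intro g
      refine ⟨⟨Function.update 0 i g, fun a b hab x => ?_⟩, Function.update_self i g (0 : ∀ j, M.V j →ₗ[k] N.V j)⟩
      have ha : a ≠ i := by
        rintro rfl
        exact hi b hab
      have := subsingleton_of_dim_eq hM ha
      rw [Subsingleton.elim x 0]
      simp
  rw [(LinearEquiv.ofBijective φ hφ).finrank_eq, Module.finrank_linearMap,
    finrank_eq_one_of_dim_eq hM, one_mul]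
  rfl

/-- A morphism to the simple representation vanishes at the neighbours of i, and their images span
M_i. -/
lemma finrank_homs_to_simple {G : SimpleGraph I} {R : I → I → Prop} {i : I} (hi : IsSink R i)
    {M : SpaceFamily k I} (hM : M.HasTrivialIdempotents R) (hd : IsRootVector G M.dim)
    (hMi : M.dim ≠ simpleRoot i) {N : SpaceFamily k I} (hN : N.dim = simpleRoot i) :
    Module.finrank k (homs R M N) = 0 := by
  have : Subsingleton (homs R M N) := by
    refine subsingleton_of_forall_eq 0 fun f => Subtype.ext (funext fun j => ?_)
    have h0 : ∀ j, j ≠ i → f.1 j = 0 := by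
      intro j hj
      have := subsingleton_of_dim_eq hN hj
      ext x
      exact Subsingleton.elim _ _
    by_cases hj : j = i
    · subst hj
      ext x
      obtain ⟨y, rfl⟩ := surjective_arrowSum hi hM hd hMi x
      rw [← arrowSum_comp f.2, arrowSum_apply]
      refine Finset.sum_eq_zero fun a _ => ?_
      rw [h0 a (hi.ne a.2), LinearMap.zero_apply, map_zero]
    · exact h0 j hj
  exact Module.finrank_zero_of_subsingleton

/-- Gives the sign ⟨M, α_i⟩ ≤ 0 that matches the vanishing of the morphisms to the simple
representation at i. -/
lemma neighborSum_ge_of_surjective {G : SimpleGraph I} {R : I → I → Prop}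
    (hR : ∀ i j, G.Adj i j ↔ R i j ∨ R j i) {i : I} (hi : IsSink R i) {M : SpaceFamily k I}
    (hM : Function.Surjective (arrowSum R M i)) : M.dim i ≤ neighborSum G M.dim i := by
  obtain ⟨M', E, hE⟩ := exists_isReflection hi M hM
  have h1 := congrFun (hE.dim_eq hR) i
  rw [simpleReflection_apply_self] at h1
  have h2 : 0 ≤ M'.dim i := Int.natCast_nonneg _
  linarith

/-- Between two indecomposables whose dimension vectors are roots there are either no morphisms or
no extensions. -/
theorem finrank_homs_eq_max {G : SimpleGraph I} {z : I → ℤ} (hz : IsPositiveWeight G z)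
    {h : I → ℤ} (hh : IsHeight G h) {M N : SpaceFamily k I}
    (hM : M.HasTrivialIdempotents (descends G h)) (hN : N.HasTrivialIdempotents (descends G h))
    (hMd : IsRootVector G M.dim) (hNd : IsRootVector G N.dim) :
    (Module.finrank k (homs (descends G h) M N) : ℤ) =
      max 0 (eulerForm (descends G h) M.dim N.dim) := by
  have hr := hz.reachesSimple hh hMd
  generalize hx : M.dim = x at hr
  -- The induction follows the reflections that make dim M simple. If M is simple at the sink, Hom
  -- is N_i. If N is, both sides are 0. Otherwise both representations can be reflected, preserving
  -- Hom and the Euler form.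
  induction hr generalizing M N with
  | simple hi =>
    rw [finrank_homs_of_dim_eq_simpleRoot hi hx, eulerForm_simpleRoot_left hi,
      max_eq_right (hNd.2 _)]
  | @reflect h x i hi hxi _ ih =>
    have hMsurj := surjective_arrowSum hi hM hMd (by rwa [hx])
    by_cases hNi : N.dim = simpleRoot i
    · rw [finrank_homs_to_simple hi hM hMd (by rwa [hx]) hNi, hNi,
        eulerForm_simpleRoot_right hh.adj_iff hi, max_eq_left]
      · rfl
      · have := neighborSum_ge_of_surjective hh.adj_iff hi hMsurj
        rw [hx] at this
        linarith
    · have hNsurj := surjective_arrowSum hi hN hNd hNi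
      obtain ⟨M', E, hE⟩ := exists_isReflection hi M hMsurj
      obtain ⟨N', F, hF⟩ := exists_isReflection hi N hNsurj
      have hMd' := hE.dim_eq hh.adj_iff
      have hNd' := hF.dim_eq hh.adj_iff
      have := ih (hh.raise hi) (M := M') (N := N')
        (by rw [hh.descends_raise hi]; exact hE.hasTrivialIdempotents hM)
        (by rw [hh.descends_raise hi]; exact hF.hasTrivialIdempotents hN)
        (by rw [hMd']; exact hMd.reflect hz hh.adj_iff descends_asymm (by rwa [hx]))
        (by rw [hNd']; exact hNd.reflect hz hh.adj_iff descends_asymm hNi)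
        (by rw [hMd', hx])
      rwa [hh.descends_raise hi, hE.finrank_homs_eq hF, hNd',
        eulerForm_reverseAt hh.adj_iff hi] at this

/-- Every positive root is the dimension vector of an indecomposable representation. -/
theorem exists_hasTrivialIdempotents {G : SimpleGraph I} {z : I → ℤ} (hz : IsPositiveWeight G z)
    {h : I → ℤ} (hh : IsHeight G h) {x : I → ℤ} (hx : IsRootVector G x) :
    ∃ M : SpaceFamily k I, M.dim = x ∧ M.HasTrivialIdempotents (descends G h) := by
  -- Sink reflections on the opposite quiver take x to a simple root. Read backwards, they are sink
  -- reflections on the given quiver leading from the simple root to x, so heights are negated.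
  suffices H : ∀ (g x : I → ℤ), ReachesSimple G g x → IsHeight G g → IsRootVector G x →
      ∃ M : SpaceFamily k I, M.dim = x ∧ M.HasTrivialIdempotents (descends G fun i => -g i) by
    obtain ⟨M, h1, h2⟩ := H (fun i => -h i) x (hz.reachesSimple hh.neg hx) hh.neg hx
    exact ⟨M, h1, by simpa using h2⟩
  intro g x hr
  induction hr with
  | @simple g i hi =>
    intro hg hx
    have hd : SpaceFamily.dim (k := k) ⟨fun j => Fin (if j = i then 1 else 0) → k, fun _ _ => 0⟩ =
        simpleRoot i := by
      ext j
      by_cases hj : j = i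
      · subst hj
        simp [SpaceFamily.dim, simpleRoot_apply_self]
      · simp [SpaceFamily.dim, simpleRoot_apply_of_ne hj, hj]
    refine ⟨_, hd, fun f _ hidem => ?_⟩
    have hother : ∀ j, j ≠ i → f j = 0 ∧ f j = LinearMap.id := by
      intro j hj
      have := subsingleton_of_dim_eq hd hj
      exact ⟨by ext1 x; exact Subsingleton.elim _ _, by ext1 x; exact Subsingleton.elim _ _⟩
    rcases eq_zero_or_id_of_finrank_eq_one (finrank_eq_one_of_dim_eq hd) (f i) (hidem i)
      with h0 | h0
    · left
      intro j
      by_cases hj : j = i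
      · subst hj
        exact h0
      · exact (hother j hj).1
    · right
      intro j
      by_cases hj : j = i
      · subst hj
        exact h0
      · exact (hother j hj).2
  | @reflect g x i hi hxi _ ih =>
    intro hg hx
    obtain ⟨M, hM1, hM2⟩ := ih (hg.raise hi)
      (hx.reflect hz hg.adj_iff descends_asymm hxi)
    set g' : I → ℤ := fun j => -raise g i j with hg'
    have hgg' : raise g' i = fun j => -g j := by
      funext j
      by_cases hj : j = i
      · subst hj
        rw [raise_self, hg']
        beta_reduce
        rw [raise_self]
        ring
      · rw [raise_of_ne _ hj, hg']
        beta_reduce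
        rw [raise_of_ne _ hj]
    have hh' : IsHeight G g' := (hg.raise hi).neg
    have hi' : IsSink (descends G g') i := by
      rintro j ⟨hij, hj⟩
      have h1 := hg.eq_of_isSink hi hij
      rw [hg'] at hj
      beta_reduce at hj
      rw [raise_self, raise_of_ne _ hij.ne'] at hj
      omega
    -- The vector s_i x differs from α_i because x is nonnegative, so M can be reflected at i.
    obtain ⟨M', E, hE⟩ := exists_isReflection hi' M (surjective_arrowSum (G := G) hi' hM2
      (by rw [hM1]; exact hx.reflect hz hg.adj_iff descends_asymm hxi)
      (by rw [hM1]; exact reflect_ne_simpleRoot hx.2 i))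
    refine ⟨M', ?_, ?_⟩
    · rw [hE.dim_eq hh'.adj_iff, hM1, simpleReflection_simpleReflection]
    · have := hE.hasTrivialIdempotents hM2
      rwa [← hh'.descends_raise hi', hgg'] at this

end Reflections

end SpaceFamily

/-! ### Functors on the path category and families of linear maps -/

section RepHoms

variable {k : Type u} [Field k] {I : Type w} {G : SimpleGraph I} {Γ : QuiverOn G}

/-- A vertex as an object of the path category. -/
abbrev QuiverOn.pt (Γ : QuiverOn G) (i : I) : Paths Γ.Vertex := (Paths.of Γ.Vertex).obj i

/-- An arrow as a morphism of the path category. -/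
abbrev QuiverOn.arr (Γ : QuiverOn G) {i j : I} (a : Γ.arrow i j) : Γ.pt i ⟶ Γ.pt j :=
  (Paths.of Γ.Vertex).map (show @Quiver.Hom Γ.Vertex _ i j from PLift.up a)

lemma QuiverOn.path_induction (Γ : QuiverOn G) {X : Paths Γ.Vertex}
    (P : ∀ {i : I}, (X ⟶ Γ.pt i) → Prop) (hid : ∀ (i : I) (h : Γ.pt i = X), P (eqToHom h.symm))
    (hcomp : ∀ {i j : I} (p : X ⟶ Γ.pt i) (a : Γ.arrow i j), P p → P (p ≫ Γ.arr a))
    {i : I} (p : X ⟶ Γ.pt i) : P p := by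
  exact Paths.induction_fixed_source (V := Γ.Vertex) (a := X) (b := Γ.pt i)
    (fun {b} f => P (i := b) f) (hid X rfl)
    (fun {u v} p q hp => hcomp (i := u) (j := v) p q.down hp) p

/-- The linear map underlying the action of a path. -/
abbrev Rep.act (M : Rep k Γ) {X Y : Paths Γ.Vertex} (p : X ⟶ Y) : M.obj X →ₗ[k] M.obj Y :=
  (M.map p).hom.hom

lemma Rep.act_id (M : Rep k Γ) (X : Paths Γ.Vertex) (x : M.obj X) : M.act (𝟙 X) x = x := by
  simp [Rep.act]

lemma Rep.act_comp (M : Rep k Γ) {X Y Z : Paths Γ.Vertex} (p : X ⟶ Y) (q : Y ⟶ Z)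
    (x : M.obj X) : M.act (p ≫ q) x = M.act q (M.act p x) := by
  simp [Rep.act]

lemma Rep.naturality {M N : Rep k Γ} (f : M ⟶ N) {X Y : Paths Γ.Vertex} (p : X ⟶ Y)
    (x : M.obj X) : (f.app Y).hom.hom (M.act p x) = N.act p ((f.app X).hom.hom x) := by
  have := f.naturality p
  have h2 := congrArg (fun g => g.hom.hom x) this
  exact h2

/-- A morphism of representations from a family of linear maps. -/
noncomputable def Rep.mkHom {M N : Rep k Γ} (f : ∀ X : Paths Γ.Vertex, M.obj X →ₗ[k] N.obj X)
    (hf : ∀ {X Y : Paths Γ.Vertex} (p : X ⟶ Y) (x : M.obj X),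
      f Y (M.act p x) = N.act p (f X x)) : M ⟶ N where
  app X := FGModuleCat.ofHom (f X)
  naturality {X Y} p := by
    ext x
    exact hf p x

lemma Rep.hom_ext {M N : Rep k Γ} {f g : M ⟶ N}
    (h : ∀ (X : Paths Γ.Vertex) (x : M.obj X), (f.app X).hom.hom x = (g.app X).hom.hom x) :
    f = g := by
  ext X x
  exact h X x

/-- It suffices to check naturality on arrows. -/
lemma Rep.natural_of_arrows {M N : Rep k Γ} (f : ∀ i : I, M.space i →ₗ[k] N.space i)
    (hf : ∀ i j (a : Γ.arrow i j) (x : M.space i),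
      f j (M.act (Γ.arr a) x) = N.act (Γ.arr a) (f i x))
    {i j : I} (p : Γ.pt i ⟶ Γ.pt j) (x : M.space i) : f j (M.act p x) = N.act p (f i x) := by
  refine Γ.path_induction (X := Γ.pt i)
    (fun {j} p => f j (M.act p x) = N.act p (f i x)) ?_ ?_ p
  · rintro i' h
    have h' : i' = i := h
    subst h'
    rw [eqToHom_refl, Rep.act_id, Rep.act_id]
  · intro i' j' p a hp
    rw [Rep.act_comp, Rep.act_comp, hf, hp]

open Classical in
/-- The underlying family of spaces of a representation. -/
noncomputable def Rep.toFamily (M : Rep k Γ) : SpaceFamily k I where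
  V i := M.space i
  map i j := if a : Γ.arrow i j then M.act (Γ.arr a) else 0

lemma Rep.toFamily_map (M : Rep k Γ) {i j : I} (a : Γ.arrow i j) :
    M.toFamily.map i j = M.act (Γ.arr a) := dif_pos a

/-- Morphisms of representations as families of linear maps. -/
noncomputable def Rep.homEquiv (M N : Rep k Γ) :
    (M ⟶ N) ≃ₗ[k] SpaceFamily.homs Γ.arrow M.toFamily N.toFamily where
  toFun f := ⟨fun i => (f.app (Γ.pt i)).hom.hom, fun i j a x => by
    rw [Rep.toFamily_map _ a, Rep.toFamily_map _ a]
    exact (Rep.naturality f (Γ.arr a) x).symm⟩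
  map_add' _ _ := rfl
  map_smul' _ _ := rfl
  invFun f := Rep.mkHom (fun X => f.1 X) (fun {X Y} p x =>
    Rep.natural_of_arrows (fun i => f.1 i) (fun i j a x => by
      have := f.2 i j a x
      rw [Rep.toFamily_map _ a, Rep.toFamily_map _ a] at this
      exact this.symm) p x)
  left_inv f := rfl
  right_inv f := rfl

/-- The representation given by a family of spaces. -/
noncomputable def SpaceFamily.toRep (Γ : QuiverOn G) (M : SpaceFamily k I) : Rep k Γ :=
  Paths.lift
    { obj := fun i : I => FGModuleCat.of k (M.V i)
      map := fun {i j : I} _ => FGModuleCat.ofHom (M.map i j) }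

lemma SpaceFamily.toRep_act (M : SpaceFamily k I) {i j : I} (a : Γ.arrow i j)
    (x : M.V i) : (M.toRep Γ).act (Γ.arr a) x = M.map i j x := by
  unfold Rep.act SpaceFamily.toRep
  erw [Paths.lift_toPath]
  rfl

end RepHoms

/-! ### Coinduced representations -/

section Coinduced

variable {k : Type u} [Field k] {I : Type w} {G : SimpleGraph I} {Γ : QuiverOn G}

/-- In a quiver with a height function there are only finitely many paths between two vertices. -/
lemma QuiverOn.finite_paths [Finite I] (Γ : QuiverOn G) {h : I → ℤ}
    (hΓ : ∀ i j, Γ.arrow i j → h i = h j + 1) (X Y : Paths Γ.Vertex) : Finite (X ⟶ Y) := by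
  let g : Γ.Vertex → ℤ := h
  -- Each arrow descends by one, so the length of a path is fixed by its endpoints. Finiteness
  -- follows by removing the last arrow.
  have len : ∀ {a b : Γ.Vertex} (p : Quiver.Path a b), g a = g b + p.length := by
    intro a b p
    induction p with
    | nil => simp
    | @cons b c p e ih =>
      have h1 : g b = g c + 1 := hΓ b c e.down
      rw [ih, Quiver.Path.length_cons]
      push_cast
      linarith
  have key : ∀ (a : Γ.Vertex) (n : ℕ) (b : Γ.Vertex), g a - g b < n →
      Finite (Quiver.Path a b) := by
    intro a n
    induction n with
    | zero =>
      intro b hb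
      have : IsEmpty (Quiver.Path a b) := ⟨fun p => by
        have := len p
        push_cast at hb
        linarith [Int.natCast_nonneg p.length]⟩
      infer_instance
    | succ n ih =>
      intro b hb
      have : ∀ c : {c : Γ.Vertex // Γ.arrow c b}, Finite (Quiver.Path a c.1) := by
        intro c
        have h1 : g c.1 = g b + 1 := hΓ c.1 b c.2
        apply ih
        push_cast at hb
        linarith
      have : Finite {c : Γ.Vertex // Γ.arrow c b} :=
        Subtype.finite (α := I) (p := fun c => Γ.arrow c b)
      let f : Quiver.Path a b → Option (Σ c : {c : Γ.Vertex // Γ.arrow c b}, Quiver.Path a c.1) :=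
        fun p => match p with
          | .nil => none
          | .cons p e => some ⟨⟨_, e.down⟩, p⟩
      refine Finite.of_injective f ?_
      intro p q hpq
      cases p with
      | nil =>
        cases q with
        | nil => rfl
        | cons q e => simp [f] at hpq
      | cons p e =>
        cases q with
        | nil => simp [f] at hpq
        | cons q e' =>
          simp only [f, Option.some.injEq, Sigma.mk.injEq, Subtype.mk.injEq] at hpq
          obtain ⟨h1, h2⟩ := hpq
          subst h1
          rw [heq_eq_eq] at h2
          subst h2
          exact congrArg (Quiver.Path.cons p) (Subsingleton.elim (α := PLift (Γ.arrow _ b)) e e')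
  exact key X ((g X - g Y).toNat + 1) Y (by omega)

variable {T : Type*} [Finite T] (x : T → Paths Γ.Vertex) (V : T → Type u)
  [∀ t, AddCommGroup (V t)] [∀ t, Module k (V t)] [∀ t, FiniteDimensional k (V t)]
  [hfin : ∀ X Y : Paths Γ.Vertex, Finite (X ⟶ Y)]

/-- A finite-dimensional space in any universe is isomorphic to one in the universe of `k`. -/
noncomputable def toModel (k : Type u) [Field k] (W : Type*) [AddCommGroup W] [Module k W]
    [FiniteDimensional k W] : W ≃ₗ[k] (Fin (Module.finrank k W) → k) :=
  (Module.finBasis k W).equivFun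

/-- The value at a vertex of the representation coinduced from the spaces `V t` at `x t`. -/
abbrev coindSpace (X : Paths Γ.Vertex) : Type _ := ∀ t, (X ⟶ x t) → V t

/-- The action of paths on the coinduced representation. -/
def coindAct {X Y : Paths Γ.Vertex} (q : X ⟶ Y) : coindSpace x V X →ₗ[k] coindSpace x V Y where
  toFun g t p := g t (q ≫ p)
  map_add' _ _ := rfl
  map_smul' _ _ := rfl

/-- The representation coinduced from the spaces `V t` at the vertices `x t`. -/
noncomputable def coind : Rep k Γ where
  obj X := FGModuleCat.of k (Fin (Module.finrank k (coindSpace x V X)) → k)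
  map {X Y} q := FGModuleCat.ofHom
    ((toModel k (coindSpace x V Y)).toLinearMap ∘ₗ coindAct x V q ∘ₗ
      (toModel k (coindSpace x V X)).symm.toLinearMap)
  map_id X := by
    ext1
    refine LinearMap.ext fun y => ?_
    obtain ⟨y, rfl⟩ := (toModel k (coindSpace x V X)).surjective y
    change toModel k _ (coindAct (k := k) x V (𝟙 X) ((toModel k _).symm (toModel k _ y))) = toModel k _ y
    rw [LinearEquiv.symm_apply_apply]
    congr 1
    funext t p
    simp [coindAct]
  map_comp {X Y Z} p q := by
    ext1
    refine LinearMap.ext fun y => ?_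
    obtain ⟨y, rfl⟩ := (toModel k (coindSpace x V X)).surjective y
    change toModel k _ (coindAct (k := k) x V (p ≫ q) ((toModel k _).symm (toModel k _ y))) =
      toModel k _ (coindAct (k := k) x V q ((toModel k _).symm (toModel k _ (coindAct (k := k) x V p
        ((toModel k _).symm (toModel k _ y))))))
    rw [LinearEquiv.symm_apply_apply, LinearEquiv.symm_apply_apply]
    congr 1
    funext t r
    simp [coindAct]

/-- The defining identification of the values of the coinduced representation. -/
noncomputable def coindEquiv (X : Paths Γ.Vertex) :
    (coind (k := k) x V).obj X ≃ₗ[k] coindSpace x V X :=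
  (toModel k (coindSpace x V X)).symm

lemma coindEquiv_act {X Y : Paths Γ.Vertex} (q : X ⟶ Y) (y : (coind (k := k) x V).obj X) (t : T)
    (p : Y ⟶ x t) :
    coindEquiv x V Y ((coind (k := k) x V).act q y) t p = coindEquiv x V X y t (q ≫ p) := by
  change (toModel k _).symm (toModel k _ (coindAct (k := k) x V q ((toModel k _).symm y))) t p = _
  rw [LinearEquiv.symm_apply_apply]
  rfl

variable (M : Rep k Γ)

/-- Maps into a coinduced representation. -/
noncomputable def coindLift (φ : ∀ t, M.obj (x t) →ₗ[k] V t) : M ⟶ coind (k := k) x V :=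
  Rep.mkHom (fun X => (coindEquiv x V X).symm.toLinearMap ∘ₗ
      LinearMap.pi fun t => LinearMap.pi fun p => φ t ∘ₗ M.act p)
    (by
      intro X Y q m
      apply (coindEquiv x V Y).injective
      funext t p
      rw [coindEquiv_act]
      simp only [LinearMap.comp_apply, LinearEquiv.coe_coe, LinearEquiv.apply_symm_apply,
        LinearMap.pi_apply, Rep.act_comp])

lemma coindEquiv_coindLift (φ : ∀ t, M.obj (x t) →ₗ[k] V t) (X : Paths Γ.Vertex) (m : M.obj X)
    (t : T) (p : X ⟶ x t) :
    coindEquiv x V X (((coindLift x V M φ).app X).hom.hom m) t p = φ t (M.act p m) := by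
  change coindEquiv x V X ((coindEquiv x V X).symm _) t p = _
  rw [LinearEquiv.apply_symm_apply]
  rfl

/-- The adjunction between coinduction and evaluation. -/
noncomputable def coindHomEquiv :
    (M ⟶ coind (k := k) x V) ≃ₗ[k] ∀ t, M.obj (x t) →ₗ[k] V t where
  toFun f t := LinearMap.proj (𝟙 (x t)) ∘ₗ LinearMap.proj t ∘ₗ
    (coindEquiv x V (x t)).toLinearMap ∘ₗ (f.app (x t)).hom.hom
  map_add' f g := by
    funext t
    ext m
    change coindEquiv x V (x t) ((f.app (x t)).hom.hom m + (g.app (x t)).hom.hom m) t _ = _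
    rw [map_add]
    rfl
  map_smul' c f := by
    funext t
    ext m
    change coindEquiv x V (x t) (c • (f.app (x t)).hom.hom m) t _ = _
    rw [map_smul]
    rfl
  invFun φ := coindLift x V M φ
  left_inv f := by
    apply Rep.hom_ext
    intro X m
    apply (coindEquiv x V X).injective
    funext t p
    rw [coindEquiv_coindLift]
    change coindEquiv x V (x t) ((f.app (x t)).hom.hom (M.act p m)) t (𝟙 _) = _
    rw [Rep.naturality, coindEquiv_act, Category.comp_id]
  right_inv φ := by
    funext t
    ext m
    change coindEquiv x V (x t) (((coindLift x V M φ).app (x t)).hom.hom m) t (𝟙 _) = _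
    rw [coindEquiv_coindLift, Rep.act_id]

lemma coindHomEquiv_apply (f : M ⟶ coind (k := k) x V) (t : T) (m : M.obj (x t)) :
    coindHomEquiv x V M f t m = coindEquiv x V (x t) ((f.app (x t)).hom.hom m) t (𝟙 _) := rfl

omit hfin in
lemma Rep.injective_app {M N : Rep k Γ} (f : M ⟶ N) [Mono f] (X : Paths Γ.Vertex) :
    Function.Injective (f.app X).hom.hom := by
  have h1 : Mono (f.app X) := inferInstance
  have h2 : Mono ((forget₂ (FGModuleCat.{u} k) (ModuleCat.{u} k)).map (f.app X)) := inferInstance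
  exact (ModuleCat.mono_iff_injective _).1 h2

/-- By adjunction a map into a coinduced representation is a free choice of linear maps at the
vertices x t. These extend along a monomorphism by left inverses over the field. -/
instance : Injective (coind (k := k) x V) where
  factors {M N} g f hf := by
    have hinj := fun t => Rep.injective_app f (x t)
    choose l hl using fun t => LinearMap.exists_leftInverse_of_injective (f.app (x t)).hom.hom
      (LinearMap.ker_eq_bot.2 (hinj t))
    refine ⟨coindLift x V N fun t => coindHomEquiv x V M g t ∘ₗ l t, ?_⟩
    apply (coindHomEquiv x V M).injective
    funext t
    ext m
    rw [coindHomEquiv_apply]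
    change coindEquiv x V (x t) (((coindLift x V N _).app (x t)).hom.hom
      ((f.app (x t)).hom.hom m)) t _ = _
    rw [coindEquiv_coindLift, Rep.act_id, LinearMap.comp_apply]
    congr 1
    exact LinearMap.congr_fun (hl t) m

end Coinduced

/-! ### The standard injective coresolution and the Euler formula -/

section Coresolution

variable {k : Type u} [Field k] {I : Type w} [Fintype I] {G : SimpleGraph I} {Γ : QuiverOn G}
  [hfin : ∀ X Y : Paths Γ.Vertex, Finite (X ⟶ Y)]

/-- The arrows of a quiver. -/
abbrev QuiverOn.Arrow (Γ : QuiverOn G) : Type w := {a : I × I // Γ.arrow a.1 a.2}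

variable (N : Rep k Γ)

/-- The sum of the representations coinduced from the spaces of `N`. -/
noncomputable abbrev vertexCoind : Rep k Γ := coind (k := k) Γ.pt fun i : I => N.space i

/-- The sum over the arrows of the representations coinduced from the targets to the sources. -/
noncomputable abbrev arrowCoind : Rep k Γ :=
  coind (k := k) (fun a : Γ.Arrow => Γ.pt a.1.1) fun a => N.space a.1.2

/-- The embedding of `N` in an injective representation. -/
noncomputable def toVertexCoind : N ⟶ vertexCoind N :=
  coindLift _ _ N fun _ => LinearMap.id

/-- The second map of the injective coresolution. -/
noncomputable def vertexToArrowCoind : vertexCoind N ⟶ arrowCoind N :=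
  coindLift _ _ _ fun a =>
    N.act (Γ.arr a.2) ∘ₗ LinearMap.proj (𝟙 (Γ.pt a.1.1)) ∘ₗ LinearMap.proj a.1.1 ∘ₗ
        (coindEquiv Γ.pt (fun i : I => N.space i) (Γ.pt a.1.1)).toLinearMap -
      LinearMap.proj (Γ.arr a.2) ∘ₗ LinearMap.proj a.1.2 ∘ₗ
        (coindEquiv Γ.pt (fun i : I => N.space i) (Γ.pt a.1.1)).toLinearMap

lemma toVertexCoind_apply (X : Paths Γ.Vertex) (m : N.obj X) (i : I) (p : X ⟶ Γ.pt i) :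
    coindEquiv (k := k) Γ.pt (fun i : I => N.space i) X (((toVertexCoind N).app X).hom.hom m) i p =
      N.act p m :=
  coindEquiv_coindLift _ _ _ _ _ _ _ _

lemma vertexToArrowCoind_apply (X : Paths Γ.Vertex) (m : (vertexCoind N).obj X) (a : Γ.Arrow)
    (p : X ⟶ Γ.pt a.1.1) :
    coindEquiv (k := k) (fun a : Γ.Arrow => Γ.pt a.1.1) (fun a => N.space a.1.2) X
        (((vertexToArrowCoind N).app X).hom.hom m) a p =
      N.act (Γ.arr a.2) (coindEquiv (k := k) Γ.pt (fun i : I => N.space i) X m a.1.1 p) -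
        coindEquiv (k := k) Γ.pt (fun i : I => N.space i) X m a.1.2 (p ≫ Γ.arr a.2) := by
  refine (coindEquiv_coindLift _ _ _ _ _ _ _ _).trans ?_
  simp only [LinearMap.sub_apply, LinearMap.comp_apply, LinearMap.proj_apply, LinearEquiv.coe_coe]
  rw [coindEquiv_act, coindEquiv_act, Category.comp_id]

lemma toVertexCoind_comp : toVertexCoind N ≫ vertexToArrowCoind N = 0 := by
  apply Rep.hom_ext
  intro X m
  apply (coindEquiv (k := k) (fun a : Γ.Arrow => Γ.pt a.1.1) (fun a => N.space a.1.2) X).injective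
  funext a p
  refine (vertexToArrowCoind_apply N X (((toVertexCoind N).app X).hom.hom m) a p).trans ?_
  rw [toVertexCoind_apply, toVertexCoind_apply, Rep.act_comp, sub_self]
  change _ = coindEquiv (k := k) (fun a : Γ.Arrow => Γ.pt a.1.1) (fun a => N.space a.1.2) X 0 a p
  rw [map_zero]
  rfl

instance : Mono (toVertexCoind N) where
  right_cancellation {A} f g h := by
    apply Rep.hom_ext
    intro X m
    obtain ⟨i, rfl⟩ : ∃ i : I, Γ.pt i = X := ⟨X, rfl⟩
    have h1 := congrArg (fun f => coindEquiv (k := k) Γ.pt (fun i : I => N.space i) (Γ.pt i)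
      ((f.app (Γ.pt i)).hom.hom m) i (𝟙 (Γ.pt i))) h
    have h2 := fun f : A ⟶ N =>
      toVertexCoind_apply N (Γ.pt i) ((f.app (Γ.pt i)).hom.hom m) i (𝟙 (Γ.pt i))
    have h3 := (h2 f).symm.trans (h1.trans (h2 g))
    rwa [Rep.act_id, Rep.act_id] at h3

/-- A function on paths with prescribed deviation from equivariance, constructed along the path. -/
noncomputable def pathSolution (X : Γ.Vertex)
    (h : ∀ (a : Γ.Arrow), Quiver.Path (V := Γ.Vertex) X a.1.1 → N.space a.1.2) :
    ∀ {j : Γ.Vertex}, Quiver.Path X j → N.space j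
  | _, .nil => 0
  | _, .cons (b := i) (c := j) p e =>
    N.act (Γ.arr (i := i) (j := j) e.down) (pathSolution X h p) - h ⟨(i, j), e.down⟩ p

/-- A nontrivial path factors uniquely through its last arrow, so a preimage can be defined
recursively along paths starting from 0. This is why the coresolution stops after one step. -/
lemma vertexToArrowCoind_surjective (X : Paths Γ.Vertex) :
    Function.Surjective ((vertexToArrowCoind N).app X).hom.hom := by
  intro y
  set h := coindEquiv (k := k) (fun a : Γ.Arrow => Γ.pt a.1.1) (fun a => N.space a.1.2) X y with hh
  refine ⟨(coindEquiv (k := k) Γ.pt (fun i : I => N.space i) X).symm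
    fun j p => pathSolution N X h p, ?_⟩
  apply (coindEquiv (k := k) (fun a : Γ.Arrow => Γ.pt a.1.1) (fun a => N.space a.1.2) X).injective
  funext a p
  rw [vertexToArrowCoind_apply, LinearEquiv.apply_symm_apply]
  change N.act (Γ.arr a.2) (pathSolution N X h p) -
    (N.act (Γ.arr a.2) (pathSolution N X h p) - h a p) = h a p
  rw [sub_sub_cancel]

instance : Epi (vertexToArrowCoind N) where
  left_cancellation {A} f g h := by
    apply Rep.hom_ext
    intro X m
    obtain ⟨m, rfl⟩ := vertexToArrowCoind_surjective N X m
    exact congrArg (fun f => (f.app X).hom.hom m) h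

/-- The standard injective coresolution. -/
noncomputable abbrev coresolution : ShortComplex (Rep k Γ) :=
  ShortComplex.mk (toVertexCoind N) (vertexToArrowCoind N) (toVertexCoind_comp N)

/-- The second map measures the failure of a function on paths to be equivariant along arrows. An
equivariant function is determined by its value on the trivial path, an element of N. -/
lemma exists_lift_toVertexCoind {A : Rep k Γ} (f : A ⟶ vertexCoind N)
    (hf : f ≫ vertexToArrowCoind N = 0) : ∃ l : A ⟶ N, l ≫ toVertexCoind N = f := by
  set F : ∀ X : Paths Γ.Vertex, A.obj X →ₗ[k] coindSpace Γ.pt (fun i : I => N.space i) X :=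
    fun X => (coindEquiv (k := k) Γ.pt (fun i : I => N.space i) X).toLinearMap ∘ₗ
      (f.app X).hom.hom with hF
  have hker : ∀ (X : Paths Γ.Vertex) (m : A.obj X) (i j : I) (a : Γ.arrow i j) (p : X ⟶ Γ.pt i),
      F X m j (p ≫ Γ.arr a) = N.act (Γ.arr a) (F X m i p) := by
    intro X m i j a p
    have h1 := congrArg (fun f => coindEquiv (k := k) (fun a : Γ.Arrow => Γ.pt a.1.1)
      (fun a => N.space a.1.2) X ((f.app X).hom.hom m) ⟨(i, j), a⟩ p) hf
    have h2 := (vertexToArrowCoind_apply N X ((f.app X).hom.hom m) ⟨(i, j), a⟩ p).symm.trans h1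
    have h3 : coindEquiv (k := k) (fun a : Γ.Arrow => Γ.pt a.1.1)
        (fun a => N.space a.1.2) X (0 : (arrowCoind N).obj X) ⟨(i, j), a⟩ p = 0 := by
      rw [map_zero]
      rfl
    exact (sub_eq_zero.1 (h2.trans h3)).symm
  have hpath : ∀ (x : I) (m : A.obj (Γ.pt x)) (i : I) (p : Γ.pt x ⟶ Γ.pt i),
      F (Γ.pt x) m i p = N.act p (F (Γ.pt x) m x (𝟙 (Γ.pt x))) := by
    intro x m i p
    refine Γ.path_induction (X := Γ.pt x)
      (fun {i} p => F (Γ.pt x) m i p = N.act p (F (Γ.pt x) m x (𝟙 (Γ.pt x)))) ?_ ?_ p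
    · intro i h
      have h' : i = x := h
      subst h'
      rw [eqToHom_refl]
      exact (Rep.act_id _ _ _).symm
    · intro i j p a hp
      rw [hker, hp, Rep.act_comp]
  refine ⟨Rep.mkHom (fun X => LinearMap.proj (𝟙 X) ∘ₗ LinearMap.proj (X : I) ∘ₗ F X) ?_, ?_⟩
  · intro X Y p m
    obtain ⟨x, rfl⟩ : ∃ i : I, Γ.pt i = X := ⟨X, rfl⟩
    obtain ⟨y, rfl⟩ : ∃ i : I, Γ.pt i = Y := ⟨Y, rfl⟩
    refine Eq.trans ?_ (hpath x m y p)
    change coindEquiv (k := k) Γ.pt (fun i : I => N.space i) (Γ.pt y)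
      ((f.app (Γ.pt y)).hom.hom (A.act p m)) y (𝟙 (Γ.pt y)) = _
    rw [Rep.naturality f]
    refine (coindEquiv_act _ _ _ _ _ _).trans ?_
    rw [Category.comp_id]
    rfl
  · apply Rep.hom_ext
    intro X m
    obtain ⟨x, rfl⟩ : ∃ i : I, Γ.pt i = X := ⟨X, rfl⟩
    apply (coindEquiv (k := k) Γ.pt (fun i : I => N.space i) (Γ.pt x)).injective
    funext i p
    refine (toVertexCoind_apply N (Γ.pt x) _ i p).trans ?_
    exact (hpath x m i p).symm

lemma coresolution_shortExact : (coresolution N).ShortExact where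
  exact := ShortComplex.exact_of_f_is_kernel _ (KernelFork.IsLimit.ofι' _ _ fun f hf =>
    ⟨_, (exists_lift_toVertexCoind N f hf).choose_spec⟩)
  mono_f := inferInstanceAs (Mono (toVertexCoind N))
  epi_g := inferInstanceAs (Epi (vertexToArrowCoind N))

variable (M : Rep k Γ)

open Abelian

/-- The connecting map of the coresolution. -/
noncomputable def connecting : (M ⟶ arrowCoind N) →ₗ[k] Ext M N 1 where
  toFun g := (Ext.mk₀ g).comp (coresolution_shortExact N).extClass (zero_add 1)
  map_add' f g := by rw [Ext.mk₀_add, Ext.add_comp]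
  map_smul' c f := by rw [Ext.mk₀_smul, Ext.smul_comp]; rfl

/-- Ext¹ into the injective middle term vanishes. -/
lemma connecting_surjective : Function.Surjective (connecting N M) := by
  intro e
  obtain ⟨x, hx⟩ := Ext.covariant_sequence_exact₁ (hS := coresolution_shortExact N) M e
    (Ext.eq_zero_of_injective _) (zero_add 1)
  obtain ⟨g, rfl⟩ := (Ext.mk₀_bijective M (arrowCoind N)).2 x
  exact ⟨g, hx⟩

lemma ker_connecting :
    LinearMap.ker (connecting N M) = LinearMap.range (Linear.rightComp k M (vertexToArrowCoind N)) := by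
  ext g
  constructor
  · intro hg
    obtain ⟨x, hx⟩ := Ext.covariant_sequence_exact₃ (hS := coresolution_shortExact N) M
      (Ext.mk₀ g) (zero_add 1) hg
    obtain ⟨f, rfl⟩ := (Ext.mk₀_bijective M (vertexCoind N)).2 x
    rw [Ext.mk₀_comp_mk₀] at hx
    exact ⟨f, (Ext.mk₀_bijective _ _).1 hx⟩
  · rintro ⟨f, rfl⟩
    change (Ext.mk₀ (f ≫ (coresolution N).g)).comp (coresolution_shortExact N).extClass
      (zero_add 1) = 0
    rw [← Ext.mk₀_comp_mk₀, Ext.comp_assoc_of_second_deg_zero,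
      ShortComplex.ShortExact.comp_extClass, Ext.comp_zero]

lemma ker_rightComp :
    LinearMap.ker (Linear.rightComp k M (vertexToArrowCoind N)) =
      LinearMap.range (Linear.rightComp k M (toVertexCoind N)) := by
  ext f
  constructor
  · intro hf
    obtain ⟨l, hl⟩ := exists_lift_toVertexCoind N f hf
    exact ⟨l, hl⟩
  · rintro ⟨l, rfl⟩
    change (l ≫ toVertexCoind N) ≫ vertexToArrowCoind N = 0
    rw [Category.assoc, toVertexCoind_comp, comp_zero]

instance finite_vertexHom : Module.Finite k (M ⟶ vertexCoind N) :=
  Module.Finite.equiv (coindHomEquiv _ _ M).symm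

instance finite_arrowHom : Module.Finite k (M ⟶ arrowCoind N) :=
  Module.Finite.equiv (coindHomEquiv _ _ M).symm

lemma finite_ext : Module.Finite k (Ext M N 1) :=
  Module.Finite.of_surjective _ (connecting_surjective N M)

/-- The dimension vector of a representation. -/
noncomputable abbrev Rep.dim (M : Rep k Γ) : I → ℤ := fun i => Module.finrank k (M.space i)

open Classical in
/-- The Euler formula for representations of quivers. -/
theorem finrank_hom_sub_finrank_ext :
    (Module.finrank k (M ⟶ N) : ℤ) - Module.finrank k (Ext M N 1) =
      eulerForm Γ.arrow M.dim N.dim := by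
  -- Rank-nullity twice along 0 → Hom(M,N) → Hom(M,I⁰) → Hom(M,I¹) → Ext¹(M,N) → 0. By adjunction
  -- the middle dimensions are the vertex sum and the arrow sum of the Euler form.
  have h1 := LinearMap.finrank_range_add_finrank_ker (connecting N M)
  rw [LinearMap.range_eq_top.2 (connecting_surjective N M), finrank_top, ker_connecting] at h1
  have h2 := LinearMap.finrank_range_add_finrank_ker
    (Linear.rightComp k M (vertexToArrowCoind N))
  have hinj : Function.Injective (Linear.rightComp k M (toVertexCoind N)) := fun f g h =>
    (cancel_mono (toVertexCoind N)).1 h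
  rw [ker_rightComp, LinearMap.finrank_range_of_inj hinj] at h2
  have h3 : (Module.finrank k (M ⟶ vertexCoind N) : ℤ) = ∑ i, M.dim i * N.dim i := by
    rw [(coindHomEquiv Γ.pt (fun i : I => N.space i) M).finrank_eq, Module.finrank_pi_fintype]
    push_cast
    exact Finset.sum_congr rfl fun i _ => by rw [Module.finrank_linearMap]; push_cast; rfl
  have h4 : (Module.finrank k (M ⟶ arrowCoind N) : ℤ) =
      ∑ a : Γ.Arrow, M.dim a.1.1 * N.dim a.1.2 := by
    rw [(coindHomEquiv (fun a : Γ.Arrow => Γ.pt a.1.1) (fun a => N.space a.1.2) M).finrank_eq,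
      Module.finrank_pi_fintype]
    push_cast
    exact Finset.sum_congr rfl fun i _ => by rw [Module.finrank_linearMap]; push_cast; rfl
  have h5 : ∑ a : Γ.Arrow, M.dim a.1.1 * N.dim a.1.2 =
      ∑ i, ∑ j, if Γ.arrow i j then M.dim i * N.dim j else 0 := by
    rw [← Fintype.sum_prod_type', ← Finset.sum_filter]
    exact (Finset.sum_subtype _ (by simp) fun a : I × I => M.dim a.1 * N.dim a.2).symm
  rw [eulerForm, ← h3, ← h5, ← h4]
  omega

end Coresolution

/-! ### Direct sum decompositions -/

section Splitting

variable {C : Type*} [Category* C] [Preadditive C] [HasBinaryBiproducts C]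

/-- An object decomposes along a pair of complementary split idempotents. -/
noncomputable def splitIso {X A B : C} (i₁ : A ⟶ X) (p₁ : X ⟶ A) (i₂ : B ⟶ X) (p₂ : X ⟶ B)
    (h₁ : i₁ ≫ p₁ = 𝟙 A) (h₂ : i₂ ≫ p₂ = 𝟙 B) (h₁₂ : i₁ ≫ p₂ = 0) (h₂₁ : i₂ ≫ p₁ = 0)
    (h : p₁ ≫ i₁ + p₂ ≫ i₂ = 𝟙 X) : X ≅ A ⊞ B where
  hom := biprod.lift p₁ p₂
  inv := biprod.desc i₁ i₂
  hom_inv_id := by rw [biprod.lift_desc, h]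
  inv_hom_id := by
    apply biprod.hom_ext' <;> apply biprod.hom_ext <;> simp [h₁, h₂, h₁₂, h₂₁]

/-- Apply the hypothesis to the idempotent that projects onto A. -/
lemma isZero_or_isZero_of_iso {X A B : C} (φ : X ≅ A ⊞ B)
    (hX : ∀ e : X ⟶ X, e ≫ e = e → e = 0 ∨ e = 𝟙 X) : IsZero A ∨ IsZero B := by
  rcases hX (φ.hom ≫ biprod.fst ≫ biprod.inl ≫ φ.inv) (by simp) with h | h
  · left
    rw [IsZero.iff_id_eq_zero]
    have := congrArg (fun e => biprod.inl ≫ φ.inv ≫ e ≫ φ.hom ≫ biprod.fst) h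
    simpa using this
  · right
    rw [IsZero.iff_id_eq_zero]
    have := congrArg (fun e => biprod.inr ≫ φ.inv ≫ e ≫ φ.hom ≫ biprod.snd) h
    simpa using this.symm

lemma isZero_and_isZero_of_iso {X A B : C} (φ : X ≅ A ⊞ B) (hX : IsZero X) :
    IsZero A ∧ IsZero B := by
  have h : 𝟙 X = 0 := hX.eq_of_src _ _
  rw [IsZero.iff_id_eq_zero, IsZero.iff_id_eq_zero]
  constructor
  · have := congrArg (fun e => biprod.inl ≫ φ.inv ≫ e ≫ φ.hom ≫ biprod.fst) h
    simpa using this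
  · have := congrArg (fun e => biprod.inr ≫ φ.inv ≫ e ≫ φ.hom ≫ biprod.snd) h
    simpa using this

/-- Adding a zero object on the right. -/
noncomputable def sumZeroIso {X Z : C} (hZ : IsZero Z) : X ≅ X ⊞ Z :=
  splitIso (𝟙 X) (𝟙 X) 0 0 (by simp) (hZ.eq_of_src _ _) (by simp) (by simp) (by simp)

/-- Adding a zero object on the left. -/
noncomputable def zeroSumIso {X Z : C} (hZ : IsZero Z) : X ≅ Z ⊞ X :=
  splitIso 0 0 (𝟙 X) (𝟙 X) (hZ.eq_of_src _ _) (by simp) (by simp) (by simp) (by simp)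

end Splitting

section FGModule

variable {k : Type u} [Field k]

lemma isZero_iff_finrank_eq_zero (V : FGModuleCat.{u} k) : IsZero V ↔ Module.finrank k V = 0 := by
  rw [Module.finrank_zero_iff]
  constructor
  · intro h
    refine ⟨fun x y => ?_⟩
    have h1 : 𝟙 V = 0 := h.eq_of_src _ _
    have h2 : ∀ z : V, z = 0 := fun z => congrArg (fun f => f.hom.hom z) h1
    rw [h2 x, h2 y]
  · intro h
    rw [IsZero.iff_id_eq_zero]
    ext x
    exact Subsingleton.elim _ _

end FGModule

/-! ### Indecomposable decorated representations -/

section Decorated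

variable {k : Type u} [Field k] {I : Type w} {G : SimpleGraph I} {Γ : QuiverOn G}

lemma Rep.isZero_iff (M : Rep k Γ) : IsZero M ↔ ∀ i : I, Module.finrank k (M.space i) = 0 := by
  constructor
  · intro h i
    rw [← isZero_iff_finrank_eq_zero]
    have h1 : 𝟙 M = 0 := h.eq_of_src _ _
    rw [IsZero.iff_id_eq_zero]
    exact congrArg (fun f => f.app (Γ.pt i)) h1
  · intro h
    rw [IsZero.iff_id_eq_zero]
    ext X : 2
    obtain ⟨i, rfl⟩ : ∃ i : I, Γ.pt i = X := ⟨X, rfl⟩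
    exact ((isZero_iff_finrank_eq_zero _).2 (h i)).eq_of_src _ _

lemma DecRep.isZero_iff (M : DecRep k Γ) : IsZero M ↔ IsZero M.1 ∧ ∀ i, IsZero (M.2 i) := by
  constructor
  · intro h
    have h1 : 𝟙 M = ((0 : M.1 ⟶ M.1), fun i => (0 : M.2 i ⟶ M.2 i)) := h.eq_of_src _ _
    refine ⟨(IsZero.iff_id_eq_zero _).2 (congrArg Prod.fst h1), fun i => ?_⟩
    exact (IsZero.iff_id_eq_zero _).2 (congrFun (congrArg Prod.snd h1) i)
  · rintro ⟨h1, h2⟩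
    refine ⟨fun Y => ⟨⟨⟨((0 : M.1 ⟶ Y.1), fun i => (0 : M.2 i ⟶ Y.2 i))⟩, fun f => ?_⟩⟩,
      fun Y => ⟨⟨⟨((0 : Y.1 ⟶ M.1), fun i => (0 : Y.2 i ⟶ M.2 i))⟩, fun f => ?_⟩⟩⟩
    · exact Prod.ext (h1.eq_of_src _ _) (funext fun i => (h2 i).eq_of_src _ _)
    · exact Prod.ext (h1.eq_of_tgt _ _) (funext fun i => (h2 i).eq_of_tgt _ _)

/-- Isomorphisms of decorated representations from isomorphisms of the components. -/
def DecRep.mkIso {M N : DecRep k Γ} (e : M.1 ≅ N.1) (f : ∀ i, M.2 i ≅ N.2 i) : M ≅ N where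
  hom := (e.hom, fun i => (f i).hom)
  inv := (e.inv, fun i => (f i).inv)
  hom_inv_id := Prod.ext e.hom_inv_id (funext fun i => (f i).hom_inv_id)
  inv_hom_id := Prod.ext e.inv_hom_id (funext fun i => (f i).inv_hom_id)

/-- The first component of an isomorphism. -/
def DecRep.isoFst {M N : DecRep k Γ} (e : M ≅ N) : M.1 ≅ N.1 where
  hom := e.hom.1
  inv := e.inv.1
  hom_inv_id := congrArg Prod.fst e.hom_inv_id
  inv_hom_id := congrArg Prod.fst e.inv_hom_id

/-- The components at a vertex of the decoration of an isomorphism. -/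
def DecRep.isoSnd {M N : DecRep k Γ} (e : M ≅ N) (i : I) : M.2 i ≅ N.2 i where
  hom := e.hom.2 i
  inv := e.inv.2 i
  hom_inv_id := congrFun (congrArg Prod.snd e.hom_inv_id) i
  inv_hom_id := congrFun (congrArg Prod.snd e.inv_hom_id) i

/-- M is the direct sum of (M⁺, 0) and (0, V). -/
lemma DecRep.IsIndecomposable.isZero_or {M : DecRep k Γ} (hM : M.IsIndecomposable) :
    IsZero M.1 ∨ ∀ i, IsZero (M.2 i) := by
  rcases hM.2 (M.1, fun _ => 0) (0, M.2)
    ⟨DecRep.mkIso (sumZeroIso (isZero_zero _)) fun i => zeroSumIso (isZero_zero _)⟩ with h | h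
  · exact Or.inl ((DecRep.isZero_iff _).1 h).1
  · exact Or.inr ((DecRep.isZero_iff _).1 h).2

lemma DecRep.IsIndecomposable.idempotent {M : DecRep k Γ} (hM : M.IsIndecomposable)
    (e : M.1 ⟶ M.1) (he : e ≫ e = e) : e = 0 ∨ e = 𝟙 M.1 := by
  obtain ⟨A, i₁, p₁, h₁, he₁⟩ := IsIdempotentComplete.idempotents_split M.1 e he
  obtain ⟨B, i₂, p₂, h₂, he₂⟩ := IsIdempotentComplete.idempotents_split M.1 (𝟙 M.1 - e)
    (Idempotents.idem_of_id_sub_idem e he)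
  have h₁₂ : i₁ ≫ p₂ = 0 := by
    have : i₁ ≫ p₂ = i₁ ≫ (p₁ ≫ i₁) ≫ (p₂ ≫ i₂) ≫ p₂ := by
      simp only [Category.assoc, h₂, reassoc_of% h₁, Category.comp_id]
    rw [this, he₁, he₂]
    simp [reassoc_of% he]
  have h₂₁ : i₂ ≫ p₁ = 0 := by
    have : i₂ ≫ p₁ = i₂ ≫ (p₂ ≫ i₂) ≫ (p₁ ≫ i₁) ≫ p₁ := by
      simp only [Category.assoc, h₁, reassoc_of% h₂, Category.comp_id]
    rw [this, he₁, he₂]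
    simp [reassoc_of% he]
  -- The images of e and 1 - e decompose M⁺; the decoration is placed with the second one so that
  -- the sum is M itself.
  rcases hM.2 (A, fun _ => 0) (B, M.2)
    ⟨DecRep.mkIso (splitIso i₁ p₁ i₂ p₂ h₁ h₂ h₁₂ h₂₁ (by rw [he₁, he₂]; abel))
      fun i => zeroSumIso (isZero_zero _)⟩ with h | h
  · left
    have h3 : p₁ = 0 := (((DecRep.isZero_iff _).1 h).1).eq_of_tgt _ _
    rw [← he₁, h3, zero_comp]
  · right
    have h3 : p₂ = 0 := (((DecRep.isZero_iff _).1 h).1).eq_of_tgt _ _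
    rw [h3, zero_comp] at he₂
    exact (sub_eq_zero.1 he₂.symm).symm

lemma DecRep.IsIndecomposable.hasTrivialIdempotents {M : DecRep k Γ} (hM : M.IsIndecomposable) :
    M.1.toFamily.HasTrivialIdempotents Γ.arrow := by
  intro f hf hidem
  set e := (Rep.homEquiv M.1 M.1).symm ⟨f, hf⟩ with he
  have hef : Rep.homEquiv M.1 M.1 e = ⟨f, hf⟩ := LinearEquiv.apply_symm_apply _ _
  have hidem' : e ≫ e = e := by
    apply (Rep.homEquiv M.1 M.1).injective
    rw [hef]
    exact Subtype.ext (funext fun i => hidem i)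
  rcases hM.idempotent e hidem' with h | h
  · left
    intro i
    rw [h, map_zero] at hef
    exact (congrFun (congrArg Subtype.val hef) i).symm
  · right
    intro i
    rw [h] at hef
    exact (congrFun (congrArg Subtype.val hef) i).symm

lemma SpaceFamily.HasTrivialIdempotents.idempotent {F : SpaceFamily k I}
    (hF : F.HasTrivialIdempotents Γ.arrow) (e : F.toRep Γ ⟶ F.toRep Γ) (he : e ≫ e = e) :
    e = 0 ∨ e = 𝟙 (F.toRep Γ) := by
  set f := Rep.homEquiv (F.toRep Γ) (F.toRep Γ) e with hf
  have hfF : (f.1 : ∀ i, F.V i →ₗ[k] F.V i) ∈ SpaceFamily.homs Γ.arrow F F := by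
    intro i j a x
    have := Rep.naturality e (Γ.arr a) x
    rw [SpaceFamily.toRep_act] at this
    exact (this.trans (SpaceFamily.toRep_act F a _)).symm
  rcases hF f.1 hfF (fun i => congrFun (congrArg (fun e => (Rep.homEquiv _ _ e).1) he) i) with h | h
  · left
    apply (Rep.homEquiv _ _).injective
    rw [map_zero]
    exact Subtype.ext (funext h)
  · right
    apply (Rep.homEquiv _ _).injective
    exact Subtype.ext (funext h)

lemma exists_isIndecomposable_of_root [Fintype I] {F : SpaceFamily k I}
    (hF : F.HasTrivialIdempotents Γ.arrow) (hd : IsRootVector G F.dim) :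
    ∃ M : DecRep k Γ, M.IsIndecomposable ∧ M.sdim = F.dim := by
  have h0 : Module.finrank k (0 : FGModuleCat.{u} k) = 0 :=
    (isZero_iff_finrank_eq_zero _).1 (isZero_zero _)
  refine ⟨(F.toRep Γ, fun _ => 0), ⟨fun h => ?_, ?_⟩, ?_⟩
  · refine hd.ne_zero (funext fun i => ?_)
    exact Int.natCast_eq_zero.2 ((Rep.isZero_iff _).1 ((DecRep.isZero_iff _).1 h).1 i)
  · rintro A B ⟨φ⟩
    have h2 := fun i => isZero_and_isZero_of_iso (DecRep.isoSnd φ i) (isZero_zero _)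
    rcases isZero_or_isZero_of_iso (DecRep.isoFst φ) hF.idempotent with h | h
    · exact Or.inl ((DecRep.isZero_iff _).2 ⟨h, fun i => (h2 i).1⟩)
    · exact Or.inr ((DecRep.isZero_iff _).2 ⟨h, fun i => (h2 i).2⟩)
  · funext i
    change (Module.finrank k (F.V i) : ℤ) - (Module.finrank k (0 : FGModuleCat.{u} k) : ℤ) = _
    rw [h0]
    simp [SpaceFamily.dim]

open Classical in
lemma exists_isIndecomposable_of_neg_simpleRoot [Fintype I] (Γ : QuiverOn G) (i : I) :
    ∃ M : DecRep k Γ, M.IsIndecomposable ∧ M.sdim = -simpleRoot i := by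
  let V : I → FGModuleCat.{u} k := fun j => FGModuleCat.of k (Fin (if j = i then 1 else 0) → k)
  have hV : ∀ j, Module.finrank k (V j) = if j = i then 1 else 0 := fun j => by
    change Module.finrank k (Fin (if j = i then 1 else 0) → k) = _
    rw [Module.finrank_fin_fun]
  have hVi : Module.finrank k (V i) = 1 := by rw [hV, if_pos rfl]
  refine ⟨(0, V), ⟨fun h => ?_, ?_⟩, ?_⟩
  · have := (isZero_iff_finrank_eq_zero _).1 (((DecRep.isZero_iff _).1 h).2 i)
    change Module.finrank k (V i) = 0 at this
    omega
  · rintro A B ⟨φ⟩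
    have h1 := isZero_and_isZero_of_iso (DecRep.isoFst φ) (isZero_zero _)
    have h2 : ∀ j, j ≠ i → IsZero (A.2 j) ∧ IsZero (B.2 j) := fun j hj =>
      isZero_and_isZero_of_iso (DecRep.isoSnd φ j)
        ((isZero_iff_finrank_eq_zero (V j)).2 (by rw [hV, if_neg hj]))
    have h3 : ∀ e : V i ⟶ V i, e ≫ e = e → e = 0 ∨ e = 𝟙 (V i) := by
      intro e he
      rcases eq_zero_or_id_of_finrank_eq_one hVi e.hom.hom
        (congrArg (fun e => e.hom.hom) he) with h | h
      · exact Or.inl (FGModuleCat.hom_ext h)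
      · exact Or.inr (FGModuleCat.hom_ext h)
    rcases isZero_or_isZero_of_iso (DecRep.isoSnd φ i) h3 with h | h
    · refine Or.inl ((DecRep.isZero_iff _).2 ⟨h1.1, fun j => ?_⟩)
      by_cases hj : j = i
      · rw [hj]
        exact h
      · exact (h2 j hj).1
    · refine Or.inr ((DecRep.isZero_iff _).2 ⟨h1.2, fun j => ?_⟩)
      by_cases hj : j = i
      · rw [hj]
        exact h
      · exact (h2 j hj).2
  · funext j
    have h0 : Module.finrank k ((0 : Rep k Γ).space j) = 0 :=
      (Rep.isZero_iff _).1 (isZero_zero _) j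
    change (Module.finrank k ((0 : Rep k Γ).space j) : ℤ) - (Module.finrank k (V j) : ℤ) = _
    rw [h0, hV]
    by_cases hj : j = i
    · subst hj
      simp [simpleRoot_apply_self]
    · simp [hj, simpleRoot_apply_of_ne hj]

/-- All that is ever used about the chosen representation, so the choice among isomorphic ones is
immaterial. -/
lemma indecomposableOf_spec {α : I → ℤ} (h : ∃ M : DecRep k Γ, M.IsIndecomposable ∧ M.sdim = α) :
    (indecomposableOf k Γ α).IsIndecomposable ∧ (indecomposableOf k Γ α).sdim = α := by
  unfold indecomposableOf
  rw [dif_pos h]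
  exact h.choose_spec

/-- A pure decoration has nonpositive signed dimension vector, so here the decoration must vanish.
-/
lemma DecRep.IsIndecomposable.of_sdim_root [Fintype I] {M : DecRep k Γ} (hM : M.IsIndecomposable)
    (hd : IsRootVector G M.sdim) :
    M.1.toFamily.dim = M.sdim ∧ ∀ i, Module.finrank k (M.2 i) = 0 := by
  rcases hM.isZero_or with h | h
  · refine absurd (funext fun i => le_antisymm ?_ (hd.2 i)) hd.ne_zero
    have := (Rep.isZero_iff _).1 h i
    simp [DecRep.sdim, this]
  · have h2 := fun i => (isZero_iff_finrank_eq_zero _).1 (h i)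
    refine ⟨funext fun i => ?_, h2⟩
    unfold DecRep.sdim
    rw [h2 i, Nat.cast_zero, sub_zero]
    rfl

lemma DecRep.IsIndecomposable.of_sdim_neg_simpleRoot [Fintype I] {M : DecRep k Γ}
    (hM : M.IsIndecomposable) {i : I} (hd : M.sdim = -simpleRoot i) :
    (∀ j, Module.finrank k (M.1.space j) = 0) ∧
      ∀ j, (Module.finrank k (M.2 j) : ℤ) = (simpleRoot i : I → ℤ) j := by
  rcases hM.isZero_or with h | h
  · have h1 := (Rep.isZero_iff _).1 h
    refine ⟨h1, fun j => ?_⟩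
    have h2 := congrFun hd j
    simp only [DecRep.sdim, h1 j, Pi.neg_apply] at h2
    push_cast at h2
    linarith
  · have h1 := (isZero_iff_finrank_eq_zero _).1 (h i)
    have h2 := congrFun hd i
    simp only [DecRep.sdim, h1, Pi.neg_apply, simpleRoot_apply_self] at h2
    push_cast at h2
    have := Int.natCast_nonneg (Module.finrank k (M.1.space i))
    linarith

end Decorated

/-! ### The compatibility degree -/

section Degree

variable {k : Type u} [Field k] {I : Type w} [Fintype I] {G : SimpleGraph I} {Γ : QuiverOn G}

open Abelian

/-- Finite dimensionality of the Ext spaces, from the coresolution, is what allows the dual to be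
counted and the dimensions to be added. -/
lemma finrank_E [hfin : ∀ X Y : Paths Γ.Vertex, Finite (X ⟶ Y)] (M N : DecRep k Γ) :
    (Module.finrank k (M.E N) : ℤ) =
      Module.finrank k (Ext M.1 N.1 1) + Module.finrank k (Ext N.1 M.1 1) +
        (∑ i, (Module.finrank k (M.1.space i) : ℤ) * Module.finrank k (N.2 i) +
          ∑ i, (Module.finrank k (M.2 i) : ℤ) * Module.finrank k (N.1.space i)) := by
  have h1 := finite_ext N.1 M.1
  have h2 := finite_ext M.1 N.1
  unfold DecRep.E
  rw [Module.finrank_prod, Module.finrank_prod, Module.finrank_prod, Subspace.dual_finrank_eq,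
    Module.finrank_pi_fintype, Module.finrank_pi_fintype]
  simp only [Module.finrank_linearMap]
  push_cast
  ring

lemma finrank_ext_of_finrank_eq_zero [hfin : ∀ X Y : Paths Γ.Vertex, Finite (X ⟶ Y)]
    {M : Rep k Γ} (hM : ∀ i, Module.finrank k (M.space i) = 0) (N : Rep k Γ) :
    Module.finrank k (Ext M N 1) = 0 ∧ Module.finrank k (Ext N M 1) = 0 := by
  have hz := (Rep.isZero_iff M).2 hM
  have hd : M.dim = 0 := funext fun i => Int.natCast_eq_zero.2 (hM i)
  have h1 := finrank_hom_sub_finrank_ext N M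
  have h2 := finrank_hom_sub_finrank_ext M N
  have : Subsingleton (M ⟶ N) := ⟨hz.eq_of_src⟩
  have : Subsingleton (N ⟶ M) := ⟨hz.eq_of_tgt⟩
  rw [hd, Module.finrank_zero_of_subsingleton] at h1 h2
  simp only [eulerForm, Pi.zero_apply, zero_mul, mul_zero, ite_self, Finset.sum_const_zero] at h1 h2
  omega

/-- Subtract the Euler formula from dim Hom = max(0, χ), with χ the Euler form: dim Ext¹ = max(0, χ)
- χ = max(0, -χ). -/
lemma finrank_ext_of_root [hfin : ∀ X Y : Paths Γ.Vertex, Finite (X ⟶ Y)] {z : I → ℤ}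
    (hz : IsPositiveWeight G z) {h : I → ℤ} (hΓ : Γ.arrow = descends G h) {M N : Rep k Γ}
    (hM : M.toFamily.HasTrivialIdempotents Γ.arrow) (hN : N.toFamily.HasTrivialIdempotents Γ.arrow)
    (hMd : IsRootVector G M.toFamily.dim) (hNd : IsRootVector G N.toFamily.dim) :
    (Module.finrank k (Ext M N 1) : ℤ) =
      max 0 (-eulerForm Γ.arrow M.toFamily.dim N.toFamily.dim) := by
  have h1 : (Module.finrank k (M ⟶ N) : ℤ) - Module.finrank k (Ext M N 1) =
    eulerForm Γ.arrow M.toFamily.dim N.toFamily.dim := finrank_hom_sub_finrank_ext N M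
  have h2 : (Module.finrank k (M ⟶ N) : ℤ) =
      max 0 (eulerForm Γ.arrow M.toFamily.dim N.toFamily.dim) := by
    rw [(Rep.homEquiv M N).finrank_eq]
    have hh := Γ.isHeight hΓ
    rw [hΓ] at hM hN ⊢
    exact SpaceFamily.finrank_homs_eq_max hz hh hM hN hMd hNd
  omega

variable (k) in
lemma indecomposableOf_root (Γ : QuiverOn G) {z : I → ℤ} (hz : IsPositiveWeight G z) {α : I → ℤ}
    (hα : IsRootVector G α) :
    (indecomposableOf k Γ α).1.toFamily.HasTrivialIdempotents Γ.arrow ∧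
      (indecomposableOf k Γ α).1.toFamily.dim = α ∧
      ∀ i, Module.finrank k ((indecomposableOf k Γ α).2 i) = 0 := by
  obtain ⟨h, -, hh, -, -⟩ := hz.exists_heights Γ Γ
  have hΓ := Γ.arrow_eq_descends hh
  obtain ⟨F, hF1, hF2⟩ := SpaceFamily.exists_hasTrivialIdempotents (k := k) hz (Γ.isHeight hΓ) hα
  rw [← hΓ] at hF2
  obtain ⟨M, hM⟩ := exists_isIndecomposable_of_root hF2 (by rwa [hF1])
  rw [hF1] at hM
  obtain ⟨h1, h2⟩ := indecomposableOf_spec ⟨M, hM⟩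
  obtain ⟨h3, h4⟩ := h1.of_sdim_root (by rwa [h2])
  exact ⟨h1.hasTrivialIdempotents, h3.trans h2, h4⟩

variable (k) in
lemma indecomposableOf_neg_simpleRoot (Γ : QuiverOn G) (i : I) :
    (∀ j, Module.finrank k ((indecomposableOf k Γ (-simpleRoot i)).1.space j) = 0) ∧
      ∀ j, (Module.finrank k ((indecomposableOf k Γ (-simpleRoot i)).2 j) : ℤ) =
        (simpleRoot i : I → ℤ) j := by
  obtain ⟨h1, h2⟩ := indecomposableOf_spec (exists_isIndecomposable_of_neg_simpleRoot (k := k) Γ i)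
  exact h1.of_sdim_neg_simpleRoot h2

lemma sum_simpleRoot_mul (i : I) (x : I → ℤ) : ∑ j, (simpleRoot i : I → ℤ) j * x j = x i := by
  rw [Finset.sum_eq_single i]
  · rw [simpleRoot_apply_self, one_mul]
  · intro b _ hb
    rw [simpleRoot_apply_of_ne hb, zero_mul]
  · simp

lemma IsPositiveWeight.finite_paths {z : I → ℤ} (hz : IsPositiveWeight G z) (Γ : QuiverOn G) :
    ∀ X Y : Paths Γ.Vertex, Finite (X ⟶ Y) := by
  obtain ⟨h, -, hh, -, -⟩ := hz.exists_heights Γ Γ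
  exact Γ.finite_paths hh

variable (k) in
lemma compatibilityDegree_root_root (Γ : QuiverOn G) {z : I → ℤ} (hz : IsPositiveWeight G z)
    {α β : AlmostPositiveRoot G} (hα : IsRootVector G α.1) (hβ : IsRootVector G β.1) :
    (compatibilityDegree k Γ α β : ℤ) =
      max 0 (-eulerForm Γ.arrow α.1 β.1) + max 0 (-eulerForm Γ.arrow β.1 α.1) := by
  have := hz.finite_paths Γ
  obtain ⟨h, -, hh, -, -⟩ := hz.exists_heights Γ Γ
  have hΓ := Γ.arrow_eq_descends hh
  obtain ⟨a1, a2, a3⟩ := indecomposableOf_root k Γ hz hα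
  obtain ⟨b1, b2, b3⟩ := indecomposableOf_root k Γ hz hβ
  unfold compatibilityDegree
  rw [finrank_E, finrank_ext_of_root hz hΓ a1 b1 (by rwa [a2]) (by rwa [b2]),
    finrank_ext_of_root hz hΓ b1 a1 (by rwa [b2]) (by rwa [a2]), a2, b2]
  simp [a3, b3]

variable (k) in
lemma compatibilityDegree_neg_root (Γ : QuiverOn G) {z : I → ℤ} (hz : IsPositiveWeight G z)
    {α β : AlmostPositiveRoot G} {i : I} (hα : α.1 = -simpleRoot i) (hβ : IsRootVector G β.1) :
    (compatibilityDegree k Γ α β : ℤ) = β.1 i := by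
  have := hz.finite_paths Γ
  obtain ⟨b1, b2, b3⟩ := indecomposableOf_root k Γ hz hβ
  obtain ⟨a1, a2⟩ := indecomposableOf_neg_simpleRoot k Γ i
  rw [← hα] at a1 a2
  obtain ⟨c1, c2⟩ := finrank_ext_of_finrank_eq_zero a1 (indecomposableOf k Γ β.1).1
  unfold compatibilityDegree
  rw [finrank_E, c1, c2]
  simp only [a1, a2, b3]
  have h1 : ∀ j, (Module.finrank k ((indecomposableOf k Γ β.1).1.space j) : ℤ) = β.1 j := fun j =>
    congrFun b2 j
  simp only [h1, sum_simpleRoot_mul]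
  simp

variable (k) in
lemma compatibilityDegree_root_neg (Γ : QuiverOn G) {z : I → ℤ} (hz : IsPositiveWeight G z)
    {α β : AlmostPositiveRoot G} {i : I} (hα : IsRootVector G α.1) (hβ : β.1 = -simpleRoot i) :
    (compatibilityDegree k Γ α β : ℤ) = α.1 i := by
  have := hz.finite_paths Γ
  rw [← compatibilityDegree_neg_root k Γ hz hβ hα]
  unfold compatibilityDegree
  rw [finrank_E, finrank_E]
  simp only [mul_comm]
  ring

variable (k) in
lemma compatibilityDegree_neg_neg (Γ : QuiverOn G) {z : I → ℤ} (hz : IsPositiveWeight G z)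
    {α β : AlmostPositiveRoot G} {i j : I} (hα : α.1 = -simpleRoot i) (hβ : β.1 = -simpleRoot j) :
    (compatibilityDegree k Γ α β : ℤ) = 0 := by
  have := hz.finite_paths Γ
  obtain ⟨a1, a2⟩ := indecomposableOf_neg_simpleRoot k Γ i
  obtain ⟨b1, b2⟩ := indecomposableOf_neg_simpleRoot k Γ j
  rw [← hα] at a1 a2
  rw [← hβ] at b1 b2
  obtain ⟨c1, c2⟩ := finrank_ext_of_finrank_eq_zero a1 (indecomposableOf k Γ β.1).1
  unfold compatibilityDegree
  rw [finrank_E, c1, c2]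
  simp [a1, b1]

end Degree

/-! ### The piecewise linear reflections -/

section Sigma

variable {I : Type w} [Fintype I] {G : SimpleGraph I}

lemma sigma_of_nonneg (i : I) {x : I → ℤ} (hx : ∀ j, 0 ≤ x j) :
    sigma G i x = simpleReflection G i x := by
  classical
  ext j
  by_cases hj : j = i
  · subst hj
    rw [simpleReflection_apply_self]
    simp only [sigma, Function.update_self, neighborSum, max_eq_left (hx _), G.adj_comm _ j]
    ring
  · simp only [sigma, Function.update_of_ne hj, simpleReflection_apply_of_ne hj]

lemma sigma_neg_simpleRoot_apply (i j : I) :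
    sigma G i (-simpleRoot j) i = (simpleRoot j : I → ℤ) i := by
  have h : ∀ a, max (-(simpleRoot j : I → ℤ) a) 0 = 0 := fun a =>
    max_eq_right (neg_nonpos.2 ((isRootVector_simpleRoot (G := G) j).2 a))
  simp only [sigma, Function.update_self, Pi.neg_apply, h, Finset.sum_const_zero, neg_neg, add_zero]

lemma sigma_neg_simpleRoot_self (i : I) : sigma G i (-simpleRoot i) = simpleRoot i := by
  classical
  ext j
  by_cases hj : j = i
  · subst hj
    exact sigma_neg_simpleRoot_apply j j
  · simp [sigma, Function.update_of_ne hj, simpleRoot_apply_of_ne hj]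

lemma sigma_neg_simpleRoot_of_ne {i j : I} (hij : j ≠ i) :
    sigma G i (-simpleRoot j) = -simpleRoot j := by
  classical
  ext a
  by_cases ha : a = i
  · subst ha
    rw [sigma_neg_simpleRoot_apply, Pi.neg_apply, simpleRoot_apply_of_ne hij.symm, neg_zero]
  · simp [sigma, Function.update_of_ne ha]

lemma isPositiveRoot_simpleRoot (i : I) : IsPositiveRoot G (simpleRoot i) :=
  ⟨.simple i, (isRootVector_simpleRoot (G := G) i).2⟩

lemma IsPositiveRoot.reflect {z : I → ℤ} (hz : IsPositiveWeight G z) (Γ : QuiverOn G) {x : I → ℤ}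
    (hx : IsPositiveRoot G x) {i : I} (hxi : x ≠ simpleRoot i) :
    IsPositiveRoot G (simpleReflection G i x) :=
  ⟨.reflect i hx.1, (hx.isRootVector.reflect hz Γ.adj_iff Γ.asymm hxi).2⟩

/-- The cases for an almost positive root relative to a vertex. -/
lemma almostPositiveRoot_cases (i : I) (α : AlmostPositiveRoot G) :
    (∃ j, j ≠ i ∧ α.1 = -simpleRoot j) ∨ α.1 = -simpleRoot i ∨ α.1 = simpleRoot i ∨
      (IsPositiveRoot G α.1 ∧ α.1 ≠ simpleRoot i) := by
  rcases α.2 with h | ⟨j, h⟩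
  · by_cases h' : α.1 = simpleRoot i
    · exact Or.inr (Or.inr (Or.inl h'))
    · exact Or.inr (Or.inr (Or.inr ⟨h, h'⟩))
  · by_cases hj : j = i
    · subst hj
      exact Or.inr (Or.inl h)
    · exact Or.inl ⟨j, hj, h⟩

/-- On nonnegative vectors σ_i is s_i. It fixes -α_j for j ≠ i and exchanges α_i with -α_i. The
orientation Γ serves only to make the Cartan form even; σ_i does not depend on it. -/
lemma sigma_mem {z : I → ℤ} (hz : IsPositiveWeight G z) (Γ : QuiverOn G) (i : I)
    (α : AlmostPositiveRoot G) :
    (IsPositiveRoot G (sigma G i α.1) ∨ ∃ j, sigma G i α.1 = -simpleRoot j) ∧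
      sigma G i (sigma G i α.1) = α.1 := by
  rcases almostPositiveRoot_cases i α with ⟨j, hj, h⟩ | h | h | ⟨h, hi⟩
  · rw [h, sigma_neg_simpleRoot_of_ne hj, sigma_neg_simpleRoot_of_ne hj]
    exact ⟨Or.inr ⟨j, rfl⟩, rfl⟩
  · rw [h, sigma_neg_simpleRoot_self, sigma_of_nonneg i (isPositiveRoot_simpleRoot (G := G) i).2,
      simpleReflection_simpleRoot]
    exact ⟨Or.inl (isPositiveRoot_simpleRoot i), rfl⟩
  · rw [h, sigma_of_nonneg i (isPositiveRoot_simpleRoot (G := G) i).2, simpleReflection_simpleRoot,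
      sigma_neg_simpleRoot_self]
    exact ⟨Or.inr ⟨i, rfl⟩, rfl⟩
  · have h' := h.reflect hz Γ hi
    rw [sigma_of_nonneg i h.2, sigma_of_nonneg i h'.2, simpleReflection_simpleReflection]
    exact ⟨Or.inl h', rfl⟩

/-- The permutation of the almost positive roots induced by `σ_i`. -/
noncomputable def sigmaEquiv {z : I → ℤ} (hz : IsPositiveWeight G z) (Γ : QuiverOn G) (i : I) :
    AlmostPositiveRoot G ≃ AlmostPositiveRoot G :=
  Function.Involutive.toPerm (fun α => ⟨sigma G i α.1, (sigma_mem hz Γ i α).1⟩)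
    fun α => Subtype.ext (sigma_mem hz Γ i α).2

lemma sigmaEquiv_val {z : I → ℤ} (hz : IsPositiveWeight G z) (Γ : QuiverOn G) (i : I)
    (α : AlmostPositiveRoot G) : (sigmaEquiv hz Γ i α).1 = sigma G i α.1 := rfl

variable (k : Type u) [Field k]

/-- The compatibility degree is invariant under reflection at a sink. -/
theorem compatibilityDegree_sigmaEquiv {z : I → ℤ} (hz : IsPositiveWeight G z) (Γ Γ' : QuiverOn G)
    {i : I} (hi : IsSink Γ.arrow i) (hΓ' : Γ'.arrow = reverseAt Γ.arrow i)
    (α β : AlmostPositiveRoot G) :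
    compatibilityDegree k Γ' (sigmaEquiv hz Γ i α) (sigmaEquiv hz Γ i β) =
      compatibilityDegree k Γ α β := by
  have hR := Γ.adj_iff
  have hi0 := isPositiveRoot_simpleRoot (G := G) i
  have hir := hi0.isRootVector
  set α' := sigmaEquiv hz Γ i α with hα'
  set β' := sigmaEquiv hz Γ i β with hβ'
  have cases : ∀ γ : AlmostPositiveRoot G,
      (∃ j, j ≠ i ∧ γ.1 = -simpleRoot j ∧ (sigmaEquiv hz Γ i γ).1 = -simpleRoot j) ∨
      (γ.1 = -simpleRoot i ∧ (sigmaEquiv hz Γ i γ).1 = simpleRoot i) ∨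
      (γ.1 = simpleRoot i ∧ (sigmaEquiv hz Γ i γ).1 = -simpleRoot i) ∨
      (IsRootVector G γ.1 ∧ IsRootVector G (sigmaEquiv hz Γ i γ).1 ∧
        (sigmaEquiv hz Γ i γ).1 = simpleReflection G i γ.1) := by
    intro γ
    rw [sigmaEquiv_val]
    rcases almostPositiveRoot_cases i γ with ⟨j, hj, h⟩ | h | h | ⟨h, hγi⟩
    · exact Or.inl ⟨j, hj, h, by rw [h, sigma_neg_simpleRoot_of_ne hj]⟩
    · exact Or.inr (Or.inl ⟨h, by rw [h, sigma_neg_simpleRoot_self]⟩)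
    · exact Or.inr (Or.inr (Or.inl ⟨h, by
        rw [h, sigma_of_nonneg i hi0.2, simpleReflection_simpleRoot]⟩))
    · refine Or.inr (Or.inr (Or.inr ⟨h.isRootVector, ?_, sigma_of_nonneg i h.2⟩))
      rw [sigma_of_nonneg i h.2]
      exact (h.reflect hz Γ hγi).isRootVector
  -- These four identities compute Ext¹ between a root and α_i, for the sink i of Γ and the source i
  -- of Γ'. Only one direction survives, and it equals the coefficient of α_i in the root on the
  -- other side of the reflection.
  have root_simple : ∀ γ : I → ℤ, IsRootVector G (simpleReflection G i γ) →
      max 0 (-eulerForm Γ.arrow γ (simpleRoot i)) = simpleReflection G i γ i := by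
    intro γ hγ
    have := hγ.2 i
    rw [simpleReflection_apply_self] at this ⊢
    rw [eulerForm_simpleRoot_right hR hi, max_eq_right (by linarith)]
    ring
  have simple_root : ∀ γ : I → ℤ, IsRootVector G γ →
      max 0 (-eulerForm Γ.arrow (simpleRoot i) γ) = 0 := by
    intro γ hγ
    rw [eulerForm_simpleRoot_left hi, max_eq_left (by linarith [hγ.2 i])]
  have root_simple' : ∀ γ : I → ℤ, IsRootVector G (simpleReflection G i γ) →
      max 0 (-eulerForm Γ'.arrow (simpleReflection G i γ) (simpleRoot i)) = 0 := by
    intro γ hγ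
    have := hγ.2 i
    rw [hΓ', eulerForm_reverseAt_apply hR hi, eulerForm_simpleRoot_right hR hi,
      neighborSum_simpleRoot, simpleRoot_apply_self, if_neg (G.loopless.irrefl i)]
    rw [max_eq_left]
    linarith
  have simple_root' : ∀ γ : I → ℤ, IsRootVector G γ →
      max 0 (-eulerForm Γ'.arrow (simpleRoot i) (simpleReflection G i γ)) = γ i := by
    intro γ hγ
    have := hγ.2 i
    rw [hΓ', eulerForm_reverseAt_apply hR hi, eulerForm_simpleRoot_left hi,
      neighborSum_simpleRoot, simpleRoot_apply_self, neighborSum_simpleReflection,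
      simpleReflection_apply_self, if_neg (G.loopless.irrefl i), max_eq_right] <;> linarith
  have hdeg : (compatibilityDegree k Γ' α' β' : ℤ) = compatibilityDegree k Γ α β := by
    -- Sixteen cases. When only one of α, β is ±α_i and the other a further positive root, an Ext¹
    -- dimension on one side matches a coefficient of α_i on the other. Two such roots use the
    -- isometry of the Euler forms.
    rcases cases α with ⟨a, ha, h1, h1'⟩ | ⟨h1, h1'⟩ | ⟨h1, h1'⟩ | ⟨h1, h1', h1''⟩ <;>
    rcases cases β with ⟨b, hb, h2, h2'⟩ | ⟨h2, h2'⟩ | ⟨h2, h2'⟩ | ⟨h2, h2', h2''⟩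
    · rw [compatibilityDegree_neg_neg k Γ hz h1 h2, compatibilityDegree_neg_neg k Γ' hz h1' h2']
    · rw [compatibilityDegree_neg_neg k Γ hz h1 h2,
        compatibilityDegree_neg_root k Γ' hz h1' (by rwa [h2']), h2', simpleRoot_apply_of_ne ha]
    · rw [compatibilityDegree_neg_neg k Γ' hz h1' h2',
        compatibilityDegree_neg_root k Γ hz h1 (by rwa [h2]), h2, simpleRoot_apply_of_ne ha]
    · rw [compatibilityDegree_neg_root k Γ' hz h1' h2', compatibilityDegree_neg_root k Γ hz h1 h2,
        h2'', simpleReflection_apply_of_ne ha]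
    · rw [compatibilityDegree_neg_neg k Γ hz h1 h2,
        compatibilityDegree_root_neg k Γ' hz (by rwa [h1']) h2', h1', simpleRoot_apply_of_ne hb]
    · rw [compatibilityDegree_neg_neg k Γ hz h1 h2,
        compatibilityDegree_root_root k Γ' hz (by rwa [h1']) (by rwa [h2']), h1', h2', hΓ',
        eulerForm_reverseAt_apply hR hi, eulerForm_simpleRoot_left hi, neighborSum_simpleRoot,
        simpleRoot_apply_self]
      simp
    · rw [compatibilityDegree_neg_root k Γ hz h1 (by rwa [h2]),
        compatibilityDegree_root_neg k Γ' hz (by rwa [h1']) h2', h1', h2]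
    · rw [compatibilityDegree_neg_root k Γ hz h1 h2,
        compatibilityDegree_root_root k Γ' hz (by rwa [h1']) h2', h1', h2'', simple_root' _ h2,
        root_simple' _ (by rwa [← h2'']), add_zero]
    · rw [compatibilityDegree_root_neg k Γ hz (by rwa [h1]) h2, h1,
        compatibilityDegree_neg_neg k Γ' hz h1' h2', simpleRoot_apply_of_ne hb]
    · rw [compatibilityDegree_root_neg k Γ hz (by rwa [h1]) h2, h1,
        compatibilityDegree_neg_root k Γ' hz h1' (by rwa [h2']), h2']
    · rw [compatibilityDegree_neg_neg k Γ' hz h1' h2',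
        compatibilityDegree_root_root k Γ hz (by rwa [h1]) (by rwa [h2]), h1, h2,
        simple_root _ hir, add_zero]
    · rw [compatibilityDegree_neg_root k Γ' hz h1' h2',
        compatibilityDegree_root_root k Γ hz (by rwa [h1]) h2, h1, simple_root _ h2,
        root_simple _ (by rwa [← h2'']), h2'', zero_add]
    · rw [compatibilityDegree_root_neg k Γ hz h1 h2, compatibilityDegree_root_neg k Γ' hz h1' h2',
        h1'', simpleReflection_apply_of_ne hb]
    · rw [compatibilityDegree_root_neg k Γ hz h1 h2,
        compatibilityDegree_root_root k Γ' hz h1' (by rwa [h2']), h2', h1'', simple_root' _ h1,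
        root_simple' _ (by rwa [← h1'']), zero_add]
    · rw [compatibilityDegree_root_neg k Γ' hz h1' h2',
        compatibilityDegree_root_root k Γ hz h1 (by rwa [h2]), h2, simple_root _ h1,
        root_simple _ (by rwa [← h1'']), h1'', add_zero]
    · rw [compatibilityDegree_root_root k Γ hz h1 h2, compatibilityDegree_root_root k Γ' hz h1' h2',
        h1'', h2'', hΓ', eulerForm_reverseAt hR hi, eulerForm_reverseAt hR hi]
  exact_mod_cast hdeg

end Sigma

end DecoratedQuiver

/-! ### The isomorphism of complexes -/

theorem corollary4p10 {k : Type u} [Field k] [IsAlgClosed k] {I : Type w} [Fintype I]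
    (G : SimpleGraph I) (hG : IsDynkin G) (Γ Γ' : QuiverOn G) :
    ∃ (l : List I) (e : AlmostPositiveRoot G ≃ AlmostPositiveRoot G),
      (∀ α : AlmostPositiveRoot G, (e α).1 = l.foldr (sigma G) α.1) ∧
      ∀ C : Finset (AlmostPositiveRoot G),
        C ∈ (compatibleComplex k Γ).faces ↔
          C.map e.toEmbedding ∈ (compatibleComplex k Γ').faces := by
  obtain ⟨z, hz⟩ := hG.exists_isPositiveWeight
  have key : ∃ (l : List I) (e : AlmostPositiveRoot G ≃ AlmostPositiveRoot G),
      (∀ α : AlmostPositiveRoot G, (e α).1 = l.foldr (sigma G) α.1) ∧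
      ∀ α β, compatibilityDegree k Γ' (e α) (e β) = compatibilityDegree k Γ α β := by
    refine hz.sink_induction (fun Γ Γ' =>
      ∃ (l : List I) (e : AlmostPositiveRoot G ≃ AlmostPositiveRoot G),
        (∀ α : AlmostPositiveRoot G, (e α).1 = l.foldr (sigma G) α.1) ∧
        ∀ α β, compatibilityDegree k Γ' (e α) (e β) = compatibilityDegree k Γ α β)
      (fun Γ => ⟨[], Equiv.refl _, fun _ => rfl, fun _ _ => rfl⟩) ?_ Γ Γ'
    rintro Γ₁ Γ₂ Γ₃ i hi hΓ₂ ⟨l, e, he, hdeg⟩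
    -- `List.foldr` applies the last entry first, so the reflection at the first sink goes to the
    -- end of the list.
    refine ⟨l ++ [i], (sigmaEquiv hz Γ₁ i).trans e, fun α => ?_, fun α β => ?_⟩
    · rw [List.foldr_append, Equiv.trans_apply, he]
      rfl
    · rw [Equiv.trans_apply, Equiv.trans_apply, hdeg,
        compatibilityDegree_sigmaEquiv k hz Γ₁ Γ₂ hi hΓ₂]
  obtain ⟨l, e, he, hdeg⟩ := key
  refine ⟨l, e, he, fun C => ?_⟩
  change (C.Nonempty ∧ IsCompatible k Γ (C : Set (AlmostPositiveRoot G))) ↔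
    ((C.map e.toEmbedding).Nonempty ∧
      IsCompatible k Γ' (C.map e.toEmbedding : Set (AlmostPositiveRoot G)))
  refine and_congr (by simp) ⟨fun h a ha b hb => ?_, fun h α hα β hβ => ?_⟩
  · obtain ⟨α, hα, rfl⟩ := Finset.mem_map.1 (Finset.mem_coe.1 ha)
    obtain ⟨β, hβ, rfl⟩ := Finset.mem_map.1 (Finset.mem_coe.1 hb)
    exact (hdeg α β).trans (h α hα β hβ)
  · exact (hdeg α β).symm.trans (h (e α) (Finset.mem_coe.2 (Finset.mem_map_of_mem _ hα)) (e β)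
      (Finset.mem_coe.2 (Finset.mem_map_of_mem _ hβ)))
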